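/- Let $\Omega\subset\mathbb R^2$ be open (an interior or exterior domain) with bounded boundary, such that near each $b\in\partial\Omega$ there are an orthonormal frame $(\tau,\nu)$ and a $C^\infty$ function $\gamma$ with $\gamma(0)=\gamma'(0)=0$ for which, in the coordinates $\xi=(y-b)\cdot\tau$, $\eta=(y-b)\cdot\nu$, the set $\Omega$ coincides near $b$ with $\{\eta>\gamma(\xi)\}$. Thus $\tau$ is tangent and $\nu$ is the inward normal at $b$, and $\kappa_b:=\gamma''(0)$ is the curvature of $\partial\Omega$ at $b$ (positive for a disc). Let $f$ be smooth up to the boundary: on $\Omega$ it agrees with a $C^\infty$ function $F:\mathbb R^2\to\mathbb R$ all of whose derivatives are bounded on $\Omega$ (automatic if $\Omega$ is bounded). No condition is put on $f$ outside $\Omega$. For $\delta>0$ let $$\mathcal V_L[f](x)=\int_0^\delta\!\int_\Omega\frac{e^{-\|x-y\|^2/4t}}{4\pi t}\,f(y)\,dy\,dt .$$ Write $\operatorname{erf}(s)=\frac{2}{\sqrt\pi}\int_0^s e^{-u^2}du$ and $\operatorname{erfc}=1-\operatorname{erf}$. (1) For $x\in\Omega$ let $b$ be a closest boundary point, $r=\|b-x\|$,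 $c=r/\sqrt\delta$, and let $f,f_\eta,f_{\xi\xi},f_{\eta\eta}$ be the value and the derivatives of $f$ at $x$ in the directions $\xi$ (along $\tau$) and $\eta$ (along $\nu$) of the frame at $b$. Then, as $\delta\to0^+$, $$\begin{aligned}\mathcal V_L[f](x)={}&\frac\delta4\Big(2\operatorname{erf}\big(\tfrac c2\big)+\frac{2c\,e^{-c^2/4}}{\sqrt\pi}-c^2\operatorname{erfc}\big(\tfrac c2\big)+2\Big)f\\&-\delta^{3/2}\,\frac{\big((4-2c^2)e^{-c^2/4}+\sqrt\pi\,c^3\operatorname{erfc}(\frac c2)\big)(\kappa_bf-2f_\eta)}{12\sqrt\pi}\\&+\frac{\delta^2}{48}\Big(\operatorname{erfc}\big(\tfrac c2\big)\big(4c^4\kappa_bf_\eta-3(c^4+4)f_{\eta\eta}+(c^4-12)f_{\xi\xi}-3c^4\kappa_b^2f\big)\\&\qquad+\frac{2c(c^2-2)e^{-c^2/4}(-4\kappa_bf_\eta+3f_{\eta\eta}-f_{\xi\xi}+3\kappa_b^2f)}{\sqrt\pi}+24(f_{\xi\xi}+f_{\eta\eta})\Big)+O(\delta^{5/2}),\end{aligned}$$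 uniformly in $x\in\Omega$ (for every closest point $b$ and every such frame): the constant in $O$ and the range $0<\delta\le\delta_0$ depend only on $\Omega$, $f$ and $F$. (2) There are $C$ and $\delta_0>0$ such that, for $0<\delta\le\delta_0$, every $x\in\Omega$ with $d=\operatorname{dist}(x,\partial\Omega)>12\sqrt\delta$ and every orthonormal frame $(\xi,\eta)$, $$\Big|\mathcal V_L[f](x)-\delta f-\frac{\delta^2}{2}(f_{\xi\xi}+f_{\eta\eta})\Big|\le C\big(\delta^3+\delta\,e^{-d^2/4\delta}\big),$$ with $f$ and its derivatives taken at $x$. In particular, for each fixed $x\in\Omega$, $\mathcal V_L[f](x)=\delta f+\frac{\delta^2}{2}(f_{\xi\xi}+f_{\eta\eta})+O(\delta^3)$ as $\delta\to0^+$. (3) For $b\in\partial\Omega$, with $f,f_\eta,f_{\xi\xi},f_{\eta\eta}$ the values at $b$ of $F$ and its derivatives in the frame at $b$, uniformly in $b$ as $\delta\to0^+$, $$\mathcal V_L[f](b)=\frac\delta2f+\frac{\delta^{3/2}}{3\sqrt\pi}(2f_\eta-\kappa_bf)+\frac{\delta^2}{4}(f_{\xi\xi}+f_{\eta\eta})+O(\delta^{5/2}).$$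 -/

import Mathlib

open scoped ContDiff

namespace HeatVol

/-- The Euclidean plane. -/
abbrev Plane : Type := EuclideanSpace ℝ (Fin 2)

/-- The error function `erf x = (2 / √π) ∫₀ˣ e^{-s²} ds`. -/
noncomputable def erf (x : ℝ) : ℝ :=
  2 / Real.sqrt Real.pi * ∫ s in (0 : ℝ)..x, Real.exp (-s ^ 2)

/-- The complementary error function. -/
noncomputable def erfc (x : ℝ) : ℝ := 1 - erf x

/-- The local part of the volume heat potential,
`V_L[f](x) = ∫₀^δ ∫_Ω e^{-‖x - y‖² / 4t} / (4 π t) f(y) dy dt`. -/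
noncomputable def localVolumePotential (Ω : Set Plane) (f : Plane → ℝ) (δ : ℝ) (x : Plane) : ℝ :=
  ∫ t in (0 : ℝ)..δ, ∫ y in Ω,
    Real.exp (-‖x - y‖ ^ 2 / (4 * t)) / (4 * Real.pi * t) * f y

/-- `(τ, ν)` is an orthonormal frame at the boundary point `b` of `Ω` for which `τ` is tangent and
`ν` is the inward normal, and, in the coordinates `ξ = ⟪y - b, τ⟫`, `η = ⟪y - b, ν⟫` centred at
`b`, the set `Ω` is given near `b` by `η > γ(ξ)`, with `γ` smooth and `γ(0) = γ'(0) = 0`.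
The curvature of the boundary at `b` is then `γ''(0)` (it is positive for a disc). -/
structure IsTangentGraph (Ω : Set Plane) (b τ ν : Plane) (γ : ℝ → ℝ) : Prop where
  orthonormal : Orthonormal ℝ ![τ, ν]
  smooth : ContDiff ℝ ∞ γ
  map_zero : γ 0 = 0
  deriv_zero : deriv γ 0 = 0
  mem_iff : ∃ ρ : ℝ, 0 < ρ ∧ ∀ y ∈ Metric.ball b ρ,
    (y ∈ Ω ↔ γ (inner ℝ (y - b) τ) < inner ℝ (y - b) ν)

/-- Interior or exterior domains with smooth boundary: open sets with bounded boundary which near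
each boundary point lie on one side of the boundary, the boundary being there a smooth graph over
its tangent line. -/
structure IsSmoothDomain (Ω : Set Plane) : Prop where
  isOpen : IsOpen Ω
  bounded_frontier : Bornology.IsBounded (frontier Ω)
  exists_graph : ∀ b ∈ frontier Ω, ∃ (τ ν : Plane) (γ : ℝ → ℝ), IsTangentGraph Ω b τ ν γ

/-- `F` is a smooth function on the plane which agrees with `f` on `Ω` and all of whose
derivatives are bounded on `Ω` (the bounds are automatic if `Ω` is bounded). -/
structure IsSmoothExtension (Ω : Set Plane) (f F : Plane → ℝ) : Prop where
  smooth : ContDiff ℝ ∞ F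
  eqOn : Set.EqOn f F Ω
  bounded : ∀ n : ℕ, ∃ M : ℝ, ∀ y ∈ Ω, ‖iteratedFDeriv ℝ n F y‖ ≤ M

/-- `b` is a point of the boundary of `Ω` at minimal distance from `x`. -/
def IsClosestBoundaryPoint (Ω : Set Plane) (x b : Plane) : Prop :=
  b ∈ frontier Ω ∧ ∀ b' ∈ frontier Ω, dist x b ≤ dist x b'

/-- First directional derivative of `f` at `x` along `u`. -/
noncomputable def D1 (f : Plane → ℝ) (x u : Plane) : ℝ := fderiv ℝ f x u

/-- Second directional derivative of `f` at `x` along `u` and `v`. -/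
noncomputable def D2 (f : Plane → ℝ) (x u v : Plane) : ℝ := iteratedFDeriv ℝ 2 f x ![u, v]

/-- The three-term expansion of the local volume heat potential at a point whose distance to the
boundary is `c √δ`, in terms of the curvature `κ` at the closest boundary point and of the Taylor
coefficients `f₀ = f`, `fη`, `fξξ`, `fηη` of the source at the target point. -/
noncomputable def expansion (δ c κ f₀ fη fξξ fηη : ℝ) : ℝ :=
  δ / 4 * (2 * erf (c / 2) + 2 * Real.exp (-c ^ 2 / 4) * c / Real.sqrt Real.pi
      - c ^ 2 * erfc (c / 2) + 2) * f₀
  - δ ^ (3 / 2 : ℝ) * (((4 - 2 * c ^ 2) * Real.exp (-c ^ 2 / 4)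
      + Real.sqrt Real.pi * c ^ 3 * erfc (c / 2)) * (κ * f₀ - 2 * fη)
      / (12 * Real.sqrt Real.pi))
  + δ ^ 2 / 48 * (erfc (c / 2) * (4 * c ^ 4 * κ * fη - 3 * (c ^ 4 + 4) * fηη
        + (c ^ 4 - 12) * fξξ - 3 * c ^ 4 * κ ^ 2 * f₀)
      + 2 * c * (c ^ 2 - 2) * Real.exp (-c ^ 2 / 4)
        * (-4 * κ * fη + 3 * fηη - fξξ + 3 * κ ^ 2 * f₀) / Real.sqrt Real.pi
      + 24 * (fξξ + fηη))

end HeatVol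

/-! Put `h = √t`. The substitution `y = x + h z` turns the inner integral into `scaledIntegral`, a
Gaussian average of `F` over the rescaled domain. The heart of the proof is that it equals `profile
h r …` up to `O(h ^ 3)`, uniformly in `x`. Since `h ^ 3 ≤ √δ ^ 3` for `t ≤ δ`, integration in time
leaves an error `O(δ ^ (5 / 2))`, and the time integral of `profile` is exactly `expansion`, because
`profilePrimitive` is an explicit antiderivative (`integral_profile`).

Near the boundary (`exists_near_bound`), a closest point `b` gives `x = b + r ν`, and in the frame
at `b` the boundary is a cubic graph up to a quartic error. After scaling, that error is a strip of
Gaussian mass `O(h ^ 3)` (`exists_strip_bound`), and replacing `F` by its quadratic Taylor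
polynomial at `x` also costs `O(h ^ 3)`. What is left is a quadratic source above a cubic graph
(`exists_model_bound`). The normal integral is explicit in terms of `tail`, `gau` and `tailTwo` at
the height of the graph. These functions have bounded derivatives on the whole line, so they can be
expanded about `-r / h` uniformly in `r / h`. A quartic polynomial in the tangential variable
remains; its odd moments vanish, which is why the cubic coefficient of the graph does not enter the
result.

Uniformity in `b` is the delicate point (`exists_isSqueezedGraph`): each frame at each `b` comes
with its own `γ`, which describes the domain only in a ball of uncontrolled size. Near a fixed `b₀`
one graph supplies a defining function `φ` of the domain. Along a polynomial curve osculating the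
boundary at `b`, `φ` is a smooth function of finitely many bounded parameters, so its order of
vanishing becomes a uniform estimate. As `φ` grows at rate at least `1 / 2` in the normal direction,
this bounds the Taylor coefficients of `γ` one after the other and traps the domain between two
explicit graphs; compactness of the boundary concludes.

Away from the boundary (`exists_far_bound`), a disc of radius `R` about `x` lies in the domain. The
cubic Taylor polynomial is integrated over the whole plane, its odd terms vanish, and the error is
`h ^ 4` plus the Gaussian mass outside the disc. At a fixed positive distance the boundary layers in
`profile` are `O(h ^ 3)` (`exists_profile_far_bound`), so the two regimes agree. -/

namespace HeatVol

open MeasureTheory Set Filter Topology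

/-! ### One-dimensional Gaussian integrals -/

/-- The density of the centred normal law of variance `2`. -/
noncomputable def gau (u : ℝ) : ℝ := Real.exp (-u ^ 2 / 4) / (2 * √Real.pi)

/-- The upper tail of the centred normal law of variance `2`. -/
noncomputable def tail (s : ℝ) : ℝ := erfc (s / 2) / 2

lemma gau_pos (u : ℝ) : 0 < gau u := by unfold gau; positivity

lemma gau_nonneg (u : ℝ) : 0 ≤ gau u := (gau_pos u).le

@[simp] lemma gau_neg (u : ℝ) : gau (-u) = gau u := by simp [gau]

@[fun_prop] lemma continuous_gau : Continuous gau := by unfold gau; fun_prop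

lemma hasDerivAt_gau (u : ℝ) : HasDerivAt gau (-(u / 2) * gau u) u := by
  have h : HasDerivAt (fun u : ℝ => -u ^ 2 / 4) (-(u / 2)) u := by
    have := ((hasDerivAt_pow 2 u).neg).div_const 4
    refine this.congr_deriv ?_
    push_cast; ring
  have := (h.exp).div_const (2 * √Real.pi)
  refine this.congr_deriv ?_
  unfold gau
  ring

lemma hasDerivAt_erf (x : ℝ) :
    HasDerivAt erf (2 / √Real.pi * Real.exp (-x ^ 2)) x := by
  have hc : Continuous fun s : ℝ => Real.exp (-s ^ 2) := by fun_prop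
  exact (hc.integral_hasStrictDerivAt 0 x).hasDerivAt.const_mul _

lemma hasDerivAt_tail (s : ℝ) : HasDerivAt tail (-gau s) s := by
  have h := (hasDerivAt_erf (s / 2)).comp s ((hasDerivAt_id s).div_const 2)
  have h2 := (h.const_sub 1).div_const 2
  refine h2.congr_deriv ?_
  have : -(s / 2) ^ 2 = -s ^ 2 / 4 := by ring
  rw [this]
  unfold gau
  ring

@[fun_prop] lemma continuous_tail : Continuous tail :=
  continuous_iff_continuousAt.2 fun s => (hasDerivAt_tail s).continuousAt

lemma erf_neg (x : ℝ) : erf (-x) = -erf x := by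
  unfold erf
  have h := intervalIntegral.integral_comp_neg (a := 0) (b := x)
    (fun s : ℝ => Real.exp (-s ^ 2))
  simp only [neg_sq, neg_zero] at h
  rw [h, intervalIntegral.integral_symm]
  ring

lemma tail_neg (s : ℝ) : tail (-s) = 1 - tail s := by
  unfold tail erfc
  rw [neg_div, erf_neg]
  ring

lemma tendsto_erf : Tendsto erf atTop (𝓝 1) := by
  have hi : IntegrableOn (fun s : ℝ => Real.exp (-s ^ 2)) (Ioi 0) := by
    have := (integrable_exp_neg_mul_sq (b := 1) one_pos).integrableOn (s := Ioi 0)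
    simpa using this
  have h := intervalIntegral_tendsto_integral_Ioi 0 hi tendsto_id
  have hv : ∫ s in Ioi (0 : ℝ), Real.exp (-s ^ 2) = √Real.pi / 2 := by
    have := integral_gaussian_Ioi 1
    simpa using this
  rw [hv] at h
  have h2 := h.const_mul (2 / √Real.pi)
  have hp : √Real.pi ≠ 0 := by positivity
  have he : 2 / √Real.pi * (√Real.pi / 2) = 1 := by field_simp
  rw [he] at h2
  exact h2

lemma tendsto_tail : Tendsto tail atTop (𝓝 0) := by
  have h := tendsto_erf.comp (tendsto_id.atTop_div_const (r := (2 : ℝ)) two_pos)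
  have h2 := (h.const_sub 1).div_const 2
  simp only [sub_self, zero_div] at h2
  exact h2

lemma tendsto_pow_mul_gau (k : ℕ) : Tendsto (fun u => u ^ k * gau u) atTop (𝓝 0) := by
  have h := (Real.tendsto_pow_mul_exp_neg_atTop_nhds_zero k)
  have h2 : Tendsto (fun u : ℝ => (u ^ k * Real.exp (-u)) * (1 / (2 * √Real.pi))) atTop (𝓝 0) := by
    simpa using h.mul_const (1 / (2 * √Real.pi))
  refine squeeze_zero' ?_ ?_ h2
  · filter_upwards [eventually_ge_atTop 0] with u hu
    exact mul_nonneg (pow_nonneg hu k) (gau_nonneg u)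
  · filter_upwards [eventually_ge_atTop 4] with u hu
    have h3 : Real.exp (-u ^ 2 / 4) ≤ Real.exp (-u) := Real.exp_le_exp.2 (by nlinarith)
    have h4 : 0 ≤ u ^ k := pow_nonneg (by linarith) k
    unfold gau
    rw [mul_assoc, ← mul_one_div (Real.exp (-u ^ 2 / 4))]
    gcongr

lemma integrable_pow_mul_gau (k : ℕ) : Integrable fun u => u ^ k * gau u := by
  have h := integrable_rpow_mul_exp_neg_mul_sq (b := 1 / 4) (by norm_num) (s := k)
    (by have : (0 : ℝ) ≤ k := Nat.cast_nonneg k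
        linarith)
  have h2 := h.mul_const (1 / (2 * √Real.pi))
  refine h2.congr (Eventually.of_forall fun u => ?_)
  simp only [Real.rpow_natCast, gau]
  rw [show -(1 / 4) * u ^ 2 = -u ^ 2 / 4 by ring]
  ring

lemma integrable_gau : Integrable gau := by simpa using integrable_pow_mul_gau 0

lemma integral_gau : ∫ u, gau u = 1 := by
  have h := integral_gaussian (1 / 4)
  unfold gau
  rw [integral_div]
  have : (fun u : ℝ => Real.exp (-u ^ 2 / 4)) = fun u => Real.exp (-(1 / 4) * u ^ 2) := by
    ext u; congr 1; ring
  rw [this, h, show Real.pi / (1 / 4) = 2 ^ 2 * Real.pi by ring,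
    Real.sqrt_mul (by positivity), Real.sqrt_sq (by norm_num)]
  exact div_self (by positivity)

/-- The derivative of `u ^ (k + 1) * gau u` has integral zero, which links moments two degrees
apart. -/
lemma integral_pow_succ_succ_mul_gau (k : ℕ) :
    ∫ u, u ^ (k + 2) * gau u = 2 * (k + 1) * ∫ u, u ^ k * gau u := by
  have hd : ∀ u : ℝ, HasDerivAt (fun u => u ^ (k + 1) * gau u)
      ((k + 1) * (u ^ k * gau u) - 1 / 2 * (u ^ (k + 2) * gau u)) u := by
    intro u
    refine ((hasDerivAt_pow (k + 1) u).mul (hasDerivAt_gau u)).congr_deriv ?_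
    push_cast
    ring
  have h := integral_eq_zero_of_hasDerivAt_of_integrable hd
    (((integrable_pow_mul_gau k).const_mul _).sub ((integrable_pow_mul_gau (k + 2)).const_mul _))
    (integrable_pow_mul_gau (k + 1))
  rw [integral_sub ((integrable_pow_mul_gau k).const_mul _)
    ((integrable_pow_mul_gau (k + 2)).const_mul _), integral_const_mul, integral_const_mul] at h
  linarith

lemma integral_id_mul_gau : ∫ u, u * gau u = 0 := by
  have hd : ∀ u : ℝ, HasDerivAt gau (-(1 / 2) * (u ^ 1 * gau u)) u := by
    intro u
    refine (hasDerivAt_gau u).congr_deriv ?_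
    ring
  have h := integral_eq_zero_of_hasDerivAt_of_integrable hd
    ((integrable_pow_mul_gau 1).const_mul _) integrable_gau
  rw [integral_const_mul] at h
  simp only [pow_one] at h
  linarith

lemma integral_sq_mul_gau : ∫ u, u ^ 2 * gau u = 2 := by
  have := integral_pow_succ_succ_mul_gau 0
  simpa [integral_gau] using this

lemma integral_cube_mul_gau : ∫ u, u ^ 3 * gau u = 0 := by
  have := integral_pow_succ_succ_mul_gau 1
  simpa [integral_id_mul_gau] using this

lemma integral_fourth_mul_gau : ∫ u, u ^ 4 * gau u = 12 := by
  have := integral_pow_succ_succ_mul_gau 2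
  rw [integral_sq_mul_gau] at this
  norm_num at this ⊢
  exact this

/-- Gaussian integral of a polynomial of degree four. -/
lemma integral_quartic_mul_gau (a₀ a₁ a₂ a₃ a₄ : ℝ) :
    ∫ u, (a₀ + a₁ * u + a₂ * u ^ 2 + a₃ * u ^ 3 + a₄ * u ^ 4) * gau u
      = a₀ + 2 * a₂ + 12 * a₄ := by
  have e : (fun u => (a₀ + a₁ * u + a₂ * u ^ 2 + a₃ * u ^ 3 + a₄ * u ^ 4) * gau u)
      = fun u => a₀ * (u ^ 0 * gau u) + a₁ * (u ^ 1 * gau u) + a₂ * (u ^ 2 * gau u)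
        + a₃ * (u ^ 3 * gau u) + a₄ * (u ^ 4 * gau u) := by
    ext u; ring
  have i := fun (a : ℝ) k => (integrable_pow_mul_gau k).const_mul a
  rw [e, integral_add (by exact (((i _ 0).add (i _ 1)).add (i _ 2)).add (i _ 3)) (i _ 4),
    integral_add (by exact ((i _ 0).add (i _ 1)).add (i _ 2)) (i _ 3),
    integral_add (by exact (i _ 0).add (i _ 1)) (i _ 2), integral_add (i _ 0) (i _ 1)]
  simp only [integral_const_mul, pow_zero, pow_one, one_mul, integral_gau, integral_id_mul_gau,
    integral_sq_mul_gau, integral_cube_mul_gau, integral_fourth_mul_gau]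
  ring

lemma integrable_quartic_mul_gau (a₀ a₁ a₂ a₃ a₄ : ℝ) :
    Integrable fun u => (a₀ + a₁ * u + a₂ * u ^ 2 + a₃ * u ^ 3 + a₄ * u ^ 4) * gau u := by
  have e : (fun u => (a₀ + a₁ * u + a₂ * u ^ 2 + a₃ * u ^ 3 + a₄ * u ^ 4) * gau u)
      = fun u => a₀ * (u ^ 0 * gau u) + a₁ * (u ^ 1 * gau u) + a₂ * (u ^ 2 * gau u)
        + a₃ * (u ^ 3 * gau u) + a₄ * (u ^ 4 * gau u) := by
    ext u; ring
  have i := fun (a : ℝ) k => (integrable_pow_mul_gau k).const_mul a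
  rw [e]
  exact ((((i _ 0).add (i _ 1)).add (i _ 2)).add (i _ 3)).add (i _ 4)

/-- Gaussian integral of a quadratic polynomial over a half-line. -/
lemma integral_Ioi_quadratic_mul_gau (α β γ s : ℝ) :
    ∫ w in Ioi s, (α + β * w + γ * w ^ 2) * gau w
      = α * tail s + β * (2 * gau s) + γ * (2 * s * gau s + 2 * tail s) := by
  -- `-A` is an antiderivative vanishing at infinity, found from `tail' = -gau` and `gau' = -(w / 2)
  -- gau`.
  set A : ℝ → ℝ := fun s => α * tail s + β * (2 * gau s) + γ * (2 * s * gau s + 2 * tail s)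
  have hd : ∀ w ∈ Ici s, HasDerivAt (fun w => -A w) ((α + β * w + γ * w ^ 2) * gau w) w := by
    intro w _
    have h := ((((hasDerivAt_tail w).const_mul α).add (((hasDerivAt_gau w).const_mul 2).const_mul β)).add
      (((((hasDerivAt_id w).const_mul 2).mul (hasDerivAt_gau w)).add
        ((hasDerivAt_tail w).const_mul 2)).const_mul γ)).neg
    refine h.congr_deriv ?_
    simp only [id]
    ring
  have hint : IntegrableOn (fun w => (α + β * w + γ * w ^ 2) * gau w) (Ioi s) := by
    have := integrable_quartic_mul_gau α β γ 0 0
    simp only [zero_mul, add_zero] at this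
    exact this.integrableOn
  have hlim : Tendsto (fun w => -A w) atTop (𝓝 0) := by
    have h0 : Tendsto gau atTop (𝓝 0) := by simpa using tendsto_pow_mul_gau 0
    have h1 : Tendsto (fun w => 2 * w * gau w) atTop (𝓝 0) := by
      simpa [mul_assoc] using (tendsto_pow_mul_gau 1).const_mul 2
    have h2 := (((tendsto_tail.const_mul α).add ((h0.const_mul 2).const_mul β)).add
      ((h1.add (tendsto_tail.const_mul 2)).const_mul γ)).neg
    simp only [mul_zero, add_zero, neg_zero] at h2
    exact h2
  rw [integral_Ioi_of_hasDerivAt_of_tendsto' hd hint hlim]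
  ring

lemma integral_Ioi_gau (s : ℝ) : ∫ w in Ioi s, gau w = tail s := by
  simpa using integral_Ioi_quadratic_mul_gau 1 0 0 s

lemma tail_nonneg (s : ℝ) : 0 ≤ tail s := by
  rw [← integral_Ioi_gau]
  exact setIntegral_nonneg measurableSet_Ioi fun w _ => gau_nonneg w

lemma tail_le_one (s : ℝ) : tail s ≤ 1 := by
  have := tail_nonneg (-s)
  rw [tail_neg] at this
  linarith

lemma sqrt_pi_ge_one : 1 ≤ √Real.pi := by
  rw [Real.one_le_sqrt]; linarith [Real.pi_gt_three]

/-- Polynomial weights are absorbed by the Gaussian density. -/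
lemma exists_pow_mul_gau_le (k : ℕ) : ∃ C, 0 < C ∧ ∀ u, |u| ^ k * gau u ≤ C := by
  -- From `x ^ k / k! ≤ exp x` at `x = |u| / 4`; the surplus exponential is harmless because `|u| /
  -- 4 - u ^ 2 / 4 ≤ 1 / 16`.
  refine ⟨4 ^ k * k.factorial, by positivity, fun u => ?_⟩
  have h0 := abs_nonneg u
  have h1 : (|u| / 4) ^ k / k.factorial ≤ Real.exp (|u| / 4) :=
    Real.pow_div_factorial_le_exp _ (by positivity) k
  have h2 : |u| ^ k ≤ 4 ^ k * k.factorial * Real.exp (|u| / 4) := by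
    have h3 : (|u| / 4) ^ k ≤ Real.exp (|u| / 4) * k.factorial :=
      (div_le_iff₀ (by positivity)).1 h1
    have h4 : |u| ^ k = 4 ^ k * (|u| / 4) ^ k := by rw [← mul_pow]; congr 1; ring
    rw [h4, mul_assoc]
    gcongr
    linarith
  have h5 : gau u ≤ Real.exp (-u ^ 2 / 4) / 2 := by
    unfold gau
    gcongr
    linarith [sqrt_pi_ge_one]
  have h6 : Real.exp (|u| / 4) * Real.exp (-u ^ 2 / 4) ≤ 2 := by
    rw [← Real.exp_add]
    have h7 : |u| / 4 + -u ^ 2 / 4 ≤ 1 / 16 := by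
      rw [← sq_abs u]; nlinarith [sq_nonneg (|u| - 1 / 2)]
    calc _ ≤ Real.exp (1 / 16) := Real.exp_le_exp.2 h7
      _ ≤ 2 := by
        have := Real.exp_bound_div_one_sub_of_interval (x := 1 / 16) (by norm_num) (by norm_num)
        linarith [show (1 : ℝ) / (1 - 1 / 16) ≤ 2 by norm_num]
  calc |u| ^ k * gau u ≤ (4 ^ k * k.factorial * Real.exp (|u| / 4))
        * (Real.exp (-u ^ 2 / 4) / 2) := by
        gcongr
        exact gau_nonneg u
    _ = 4 ^ k * k.factorial * (Real.exp (|u| / 4) * Real.exp (-u ^ 2 / 4)) / 2 := by ring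
    _ ≤ 4 ^ k * k.factorial * 2 / 2 := by gcongr
    _ = _ := by ring

lemma gau_le_one (u : ℝ) : gau u ≤ 1 := by
  unfold gau
  rw [div_le_one (by positivity)]
  have : Real.exp (-u ^ 2 / 4) ≤ 1 := Real.exp_le_one_iff.2 (by nlinarith [sq_nonneg u])
  linarith [sqrt_pi_ge_one]

/-- On the half-line beyond `s` one has `s ≤ w`, and the first moment there is `2 * gau s`. This
turns bounds for `gau` into bounds for `tail`. -/
lemma mul_tail_le (s : ℝ) : s * tail s ≤ 2 * gau s := by
  have h1 := integral_Ioi_quadratic_mul_gau 1 0 0 s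
  have h2 := integral_Ioi_quadratic_mul_gau 0 1 0 s
  have h3 : ∫ w in Ioi s, s * gau w ≤ ∫ w in Ioi s, w * gau w := by
    refine setIntegral_mono_on (integrable_gau.const_mul s).integrableOn ?_ measurableSet_Ioi ?_
    · simpa using (integrable_pow_mul_gau 1).integrableOn
    · intro w hw
      exact mul_le_mul_of_nonneg_right (le_of_lt hw) (gau_nonneg w)
  rw [integral_const_mul, integral_Ioi_gau] at h3
  simp only [zero_add, zero_mul, one_mul, add_zero] at h2
  linarith

lemma exists_pow_mul_tail_le (k : ℕ) : ∃ C, 0 < C ∧ ∀ s, 0 ≤ s → s ^ k * tail s ≤ C := by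
  rcases k with _ | k
  · exact ⟨1, one_pos, fun s _ => by simpa using tail_le_one s⟩
  · obtain ⟨C, hC, h⟩ := exists_pow_mul_gau_le k
    refine ⟨2 * C, by positivity, fun s hs => ?_⟩
    have h1 := mul_tail_le s
    have h2 := h s
    rw [abs_of_nonneg hs] at h2
    calc s ^ (k + 1) * tail s = s ^ k * (s * tail s) := by ring
      _ ≤ s ^ k * (2 * gau s) := by gcongr
      _ ≤ 2 * C := by linarith

/-! ### Integration of the expansion of the inner integral in time -/

/-- The expansion, in powers of `h = √t`, of the spatial integral of the heat kernel against the
source, at distance `r` from the boundary. -/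
noncomputable def profile (h r κ f₀ fη fξξ fηη : ℝ) : ℝ :=
  f₀ * (1 - tail (r / h)) + h * gau (r / h) * (2 * fη - κ * f₀)
    + h ^ 2 * (fξξ + fηη) * (1 - tail (r / h))
    + h * r * gau (r / h) * (κ * fη - fηη - 3 / 4 * κ ^ 2 * f₀)

/-- A primitive in time of `profile (√t)`. -/
noncomputable def profilePrimitive (r κ f₀ fη fξξ fηη t : ℝ) : ℝ :=
  f₀ * (t * (1 - tail (r / √t)) + r * √t * gau (r / √t) - r ^ 2 * tail (r / √t) / 2)
  + (2 * fη - κ * f₀ + r * (κ * fη - fηη - 3 / 4 * κ ^ 2 * f₀))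
    * (((4 * t - 2 * r ^ 2) * √t * gau (r / √t) + r ^ 3 * tail (r / √t)) / 6)
  + (fξξ + fηη) * (((r ^ 4 - 12 * t ^ 2) * tail (r / √t)
      - 2 * r * √t * (r ^ 2 - 2 * t) * gau (r / √t)) / 24 + t ^ 2 / 2)

lemma hasDerivAt_div_sqrt (r : ℝ) {t : ℝ} (ht : 0 < t) :
    HasDerivAt (fun t => r / √t) (-(r / (2 * √t ^ 3))) t := by
  have h0 : √t ≠ 0 := (Real.sqrt_pos.2 ht).ne'
  refine ((hasDerivAt_const t r).div (Real.hasDerivAt_sqrt ht.ne') h0).congr_deriv ?_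
  field_simp
  ring

lemma hasDerivAt_profilePrimitive (r κ f₀ fη fξξ fηη : ℝ) {t : ℝ} (ht : 0 < t) :
    HasDerivAt (profilePrimitive r κ f₀ fη fξξ fηη) (profile (√t) r κ f₀ fη fξξ fηη) t := by
  have h0 : √t ≠ 0 := (Real.sqrt_pos.2 ht).ne'
  have hρ := hasDerivAt_div_sqrt r ht
  have hT := (hasDerivAt_tail (r / √t)).comp t hρ
  have hg := (hasDerivAt_gau (r / √t)).comp t hρ
  have hs := Real.hasDerivAt_sqrt ht.ne'
  have hi := hasDerivAt_id t
  have h1 := (((hi.mul (hT.const_sub 1)).add ((hs.const_mul r).mul hg)).sub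
    ((hT.const_mul (r ^ 2)).div_const 2)).const_mul f₀
  have h2 := (((((hi.const_mul 4).sub_const (2 * r ^ 2)).mul hs).mul hg).add
    (hT.const_mul (r ^ 3))).div_const 6
  have h3 := ((((((hi.pow 2).const_mul 12).const_sub (r ^ 4)).mul hT).sub
    (((hs.const_mul (2 * r)).mul ((hi.const_mul 2).const_sub (r ^ 2))).mul hg)).div_const 24).add
    ((hi.pow 2).div_const 2)
  have h := (h1.add (h2.const_mul (2 * fη - κ * f₀ + r * (κ * fη - fηη - 3 / 4 * κ ^ 2 * f₀)))).add
    (h3.const_mul (fξξ + fηη))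
  refine h.congr_deriv ?_
  -- With `√t`, `gau` and `tail` replaced by free variables, the claim is an identity of rational
  -- functions.
  have ht2 : t = √t ^ 2 := (Real.sq_sqrt ht.le).symm
  simp only [id, Function.comp, Pi.mul_apply, Pi.pow_apply]
  unfold profile
  generalize gau (r / √t) = g
  generalize tail (r / √t) = T
  generalize √t = s at *
  subst ht2
  push_cast
  field_simp
  ring

lemma measurable_profile (r κ f₀ fη fξξ fηη : ℝ) :
    Measurable fun t : ℝ => profile (√t) r κ f₀ fη fξξ fηη := by
  have h1 : Measurable fun t : ℝ => r / √t := by fun_prop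
  have h2 : Measurable fun t : ℝ => gau (r / √t) := continuous_gau.measurable.comp h1
  have h3 : Measurable fun t : ℝ => tail (r / √t) := continuous_tail.measurable.comp h1
  unfold profile
  fun_prop

lemma abs_profile_le {h : ℝ} (h0 : 0 ≤ h) {r : ℝ} (hr : 0 ≤ r) (κ f₀ fη fξξ fηη : ℝ) :
    |profile h r κ f₀ fη fξξ fηη| ≤ |f₀| + h * |2 * fη - κ * f₀| + h ^ 2 * |fξξ + fηη|
      + h * r * |κ * fη - fηη - 3 / 4 * κ ^ 2 * f₀| := by
  have hT : |1 - tail (r / h)| ≤ 1 := by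
    rw [abs_le]; constructor <;> linarith [tail_nonneg (r / h), tail_le_one (r / h)]
  have hg : |gau (r / h)| ≤ 1 := by
    rw [abs_of_nonneg (gau_nonneg _)]; exact gau_le_one _
  unfold profile
  refine (abs_add_le _ _).trans (add_le_add ((abs_add_le _ _).trans (add_le_add
    ((abs_add_le _ _).trans (add_le_add ?_ ?_)) ?_)) ?_)
  · rw [abs_mul]; exact mul_le_of_le_one_right (abs_nonneg _) hT
  · rw [abs_mul, abs_mul, abs_of_nonneg h0]
    exact mul_le_mul_of_nonneg_right (mul_le_of_le_one_right h0 hg) (abs_nonneg _)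
  · rw [abs_mul, abs_mul, abs_of_nonneg (sq_nonneg h)]
    exact mul_le_of_le_one_right (by positivity) hT
  · rw [abs_mul, abs_mul, abs_of_nonneg (mul_nonneg h0 hr)]
    exact mul_le_mul_of_nonneg_right (mul_le_of_le_one_right (by positivity) hg) (abs_nonneg _)

lemma intervalIntegrable_profile {r : ℝ} (hr : 0 ≤ r) (κ f₀ fη fξξ fηη : ℝ) {δ : ℝ} (hδ : 0 ≤ δ) :
    IntervalIntegrable (fun t : ℝ => profile (√t) r κ f₀ fη fξξ fηη) volume 0 δ := by
  rw [intervalIntegrable_iff_integrableOn_Ioc_of_le hδ]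
  refine Measure.integrableOn_of_bounded (M := |f₀| + √δ * |2 * fη - κ * f₀|
      + √δ ^ 2 * |fξξ + fηη| + √δ * r * |κ * fη - fηη - 3 / 4 * κ ^ 2 * f₀|) (by simp)
    (measurable_profile _ _ _ _ _ _).aestronglyMeasurable ?_
  refine (ae_restrict_mem measurableSet_Ioc).mono fun t ht => ?_
  refine (abs_profile_le (Real.sqrt_nonneg t) hr _ _ _ _ _).trans ?_
  have := Real.sqrt_le_sqrt ht.2
  gcongr

lemma tendsto_profilePrimitive_zero {r : ℝ} (hr : 0 ≤ r) (κ f₀ fη fξξ fηη : ℝ) :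
    Tendsto (profilePrimitive r κ f₀ fη fξξ fηη) (𝓝[>] 0) (𝓝 0) := by
  have ht : Tendsto (fun t : ℝ => t) (𝓝[>] 0) (𝓝 0) := tendsto_id.mono_left nhdsWithin_le_nhds
  have hs : Tendsto (fun t : ℝ => √t) (𝓝[>] 0) (𝓝 0) := by
    have := (Real.continuous_sqrt.tendsto 0).mono_left (nhdsWithin_le_nhds (s := Ioi 0))
    simpa using this
  -- For `r = 0` the argument `r / √t` stays at `0` and every term carries a positive power of `t`;
  -- for `r > 0` it tends to infinity and `gau` and `tail` vanish in the limit.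
  rcases hr.eq_or_lt with rfl | hr
  · have h := (((ht.mul_const (1 - tail 0)).const_mul f₀).add ((((ht.const_mul 4).mul hs).mul_const
      (gau 0 / 6)).const_mul (2 * fη - κ * f₀))).add
      ((((ht.pow 2).const_mul (-12 * tail 0 / 24 + 1 / 2))).const_mul (fξξ + fηη))
    simp only [zero_mul, mul_zero, add_zero, ne_eq, OfNat.ofNat_ne_zero, not_false_eq_true,
      zero_pow] at h
    refine h.congr fun t => ?_
    simp only [profilePrimitive, zero_div]
    ring
  · have hρ : Tendsto (fun t : ℝ => r / √t) (𝓝[>] 0) atTop := by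
      refine Tendsto.const_mul_atTop hr (tendsto_inv_nhdsGT_zero.comp ?_)
      exact tendsto_nhdsWithin_iff.2 ⟨hs, eventually_mem_nhdsWithin.mono
        fun t ht => Real.sqrt_pos.2 ht⟩
    have hT := tendsto_tail.comp hρ
    have hg : Tendsto (fun t : ℝ => gau (r / √t)) (𝓝[>] 0) (𝓝 0) := by
      have := (tendsto_pow_mul_gau 0).comp hρ
      simpa [Function.comp_def] using this
    simp only [Function.comp_def] at hT
    have h1 := (((ht.mul (hT.const_sub 1)).add ((hs.const_mul r).mul hg)).sub
      ((hT.const_mul (r ^ 2)).div_const 2)).const_mul f₀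
    have h2 := (((((ht.const_mul 4).sub_const (2 * r ^ 2)).mul hs).mul hg).add
      (hT.const_mul (r ^ 3))).div_const 6
    have h3 := ((((((ht.pow 2).const_mul 12).const_sub (r ^ 4)).mul hT).sub
      (((hs.const_mul (2 * r)).mul ((ht.const_mul 2).const_sub (r ^ 2))).mul hg)).div_const 24).add
      ((ht.pow 2).div_const 2)
    have h := (h1.add (h2.const_mul
      (2 * fη - κ * f₀ + r * (κ * fη - fηη - 3 / 4 * κ ^ 2 * f₀)))).add (h3.const_mul (fξξ + fηη))
    have e : f₀ * (0 * (1 - 0) + r * 0 * 0 - r ^ 2 * 0 / 2)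
        + (2 * fη - κ * f₀ + r * (κ * fη - fηη - 3 / 4 * κ ^ 2 * f₀))
          * (((4 * 0 - 2 * r ^ 2) * 0 * 0 + r ^ 3 * 0) / 6)
        + (fξξ + fηη) * (((r ^ 4 - 12 * 0 ^ 2) * 0
          - 2 * r * 0 * (r ^ 2 - 2 * 0) * 0) / 24 + 0 ^ 2 / 2) = 0 := by ring
    rw [e] at h
    exact h

lemma expansion_eq_profilePrimitive (r κ f₀ fη fξξ fηη : ℝ) {δ : ℝ} (hδ : 0 < δ) :
    expansion δ (r / √δ) κ f₀ fη fξξ fηη = profilePrimitive r κ f₀ fη fξξ fηη δ := by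
  have h0 : √δ ≠ 0 := (Real.sqrt_pos.2 hδ).ne'
  have hp : √Real.pi ≠ 0 := by positivity
  have e1 : erf (r / √δ / 2) = 1 - 2 * tail (r / √δ) := by unfold tail erfc; ring
  have e2 : erfc (r / √δ / 2) = 2 * tail (r / √δ) := by unfold tail; ring
  have e3 : Real.exp (-(r / √δ) ^ 2 / 4) = 2 * √Real.pi * gau (r / √δ) := by
    unfold gau; field_simp
  have e4 : δ ^ (3 / 2 : ℝ) = √δ ^ 3 := by
    rw [Real.sqrt_eq_rpow, ← Real.rpow_natCast, ← Real.rpow_mul hδ.le]; norm_num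
  unfold expansion profilePrimitive
  rw [e1, e2, e3, e4]
  generalize gau (r / √δ) = g
  generalize tail (r / √δ) = T
  have hδ2 : δ = √δ ^ 2 := (Real.sq_sqrt hδ.le).symm
  generalize √δ = s at *
  subst hδ2
  field_simp
  ring

/-- The time integral of the profile is the expansion. -/
lemma integral_profile {r : ℝ} (hr : 0 ≤ r) (κ f₀ fη fξξ fηη : ℝ) {δ : ℝ} (hδ : 0 < δ) :
    ∫ t in (0 : ℝ)..δ, profile (√t) r κ f₀ fη fξξ fηη
      = expansion δ (r / √δ) κ f₀ fη fξξ fηη := by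
  rw [expansion_eq_profilePrimitive _ _ _ _ _ _ hδ]
  have h := intervalIntegral.integral_eq_sub_of_hasDerivAt_of_tendsto hδ
    (fun t ht => hasDerivAt_profilePrimitive r κ f₀ fη fξξ fηη ht.1)
    (intervalIntegrable_profile hr κ f₀ fη fξξ fηη hδ.le)
    (tendsto_profilePrimitive_zero hr κ f₀ fη fξξ fηη)
    ((hasDerivAt_profilePrimitive r κ f₀ fη fξξ fηη hδ).continuousAt.tendsto.mono_left
      nhdsWithin_le_nhds)
  rw [h, sub_zero]

/-! ### Taylor expansion of the source -/

/-- Integral form of the remainder, with the factors `1 / n!` and `(1 - t) ^ n` simply bounded by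
one. -/
lemma abs_sub_taylor_le {E : Type*} [NormedAddCommGroup E] [NormedSpace ℝ E] {F : E → ℝ}
    (hF : ContDiff ℝ ∞ F) (n : ℕ) (x y : E) {M : ℝ}
    (hM : ∀ t ∈ Icc (0 : ℝ) 1, ‖iteratedFDeriv ℝ (n + 1) F (x + t • y)‖ ≤ M) :
    |F (x + y) - ∑ k ∈ Finset.range (n + 1), (k.factorial : ℝ)⁻¹
      * iteratedFDeriv ℝ k F x (fun _ => y)| ≤ M * ‖y‖ ^ (n + 1) := by
  have h := map_add_eq_sum_add_integral_iteratedFDeriv (f := F) (x := x) (y := y) (n := n)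
    (fun t _ => (hF.of_le (by exact_mod_cast le_top)).contDiffAt)
  have hM0 : 0 ≤ M := (norm_nonneg _).trans (hM 0 (by simp))
  simp only [smul_eq_mul] at h
  rw [h, add_sub_cancel_left, abs_mul]
  have hf : |((n.factorial : ℝ))⁻¹| ≤ 1 := by
    rw [abs_of_nonneg (by positivity)]
    exact inv_le_one_of_one_le₀ (by exact_mod_cast n.factorial_pos)
  have hi : |∫ t in (0 : ℝ)..1, (1 - t) ^ n * iteratedFDeriv ℝ (n + 1) F (x + t • y) (fun _ => y)|
      ≤ M * ‖y‖ ^ (n + 1) := by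
    have := intervalIntegral.norm_integral_le_of_norm_le_const (a := (0 : ℝ)) (b := 1)
      (C := M * ‖y‖ ^ (n + 1))
      (f := fun t => (1 - t) ^ n * iteratedFDeriv ℝ (n + 1) F (x + t • y) (fun _ => y)) ?_
    · simpa using this
    · intro t ht
      rw [uIoc_of_le zero_le_one] at ht
      have h1 : |(1 - t) ^ n| ≤ 1 := by
        rw [abs_pow]
        exact pow_le_one₀ (abs_nonneg _) (abs_le.2 ⟨by linarith [ht.2], by linarith [ht.1]⟩)
      have h2 : ‖iteratedFDeriv ℝ (n + 1) F (x + t • y) (fun _ => y)‖ ≤ M * ‖y‖ ^ (n + 1) := by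
        refine (ContinuousMultilinearMap.le_opNorm _ _).trans ?_
        simp only [Finset.prod_const, Finset.card_univ, Fintype.card_fin]
        gcongr
        exact hM t ⟨ht.1.le, ht.2⟩
      rw [norm_mul, ← one_mul (M * _)]
      exact mul_le_mul h1 h2 (norm_nonneg _) zero_le_one
  calc _ ≤ 1 * (M * ‖y‖ ^ (n + 1)) := mul_le_mul hf hi (abs_nonneg _) zero_le_one
    _ = _ := one_mul _

/-- If the frontier were missed, `Ω` and the complement of its closure would be disjoint open sets
separating `s`. It is applied to segments, to show that discs which miss the boundary stay inside
the domain. -/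
lemma _root_.IsPreconnected.inter_frontier_nonempty_of_isOpen {X : Type*} [TopologicalSpace X]
    {s Ω : Set X} (hs : IsPreconnected s) (hΩ : IsOpen Ω) (h1 : (s ∩ Ω).Nonempty)
    (h2 : (s ∩ Ωᶜ).Nonempty) : (s ∩ frontier Ω).Nonempty := by
  by_contra hne
  rw [not_nonempty_iff_eq_empty, hΩ.frontier_eq] at hne
  have hcov : s ⊆ Ω ∪ (closure Ω)ᶜ := by
    intro z hz
    by_contra hcon
    simp only [mem_union, mem_compl_iff, not_or, not_not] at hcon
    exact (hne ▸ (⟨hz, hcon.2, hcon.1⟩ : z ∈ s ∩ (closure Ω \ Ω)) : z ∈ (∅ : Set X))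
  obtain ⟨y, hy, hyΩ⟩ := h2
  have hy' : y ∈ (closure Ω)ᶜ := (hcov hy).resolve_left hyΩ
  obtain ⟨z, -, hz, hz'⟩ := hs _ _ hΩ isClosed_closure.isOpen_compl hcov h1 ⟨y, hy, hy'⟩
  exact hz' (subset_closure hz)

/-- The derivatives of a smooth extension are bounded in the unit neighbourhood of the domain. -/
lemma exists_bound_iteratedFDeriv {Ω : Set Plane} (hΩ : IsSmoothDomain Ω) {f F : Plane → ℝ}
    (hF : IsSmoothExtension Ω f F) (n : ℕ) :
    ∃ M : ℝ, 0 ≤ M ∧ ∀ x ∈ closure Ω, ∀ y, dist y x ≤ 1 → ‖iteratedFDeriv ℝ n F y‖ ≤ M := by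
  obtain ⟨M₀, hM₀⟩ := hF.bounded n
  have hK : IsCompact (Metric.cthickening 1 (frontier Ω)) :=
    (Metric.isCompact_of_isClosed_isBounded isClosed_frontier hΩ.bounded_frontier).cthickening
  obtain ⟨M₁, hM₁⟩ := hK.exists_bound_of_continuousOn
    (hF.smooth.continuous_iteratedFDeriv (m := n) (by exact_mod_cast le_top)).continuousOn
  refine ⟨max 0 (max M₀ M₁), le_max_left _ _, fun x hx y hxy => ?_⟩
  by_cases hy : y ∈ Ω
  · exact (hM₀ y hy).trans (by simp)
  -- A point outside `Ω` but within `1` of its closure lies within `1` of the frontier, hence in a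
  -- compact set, where continuity of the derivatives suffices. Such points are needed because a
  -- Taylor segment may leave a domain that is not convex.
  suffices h : ∃ z ∈ frontier Ω, dist y z ≤ 1 by
    obtain ⟨z, hz, hyz⟩ := h
    exact (hM₁ y (Metric.mem_cthickening_of_dist_le y z 1 _ hz hyz)).trans (by simp)
  by_cases hx' : x ∈ Ω
  · obtain ⟨z, hz, hzf⟩ := (convex_segment x y).isPreconnected.inter_frontier_nonempty_of_isOpen hΩ.isOpen
      ⟨x, left_mem_segment ℝ x y, hx'⟩ ⟨y, right_mem_segment ℝ x y, hy⟩
    refine ⟨z, hzf, ?_⟩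
    have := dist_add_dist_of_mem_segment hz
    rw [dist_comm x z, dist_comm x y, dist_comm z y] at this
    linarith [dist_nonneg (x := z) (y := x)]
  · refine ⟨x, ?_, hxy⟩
    rw [frontier, hΩ.isOpen.interior_eq]
    exact ⟨hx, hx'⟩

lemma abs_D1_le (F : Plane → ℝ) (x u : Plane) : |D1 F x u| ≤ ‖iteratedFDeriv ℝ 1 F x‖ * ‖u‖ := by
  rw [norm_iteratedFDeriv_one]
  exact (fderiv ℝ F x).le_opNorm u

lemma abs_D2_le (F : Plane → ℝ) (x u v : Plane) :
    |D2 F x u v| ≤ ‖iteratedFDeriv ℝ 2 F x‖ * (‖u‖ * ‖v‖) := by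
  have := (iteratedFDeriv ℝ 2 F x).le_opNorm ![u, v]
  simpa [Fin.prod_univ_two, D2] using this

lemma D1_add_smul (F : Plane → ℝ) (x τ ν : Plane) (a b : ℝ) :
    D1 F x (a • τ + b • ν) = a * D1 F x τ + b * D1 F x ν := by
  simp [D1]

lemma D2_add_smul (F : Plane → ℝ) (x τ ν : Plane) (a b : ℝ) :
    D2 F x (a • τ + b • ν) (a • τ + b • ν) = a ^ 2 * D2 F x τ τ
      + a * b * (D2 F x τ ν + D2 F x ν τ) + b ^ 2 * D2 F x ν ν := by
  simp only [D2, iteratedFDeriv_two_apply]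
  simp
  ring

lemma iteratedFDeriv_two_const (F : Plane → ℝ) (x z : Plane) :
    iteratedFDeriv ℝ 2 F x (fun _ => z) = D2 F x z z := by
  unfold D2
  congr 1
  ext i
  fin_cases i <;> rfl

lemma D2_eq_of_eqOn {Ω : Set Plane} (hΩ : IsOpen Ω) {f F : Plane → ℝ} (h : EqOn f F Ω) {x : Plane}
    (hx : x ∈ Ω) (u v : Plane) : D2 f x u v = D2 F x u v := by
  unfold D2
  rw [((h.eventuallyEq_of_mem (hΩ.mem_nhds hx)).iteratedFDeriv ℝ 2).eq_of_nhds]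

lemma D1_eq_of_eqOn {Ω : Set Plane} (hΩ : IsOpen Ω) {f F : Plane → ℝ} (h : EqOn f F Ω) {x : Plane}
    (hx : x ∈ Ω) (u : Plane) : D1 f x u = D1 F x u := by
  unfold D1
  rw [(h.eventuallyEq_of_mem (hΩ.mem_nhds hx)).fderiv_eq]

/-- Second order Taylor polynomial in the displacement `z`. -/
noncomputable def taylorTwo (F : Plane → ℝ) (x z : Plane) : ℝ := F x + D1 F x z + D2 F x z z / 2

/-- The source and its Taylor coefficients are bounded, and the Taylor remainders are controlled,
uniformly on the closure of the domain. -/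
lemma exists_taylor_bounds {Ω : Set Plane} (hΩ : IsSmoothDomain Ω) {f F : Plane → ℝ}
    (hF : IsSmoothExtension Ω f F) : ∃ M : ℝ, 0 ≤ M ∧
      (∀ x ∈ closure Ω, |F x| ≤ M ∧ (∀ u, |D1 F x u| ≤ M * ‖u‖) ∧
        (∀ u v, |D2 F x u v| ≤ M * (‖u‖ * ‖v‖)) ∧
        (∀ z, |iteratedFDeriv ℝ 3 F x (fun _ => z)| ≤ M * ‖z‖ ^ 3)) ∧
      (∀ x ∈ closure Ω, ∀ z, ‖z‖ ≤ 1 → |F (x + z) - taylorTwo F x z| ≤ M * ‖z‖ ^ 3) ∧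
      (∀ x ∈ closure Ω, ∀ z, ‖z‖ ≤ 1 →
        |F (x + z) - (taylorTwo F x z + 1 / 6 * iteratedFDeriv ℝ 3 F x (fun _ => z))|
          ≤ M * ‖z‖ ^ 4) := by
  choose B hB0 hB using exists_bound_iteratedFDeriv hΩ hF
  set M := B 0 + B 1 + B 2 + B 3 + B 4
  have hM : B 0 ≤ M ∧ B 1 ≤ M ∧ B 2 ≤ M ∧ B 3 ≤ M ∧ B 4 ≤ M := by
    refine ⟨?_, ?_, ?_, ?_, ?_⟩ <;> linarith [hB0 0, hB0 1, hB0 2, hB0 3, hB0 4]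
  obtain ⟨h0, h1, h2, h3, h4⟩ := hM
  have hseg : ∀ x ∈ closure Ω, ∀ z : Plane, ‖z‖ ≤ 1 → ∀ n, B n ≤ M → ∀ t ∈ Icc (0 : ℝ) 1,
      ‖iteratedFDeriv ℝ n F (x + t • z)‖ ≤ M := by
    intro x hx z hz n hn t ht
    refine (hB n x hx _ ?_).trans hn
    rw [dist_eq_norm, add_sub_cancel_left, norm_smul, Real.norm_of_nonneg ht.1]
    exact mul_le_one₀ ht.2 (norm_nonneg _) hz
  have hself : ∀ x ∈ closure Ω, ∀ n, B n ≤ M → ‖iteratedFDeriv ℝ n F x‖ ≤ M := fun x hx n hn =>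
    (hB n x hx x (by simp)).trans hn
  refine ⟨M, (hB0 0).trans h0, fun x hx => ⟨?_, fun u => ?_, fun u v => ?_, fun z => ?_⟩,
    fun x hx z hz => ?_, fun x hx z hz => ?_⟩
  · have := hself x hx 0 h0
    rwa [norm_iteratedFDeriv_zero] at this
  · refine (abs_D1_le F x u).trans ?_
    gcongr
    exact hself x hx 1 h1
  · refine (abs_D2_le F x u v).trans ?_
    gcongr
    exact hself x hx 2 h2
  · refine ((iteratedFDeriv ℝ 3 F x).le_opNorm _).trans ?_
    simp only [Finset.prod_const, Finset.card_univ, Fintype.card_fin]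
    gcongr
    exact hself x hx 3 h3
  · have h := abs_sub_taylor_le hF.smooth 2 x z (hseg x hx z hz 3 h3)
    simp only [Finset.sum_range_succ, Finset.range_zero, Finset.sum_empty, zero_add,
      iteratedFDeriv_two_const, iteratedFDeriv_zero_apply, iteratedFDeriv_one_apply] at h
    convert h using 2
    unfold taylorTwo D1
    norm_num [Nat.factorial]
    ring
  · have h := abs_sub_taylor_le hF.smooth 3 x z (hseg x hx z hz 4 h4)
    simp only [Finset.sum_range_succ, Finset.range_zero, Finset.sum_empty, zero_add,
      iteratedFDeriv_two_const, iteratedFDeriv_zero_apply, iteratedFDeriv_one_apply] at h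
    convert h using 2
    unfold taylorTwo D1
    norm_num [Nat.factorial]
    ring

/-! ### Orthonormal frames -/

section Frame

variable {τ ν : Plane}

lemma frame_norm_left (h : Orthonormal ℝ ![τ, ν]) : ‖τ‖ = 1 := h.1 0

lemma frame_norm_right (h : Orthonormal ℝ ![τ, ν]) : ‖ν‖ = 1 := h.1 1

lemma frame_inner (h : Orthonormal ℝ ![τ, ν]) : inner ℝ τ ν = 0 :=
  h.2 (i := 0) (j := 1) (by decide)

lemma frame_inner' (h : Orthonormal ℝ ![τ, ν]) : inner ℝ ν τ = 0 :=
  h.2 (i := 1) (j := 0) (by decide)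

lemma frame_inner_left (h : Orthonormal ℝ ![τ, ν]) (ξ η : ℝ) :
    inner ℝ (ξ • τ + η • ν) τ = ξ := by
  rw [inner_add_left, inner_smul_left, inner_smul_left, frame_inner' h,
    real_inner_self_eq_norm_sq, frame_norm_left h]
  simp

lemma frame_inner_right (h : Orthonormal ℝ ![τ, ν]) (ξ η : ℝ) :
    inner ℝ (ξ • τ + η • ν) ν = η := by
  rw [inner_add_left, inner_smul_left, inner_smul_left, frame_inner h,
    real_inner_self_eq_norm_sq, frame_norm_right h]
  simp

lemma frame_norm_sq (h : Orthonormal ℝ ![τ, ν]) (ξ η : ℝ) :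
    ‖ξ • τ + η • ν‖ ^ 2 = ξ ^ 2 + η ^ 2 := by
  rw [← real_inner_self_eq_norm_sq, inner_add_right, inner_smul_right, inner_smul_right,
    frame_inner_left h, frame_inner_right h]
  ring

lemma frame_norm_le (h : Orthonormal ℝ ![τ, ν]) (ξ η : ℝ) :
    ‖ξ • τ + η • ν‖ ≤ |ξ| + |η| := by
  refine (norm_add_le _ _).trans ?_
  rw [norm_smul, norm_smul, frame_norm_left h, frame_norm_right h]
  simp

/-- The orthonormal basis of the plane given by a frame. -/
noncomputable def frameBasis (h : Orthonormal ℝ ![τ, ν]) : OrthonormalBasis (Fin 2) ℝ Plane :=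
  OrthonormalBasis.mk h
    (h.linearIndependent.span_eq_top_of_card_eq_finrank' (by simp)).ge

lemma frame_decomp (h : Orthonormal ℝ ![τ, ν]) (v : Plane) :
    ∃ a b : ℝ, v = a • τ + b • ν := by
  have := (frameBasis h).sum_repr v
  rw [Fin.sum_univ_two] at this
  refine ⟨(frameBasis h).repr v 0, (frameBasis h).repr v 1, ?_⟩
  nth_rw 1 [← this]
  simp [frameBasis]

end Frame

/-! ### Taylor expansion with uniform remainder for functions of a parameter -/

/-- Letting `s` tend to zero kills the constant coefficient; dividing by `s` lowers the degree. -/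
lemma coeff_eq_zero_of_isBigO (n : ℕ) (c : ℕ → ℝ)
    (h : (fun s : ℝ => ∑ k ∈ Finset.range (n + 1), c k * s ^ k) =O[𝓝[≠] 0]
      fun s => s ^ (n + 1)) : ∀ k ≤ n, c k = 0 := by
  induction n generalizing c with
  | zero =>
    intro k hk
    obtain rfl : k = 0 := by omega
    simp only [zero_add, Finset.range_one, Finset.sum_singleton, pow_zero, mul_one, pow_one] at h
    have ht := h.trans_tendsto (tendsto_id.mono_left nhdsWithin_le_nhds)
    exact (tendsto_nhds_unique ht tendsto_const_nhds).symm
  | succ n ih =>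
    have hc0 : c 0 = 0 := by
      have hz : Tendsto (fun s : ℝ => s ^ (n + 1 + 1)) (𝓝[≠] 0) (𝓝 0) := by
        have := ((continuous_pow (M := ℝ) (n + 1 + 1)).tendsto 0).mono_left
          (nhdsWithin_le_nhds (s := {0}ᶜ))
        simpa using this
      have hc : Continuous fun s : ℝ => ∑ k ∈ Finset.range (n + 1 + 1), c k * s ^ k := by fun_prop
      have := (hc.tendsto 0).mono_left (nhdsWithin_le_nhds (s := {0}ᶜ))
      have h0 := tendsto_nhds_unique this (h.trans_tendsto hz)
      rw [Finset.sum_range_succ'] at h0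
      simpa using h0
    have h2 : (fun s : ℝ => ∑ k ∈ Finset.range (n + 1), c (k + 1) * s ^ k) =O[𝓝[≠] 0]
        fun s => s ^ (n + 1) := by
      have := (Asymptotics.isBigO_refl (fun s : ℝ => s⁻¹) (𝓝[≠] 0)).mul h
      refine this.congr' ?_ ?_
      · filter_upwards [self_mem_nhdsWithin] with s hs
        have hs : s ≠ 0 := hs
        rw [Finset.sum_range_succ', hc0, zero_mul, add_zero, Finset.mul_sum]
        refine Finset.sum_congr rfl fun k _ => ?_
        field_simp
        ring
      · filter_upwards [self_mem_nhdsWithin] with s hs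
        have hs : s ≠ 0 := hs
        field_simp
        ring
    intro k hk
    rcases k with _ | k
    · exact hc0
    · exact ih _ h2 k (by omega)

/-- A smooth function of a bounded parameter `p` and of `s` which, for a given `p`, vanishes to
order `n` at `s = 0` satisfies a bound uniform in the parameter. -/
lemma exists_uniform_vanishing_bound {P : Type*} [NormedAddCommGroup P] [NormedSpace ℝ P]
    [ProperSpace P] {Q : P × ℝ → ℝ} (hQ : ContDiff ℝ ∞ Q) (R : ℝ) (n : ℕ) :
    ∃ C : ℝ, 0 ≤ C ∧ ∀ p : P, ‖p‖ ≤ R →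
      ((fun s : ℝ => Q (p, s)) =O[𝓝 0] fun s => s ^ (n + 1)) →
      ∀ s : ℝ, |s| ≤ 1 → |Q (p, s)| ≤ C * |s| ^ (n + 1) := by
  obtain ⟨C, hC⟩ := (isCompact_closedBall (0 : P × ℝ) (max R 1)).exists_bound_of_continuousOn
    (hQ.continuous_iteratedFDeriv (m := n + 1) (by exact_mod_cast le_top)).continuousOn
  refine ⟨max C 0, le_max_right _ _, fun p hp hO => ?_⟩
  set c : ℕ → ℝ := fun k => (k.factorial : ℝ)⁻¹ *
    iteratedFDeriv ℝ k Q (p, 0) (fun _ => ((0 : P), (1 : ℝ)))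
  have key : ∀ s : ℝ, |s| ≤ 1 →
      |Q (p, s) - ∑ k ∈ Finset.range (n + 1), c k * s ^ k| ≤ max C 0 * |s| ^ (n + 1) := by
    intro s hs
    have h := abs_sub_taylor_le hQ n (p, (0 : ℝ)) ((0 : P), s) (M := max C 0) ?_
    · convert h using 2
      · congr 1
        · simp
        · refine Finset.sum_congr rfl fun k _ => ?_
          have e : (fun _ : Fin k => ((0 : P), s)) = fun _ => s • ((0 : P), (1 : ℝ)) := by
            ext i <;> simp
          rw [e, ContinuousMultilinearMap.map_smul_univ]
          simp [c]
          ring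
      · simp [Prod.norm_def]
    · intro t ht
      refine (hC _ ?_).trans (le_max_left _ _)
      rw [mem_closedBall_zero_iff, Prod.norm_def]
      simp only [Prod.smul_mk, smul_zero, Prod.mk_add_mk, add_zero, zero_add, smul_eq_mul]
      refine max_le_max hp ?_
      rw [norm_mul, Real.norm_eq_abs, Real.norm_eq_abs, abs_of_nonneg ht.1]
      exact mul_le_one₀ ht.2 (abs_nonneg _) hs
  have hev : ∀ᶠ s : ℝ in 𝓝 0, |s| ≤ 1 := by
    filter_upwards [Metric.closedBall_mem_nhds (0 : ℝ) one_pos] with s hs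
    simpa using hs
  have hO2 : (fun s : ℝ => Q (p, s) - ∑ k ∈ Finset.range (n + 1), c k * s ^ k) =O[𝓝 0]
      fun s => s ^ (n + 1) := by
    refine Asymptotics.IsBigO.of_bound (max C 0) ?_
    filter_upwards [hev] with s hs
    simpa using key s hs
  have hO3 := (hO.sub hO2).mono (nhdsWithin_le_nhds (s := {0}ᶜ))
  simp only [sub_sub_cancel] at hO3
  -- The Taylor polynomial in `s` is itself `O(s ^ (n + 1))`, hence zero, and only the remainder
  -- survives. Its constant bounds a derivative of `Q` on a fixed compact ball, so it does not
  -- depend on `p`.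
  have hc := coeff_eq_zero_of_isBigO n c hO3
  intro s hs
  have := key s hs
  rwa [Finset.sum_eq_zero, sub_zero] at this
  intro k hk
  rw [hc k (by simpa [Nat.lt_succ_iff] using hk), zero_mul]

/-- Divide by `|s| ^ n` and let `s` tend to zero. The constant `K` passes to the coefficient
whatever the size of the neighbourhood where the bound holds. -/
lemma abs_le_of_eventually_le_of_isBigO {g : ℝ → ℝ} {a K : ℝ} {n : ℕ}
    (h1 : ∀ᶠ s in 𝓝 0, |g s| ≤ K * |s| ^ n)
    (h2 : (fun s => g s - a * s ^ n) =O[𝓝 0] fun s => s ^ (n + 1)) : |a| ≤ K := by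
  obtain ⟨c, hc⟩ := h2.bound
  have h3 : ∀ᶠ s in 𝓝[≠] (0 : ℝ), |a| ≤ K + c * |s| := by
    filter_upwards [h1.filter_mono nhdsWithin_le_nhds, hc.filter_mono nhdsWithin_le_nhds,
      self_mem_nhdsWithin] with s hs1 hs2 hs0
    have hs0 : s ≠ 0 := hs0
    have hp : 0 < |s| ^ n := by positivity
    rw [Real.norm_eq_abs, Real.norm_eq_abs, abs_pow] at hs2
    have : |a| * |s| ^ n ≤ (K + c * |s|) * |s| ^ n := by
      calc |a| * |s| ^ n = |a * s ^ n| := by rw [abs_mul, abs_pow]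
        _ = |g s - (g s - a * s ^ n)| := by rw [sub_sub_cancel]
        _ ≤ |g s| + |g s - a * s ^ n| := abs_sub _ _
        _ ≤ K * |s| ^ n + c * |s| ^ (n + 1) := add_le_add hs1 hs2
        _ = _ := by ring
    exact le_of_mul_le_mul_right this hp
  have h4 : Tendsto (fun s : ℝ => K + c * |s|) (𝓝[≠] 0) (𝓝 K) := by
    have : Continuous fun s : ℝ => K + c * |s| := by fun_prop
    simpa using (this.tendsto 0).mono_left (nhdsWithin_le_nhds (s := {0}ᶜ))
  exact ge_of_tendsto h4 h3

lemma isBigO_sub_cubic {γ : ℝ → ℝ} (hγ : ContDiff ℝ ∞ γ) (h0 : γ 0 = 0) (h1 : deriv γ 0 = 0) :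
    (fun s => γ s - (iteratedDeriv 2 γ 0 / 2 * s ^ 2 + iteratedDeriv 3 γ 0 / 6 * s ^ 3))
      =O[𝓝 0] fun s => s ^ 4 := by
  obtain ⟨C, hC⟩ := (isCompact_closedBall (0 : ℝ) 1).exists_bound_of_continuousOn
    (hγ.continuous_iteratedFDeriv (m := 4)
      (WithTop.coe_le_coe.2 (le_top (a := ((4 : ℕ) : ℕ∞))))).continuousOn
  refine Asymptotics.IsBigO.of_bound C ?_
  filter_upwards [Metric.closedBall_mem_nhds (0 : ℝ) one_pos] with s hs
  have hs : |s| ≤ 1 := by simpa using hs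
  have h := abs_sub_taylor_le hγ 3 0 s (M := C) ?_
  · have hd : ∀ k, iteratedFDeriv ℝ k γ 0 (fun _ => s) = s ^ k * iteratedDeriv k γ 0 := by
      intro k
      have e : (fun _ : Fin k => s) = fun _ => s • (1 : ℝ) := by simp
      rw [e, ContinuousMultilinearMap.map_smul_univ, iteratedDeriv_eq_iteratedFDeriv]
      simp
    simp only [hd, Finset.sum_range_succ, Finset.range_zero, Finset.sum_empty, zero_add,
      iteratedDeriv_zero, iteratedDeriv_one, h0, h1] at h
    rw [Real.norm_eq_abs, norm_pow]
    convert h using 2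
    norm_num [Nat.factorial]
    ring
  · intro t ht
    apply hC
    rw [mem_closedBall_zero_iff, zero_add, smul_eq_mul, norm_mul, Real.norm_eq_abs,
      Real.norm_eq_abs, abs_of_nonneg ht.1]
    exact mul_le_one₀ ht.2 (abs_nonneg _) hs

/-! ### Uniform description of the domain near its boundary -/

/-- In the rectangle `|ξ|, |η| ≤ ρ` of the frame `(τ, ν)` at `b`, the set `Ω` is squeezed between
the epigraphs of `κ ξ² / 2 + a ξ³ ± C ξ⁴`, where `κ` and `a` are bounded by `C`. -/
def IsSqueezedGraph (Ω : Set Plane) (ρ C : ℝ) (b τ ν : Plane) (κ : ℝ) : Prop :=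
  |κ| ≤ C ∧ ∃ a : ℝ, |a| ≤ C ∧ ∀ ξ η : ℝ, |ξ| ≤ ρ → |η| ≤ ρ →
    (κ / 2 * ξ ^ 2 + a * ξ ^ 3 + C * ξ ^ 4 < η → b + (ξ • τ + η • ν) ∈ Ω) ∧
    (η < κ / 2 * ξ ^ 2 + a * ξ ^ 3 - C * ξ ^ 4 → b + (ξ • τ + η • ν) ∉ Ω)

lemma IsSqueezedGraph.mono {Ω : Set Plane} {ρ C ρ' C' : ℝ} {b τ ν : Plane} {κ : ℝ}
    (h : IsSqueezedGraph Ω ρ C b τ ν κ) (hρ : ρ' ≤ ρ) (hC : C ≤ C') :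
    IsSqueezedGraph Ω ρ' C' b τ ν κ := by
  obtain ⟨h1, a, h2, h3⟩ := h
  refine ⟨h1.trans hC, a, h2.trans hC, fun ξ η hξ hη => ?_⟩
  obtain ⟨h4, h5⟩ := h3 ξ η (hξ.trans hρ) (hη.trans hρ)
  have : C * ξ ^ 4 ≤ C' * ξ ^ 4 := by gcongr
  exact ⟨fun h => h4 (by linarith), fun h => h5 (by linarith)⟩

/-! ### A defining function of the domain against the tangent graphs of nearby points. -/

section Local

variable {Ω : Set Plane} {φ : Plane → ℝ} {b₀ ν₀ : Plane} {ε : ℝ}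

lemma continuous_frame (b τ ν : Plane) {g : ℝ → ℝ} (hg : Continuous g) :
    Continuous fun ξ : ℝ => b + (ξ • τ + g ξ • ν) := by fun_prop

/-- Points of the graph lie outside `Ω`, so `φ ≤ 0` there, and they are limits of points just above,
which lie in `Ω`, where `φ > 0`. -/
lemma eventually_zero_of_isTangentGraph (hφ : ContDiff ℝ ∞ φ)
    (H : ∀ y ∈ Metric.ball b₀ ε, (y ∈ Ω ↔ 0 < φ y)) {b τ ν : Plane} {γ : ℝ → ℝ}
    (hb : b ∈ Metric.ball b₀ ε) (hγ : IsTangentGraph Ω b τ ν γ) :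
    ∀ᶠ ξ in 𝓝 (0 : ℝ), φ (b + (ξ • τ + γ ξ • ν)) = 0 := by
  obtain ⟨ρ, hρ, hmem⟩ := hγ.mem_iff
  have hU : IsOpen (Metric.ball b₀ ε ∩ Metric.ball b ρ) := Metric.isOpen_ball.inter Metric.isOpen_ball
  have hb' : b ∈ Metric.ball b₀ ε ∩ Metric.ball b ρ := ⟨hb, Metric.mem_ball_self hρ⟩
  have hev : ∀ᶠ ξ in 𝓝 (0 : ℝ), b + (ξ • τ + γ ξ • ν) ∈ Metric.ball b₀ ε ∩ Metric.ball b ρ := by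
    refine ((continuous_frame b τ ν hγ.smooth.continuous).tendsto 0).eventually
      (hU.mem_nhds ?_)
    simpa [hγ.map_zero] using hb'
  filter_upwards [hev] with ξ hξ
  have hout : b + (ξ • τ + γ ξ • ν) ∉ Ω := by
    rw [hmem _ hξ.2, add_sub_cancel_left, frame_inner_left hγ.orthonormal,
      frame_inner_right hγ.orthonormal]
    exact lt_irrefl _
  rw [H _ hξ.1, not_lt] at hout
  refine le_antisymm hout ?_
  have hcl : Continuous fun s : ℝ => b + (ξ • τ + (γ ξ + s) • ν) := by fun_prop
  have hlim : Tendsto (fun s : ℝ => φ (b + (ξ • τ + (γ ξ + s) • ν))) (𝓝[>] 0)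
      (𝓝 (φ (b + (ξ • τ + γ ξ • ν)))) := by
    have := ((hφ.continuous.comp hcl).tendsto 0).mono_left (nhdsWithin_le_nhds (s := Ioi 0))
    simpa [Function.comp_def] using this
  refine ge_of_tendsto hlim ?_
  have hev2 : ∀ᶠ s in 𝓝[>] (0 : ℝ), b + (ξ • τ + (γ ξ + s) • ν)
      ∈ Metric.ball b₀ ε ∩ Metric.ball b ρ := by
    refine ((hcl.tendsto 0).mono_left (nhdsWithin_le_nhds (s := Ioi 0))).eventually
      (hU.mem_nhds ?_)
    simpa using hξ
  filter_upwards [hev2, self_mem_nhdsWithin] with s hs hs0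
  have hs0 : 0 < s := hs0
  refine ((H _ hs.1).1 ?_).le
  rw [hmem _ hs.2, add_sub_cancel_left, frame_inner_left hγ.orthonormal,
    frame_inner_right hγ.orthonormal]
  linarith

/-- Differentiate the vanishing of `φ` along the graph, whose tangent at `b` is `τ`. -/
lemma fderiv_tangent_eq_zero (hφ : ContDiff ℝ ∞ φ)
    (H : ∀ y ∈ Metric.ball b₀ ε, (y ∈ Ω ↔ 0 < φ y)) {b τ ν : Plane} {γ : ℝ → ℝ}
    (hb : b ∈ Metric.ball b₀ ε) (hγ : IsTangentGraph Ω b τ ν γ) : fderiv ℝ φ b τ = 0 := by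
  have hz := eventually_zero_of_isTangentGraph hφ H hb hγ
  have hγd : HasDerivAt γ 0 0 := by
    have := (hγ.smooth.differentiable (by simp) 0).hasDerivAt
    rwa [hγ.deriv_zero] at this
  have hc : HasDerivAt (fun ξ : ℝ => b + (ξ • τ + γ ξ • ν)) τ 0 := by
    have := (((hasDerivAt_id (0 : ℝ)).smul_const τ).add (hγd.smul_const ν)).const_add b
    refine this.congr_deriv ?_
    simp
  have hφd : HasFDerivAt φ (fderiv ℝ φ b) (b + ((0 : ℝ) • τ + γ 0 • ν)) := by
    rw [hγ.map_zero]
    simpa using (hφ.differentiable (by simp) b).hasFDerivAt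
  have h1 := hφd.comp_hasDerivAt (0 : ℝ) hc
  have h2 : HasDerivAt (φ ∘ fun ξ : ℝ => b + (ξ • τ + γ ξ • ν)) 0 0 :=
    (hasDerivAt_const (0 : ℝ) (0 : ℝ)).congr_of_eventuallyEq hz
  exact h1.unique h2

/-- The derivative along `ν₀` is at least `1 - 1 / 8`. Since `τ` contributes nothing and the
`ν`-component of the unit vector `ν₀` is at most one in size, the derivative along `ν` is at least
as large in absolute value. Its sign is that of `φ` just inside the domain. -/
lemma fderiv_normal_ge (hφ : ContDiff ℝ ∞ φ)
    (H : ∀ y ∈ Metric.ball b₀ ε, (y ∈ Ω ↔ 0 < φ y))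
    (H' : ∀ y ∈ Metric.ball b₀ ε, ‖fderiv ℝ φ y - fderiv ℝ φ b₀‖ ≤ 1 / 8)
    (hν₀ : ‖ν₀‖ = 1) (hφν₀ : fderiv ℝ φ b₀ ν₀ = 1) {b τ ν : Plane} {γ : ℝ → ℝ}
    (hb : b ∈ Metric.ball b₀ ε) (hγ : IsTangentGraph Ω b τ ν γ) : 7 / 8 ≤ fderiv ℝ φ b ν := by
  have hτ := fderiv_tangent_eq_zero hφ H hb hγ
  have h1 : 7 / 8 ≤ fderiv ℝ φ b ν₀ := by
    have := (fderiv ℝ φ b - fderiv ℝ φ b₀).le_opNorm ν₀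
    rw [hν₀, mul_one] at this
    have h2 := this.trans (H' b hb)
    rw [sub_apply, hφν₀, Real.norm_eq_abs, abs_le] at h2
    linarith [h2.1]
  obtain ⟨a, c, hac⟩ := frame_decomp hγ.orthonormal ν₀
  have h2 : fderiv ℝ φ b ν₀ = c * fderiv ℝ φ b ν := by
    rw [hac, map_add, map_smul, map_smul, hτ]
    simp
  have hc : |c| ≤ 1 := by
    have h3 := frame_norm_sq hγ.orthonormal a c
    rw [← hac, hν₀] at h3
    rw [← sq_le_one_iff_abs_le_one]
    nlinarith [sq_nonneg a]
  have habs : 7 / 8 ≤ |fderiv ℝ φ b ν| := by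
    calc 7 / 8 ≤ |c * fderiv ℝ φ b ν| := by rw [← h2]; exact h1.trans (le_abs_self _)
      _ = |c| * |fderiv ℝ φ b ν| := abs_mul _ _
      _ ≤ 1 * |fderiv ℝ φ b ν| := by gcongr
      _ = _ := one_mul _
  suffices h : 0 ≤ fderiv ℝ φ b ν by rwa [abs_of_nonneg h] at habs
  have hz : φ b = 0 := by
    have := (eventually_zero_of_isTangentGraph hφ H hb hγ).self_of_nhds
    simpa [hγ.map_zero] using this
  have hline : HasDerivAt (fun s : ℝ => φ (b + s • ν)) (fderiv ℝ φ b ν) 0 := by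
    have hc : HasDerivAt (fun s : ℝ => b + s • ν) ν 0 := by
      have := ((hasDerivAt_id (0 : ℝ)).smul_const ν).const_add b
      refine this.congr_deriv (by simp)
    have hφd : HasFDerivAt φ (fderiv ℝ φ b) (b + (0 : ℝ) • ν) := by
      simpa using (hφ.differentiable (by simp) b).hasFDerivAt
    exact hφd.comp_hasDerivAt (0 : ℝ) hc
  have hlim := hline.tendsto_slope_zero_right
  refine ge_of_tendsto hlim ?_
  obtain ⟨ρ, hρ, hmem⟩ := hγ.mem_iff
  have hcl : Continuous fun s : ℝ => b + s • ν := by fun_prop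
  have hev2 : ∀ᶠ s in 𝓝[>] (0 : ℝ), b + s • ν ∈ Metric.ball b₀ ε ∩ Metric.ball b ρ := by
    refine ((hcl.tendsto 0).mono_left (nhdsWithin_le_nhds (s := Ioi 0))).eventually
      ((Metric.isOpen_ball.inter Metric.isOpen_ball).mem_nhds ?_)
    simpa using ⟨hb, hρ⟩
  filter_upwards [hev2, self_mem_nhdsWithin] with s hs hs0
  have hs0 : 0 < s := hs0
  have hin : b + s • ν ∈ Ω := by
    rw [hmem _ hs.2, add_sub_cancel_left]
    have e : s • ν = (0 : ℝ) • τ + s • ν := by simp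
    rw [e, frame_inner_left hγ.orthonormal, frame_inner_right hγ.orthonormal, hγ.map_zero]
    exact hs0
  have hpos := (H _ hs.1).1 hin
  rw [zero_add, zero_smul, add_zero, hz, sub_zero, smul_eq_mul]
  positivity

/-- The derivative along `ν` is at least `7 / 8` at `b` and varies by at most `1 / 8 + 1 / 8` in the
ball, so the slope exceeds `1 / 2`. -/
lemma half_le_sub_of_isTangentGraph (hφ : ContDiff ℝ ∞ φ)
    (H : ∀ y ∈ Metric.ball b₀ ε, (y ∈ Ω ↔ 0 < φ y))
    (H' : ∀ y ∈ Metric.ball b₀ ε, ‖fderiv ℝ φ y - fderiv ℝ φ b₀‖ ≤ 1 / 8)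
    (hν₀ : ‖ν₀‖ = 1) (hφν₀ : fderiv ℝ φ b₀ ν₀ = 1) {b τ ν : Plane} {γ : ℝ → ℝ}
    (hb : b ∈ Metric.ball b₀ ε) (hγ : IsTangentGraph Ω b τ ν γ) {ξ η₁ η₂ : ℝ} (hη : η₁ ≤ η₂)
    (h1 : b + (ξ • τ + η₁ • ν) ∈ Metric.ball b₀ ε) (h2 : b + (ξ • τ + η₂ • ν) ∈ Metric.ball b₀ ε) :
    1 / 2 * (η₂ - η₁) ≤ φ (b + (ξ • τ + η₂ • ν)) - φ (b + (ξ • τ + η₁ • ν)) := by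
  have hd : ∀ s : ℝ, HasDerivAt (fun s : ℝ => φ (b + (ξ • τ + s • ν)))
      (fderiv ℝ φ (b + (ξ • τ + s • ν)) ν) s := by
    intro s
    have hc : HasDerivAt (fun s : ℝ => b + (ξ • τ + s • ν)) ν s := by
      have := (((hasDerivAt_id s).smul_const ν).const_add (ξ • τ)).const_add b
      refine this.congr_deriv (by simp)
    exact (hφ.differentiable (by simp) _).hasFDerivAt.comp_hasDerivAt s hc
  refine (convex_Icc η₁ η₂).mul_sub_le_image_sub_of_le_deriv
    (f := fun s : ℝ => φ (b + (ξ • τ + s • ν)))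
    (fun s _ => (hd s).continuousAt.continuousWithinAt)
    (fun s _ => (hd s).differentiableAt.differentiableWithinAt) ?_ η₁ (left_mem_Icc.2 hη) η₂
    (right_mem_Icc.2 hη) hη
  intro s hs
  have hs := interior_subset hs
  rw [(hd s).deriv]
  have hball : b + (ξ • τ + s • ν) ∈ Metric.ball b₀ ε := by
    refine (convex_ball b₀ ε).segment_subset h1 h2 ?_
    rcases hη.eq_or_lt with rfl | hlt
    · obtain rfl : s = η₁ := le_antisymm hs.2 hs.1
      exact left_mem_segment _ _ _
    have h0 : 0 < η₂ - η₁ := sub_pos.2 hlt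
    refine ⟨(η₂ - s) / (η₂ - η₁), (s - η₁) / (η₂ - η₁), div_nonneg (sub_nonneg.2 hs.2) h0.le,
      div_nonneg (sub_nonneg.2 hs.1) h0.le, by field_simp; ring, ?_⟩
    have e1 : (η₂ - s) / (η₂ - η₁) + (s - η₁) / (η₂ - η₁) = 1 := by field_simp; ring
    have e2 : (η₂ - s) / (η₂ - η₁) * η₁ + (s - η₁) / (η₂ - η₁) * η₂ = s := by field_simp; ring
    generalize (η₂ - s) / (η₂ - η₁) = p at *
    generalize (s - η₁) / (η₂ - η₁) = q at *
    obtain rfl : p = 1 - q := by linarith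
    rw [← e2]
    module
  have h3 := fderiv_normal_ge hφ H H' hν₀ hφν₀ hb hγ
  have h4 := (fderiv ℝ φ (b + (ξ • τ + s • ν)) - fderiv ℝ φ b).le_opNorm ν
  have h5 : ‖fderiv ℝ φ (b + (ξ • τ + s • ν)) - fderiv ℝ φ b‖ ≤ 1 / 4 := by
    have := norm_sub_le (fderiv ℝ φ (b + (ξ • τ + s • ν)) - fderiv ℝ φ b₀)
      (fderiv ℝ φ b - fderiv ℝ φ b₀)
    rw [sub_sub_sub_cancel_right] at this
    linarith [H' _ hball, H' b hb]
  rw [frame_norm_right hγ.orthonormal, mul_one, sub_apply,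
    Real.norm_eq_abs] at h4
  have := (abs_le.1 (h4.trans h5)).1
  linarith

/-- Near `b₀`, the defining function is small of order `n + 1` along a polynomial curve which
osculates the boundary to order `n`; the constant does not depend on the boundary point. -/
lemma exists_bound_along_osculating (hφ : ContDiff ℝ ∞ φ)
    (H : ∀ y ∈ Metric.ball b₀ ε, (y ∈ Ω ↔ 0 < φ y)) (R : ℝ) (n : ℕ) :
    ∃ C : ℝ, 0 ≤ C ∧ ∀ b ∈ Metric.ball b₀ ε, ∀ (τ ν : Plane) (γ : ℝ → ℝ),
      IsTangentGraph Ω b τ ν γ → ∀ a₂ a₃ : ℝ, |a₂| ≤ R → |a₃| ≤ R →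
      ((fun s => γ s - (a₂ * s ^ 2 + a₃ * s ^ 3)) =O[𝓝 0] fun s => s ^ (n + 1)) →
      ∀ s : ℝ, |s| ≤ 1 →
        |φ (b + (s • τ + (a₂ * s ^ 2 + a₃ * s ^ 3) • ν))| ≤ C * |s| ^ (n + 1) := by
  -- The point, the frame and the two coefficients form a bounded parameter of finite dimension; `γ`
  -- itself does not enter.
  set Q : (Plane × Plane × Plane × ℝ × ℝ) × ℝ → ℝ := fun q =>
    φ (q.1.1 + (q.2 • q.1.2.1 + (q.1.2.2.2.1 * q.2 ^ 2 + q.1.2.2.2.2 * q.2 ^ 3) • q.1.2.2.1))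
  have hQ : ContDiff ℝ ∞ Q := hφ.comp (by fun_prop)
  obtain ⟨C, hC0, hC⟩ := exists_uniform_vanishing_bound hQ (max (‖b₀‖ + ε) (max 1 R)) n
  refine ⟨C, hC0, fun b hb τ ν γ hγ a₂ a₃ h2 h3 hO s hs => ?_⟩
  refine hC (b, τ, ν, a₂, a₃) ?_ ?_ s hs
  · have hbn : ‖b‖ ≤ ‖b₀‖ + ε := by
      have h1 := norm_le_norm_add_norm_sub' b b₀
      rw [← dist_eq_norm] at h1
      linarith [Metric.mem_ball.1 hb]
    simp only [Prod.norm_def, frame_norm_left hγ.orthonormal, frame_norm_right hγ.orthonormal,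
      Real.norm_eq_abs]
    have h1 : (1 : ℝ) ≤ max (‖b₀‖ + ε) (max 1 R) := (le_max_left _ _).trans (le_max_right _ _)
    have hR : R ≤ max (‖b₀‖ + ε) (max 1 R) := (le_max_right _ _).trans (le_max_right _ _)
    exact max_le (hbn.trans (le_max_left _ _))
      (max_le h1 (max_le h1 (max_le (h2.trans hR) (h3.trans hR))))
  · have hz := eventually_zero_of_isTangentGraph hφ H hb hγ
    obtain ⟨K, t, ht, hK⟩ := (hφ.contDiffAt (x := b)).of_le (by simp) |>.exists_lipschitzOnWith
    have hc1 : ∀ᶠ s : ℝ in 𝓝 0, b + (s • τ + γ s • ν) ∈ t := by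
      refine ((continuous_frame b τ ν hγ.smooth.continuous).tendsto 0).eventually ?_
      simpa [hγ.map_zero] using ht
    have hc2 : ∀ᶠ s : ℝ in 𝓝 0, b + (s • τ + (a₂ * s ^ 2 + a₃ * s ^ 3) • ν) ∈ t := by
      refine ((continuous_frame b τ ν (g := fun s => a₂ * s ^ 2 + a₃ * s ^ 3)
        (by fun_prop)).tendsto 0).eventually ?_
      simpa using ht
    -- `φ` vanishes on the graph and is Lipschitz near `b`, so along the curve it is controlled by
    -- the gap between curve and graph.
    refine Asymptotics.IsBigO.trans ?_ hO
    refine Asymptotics.IsBigO.of_bound K ?_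
    filter_upwards [hz, hc1, hc2] with s hs1 hs2 hs3
    have := hK.dist_le_mul _ hs3 _ hs2
    rw [Real.dist_eq, hs1, sub_zero, dist_eq_norm] at this
    refine this.trans (le_of_eq ?_)
    have e : b + (s • τ + (a₂ * s ^ 2 + a₃ * s ^ 3) • ν) - (b + (s • τ + γ s • ν))
        = -(γ s - (a₂ * s ^ 2 + a₃ * s ^ 3)) • ν := by module
    rw [e, norm_smul, frame_norm_right hγ.orthonormal, norm_neg, mul_one]

end Local

/-! ### Uniform bounds for the Taylor coefficients of the boundary. -/

section Local

variable {Ω : Set Plane} {φ : Plane → ℝ} {b₀ ν₀ : Plane} {ε : ℝ}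

/-- Graph and curve are compared on vertical segments: `φ` is zero at one end, small at the other,
and grows at rate at least `1 / 2` between them, whence the factor `2`. -/
lemma eventually_abs_sub_le_of_osculating (hφ : ContDiff ℝ ∞ φ)
    (H : ∀ y ∈ Metric.ball b₀ ε, (y ∈ Ω ↔ 0 < φ y))
    (H' : ∀ y ∈ Metric.ball b₀ ε, ‖fderiv ℝ φ y - fderiv ℝ φ b₀‖ ≤ 1 / 8)
    (hν₀ : ‖ν₀‖ = 1) (hφν₀ : fderiv ℝ φ b₀ ν₀ = 1) {b τ ν : Plane} {γ : ℝ → ℝ}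
    (hb : b ∈ Metric.ball b₀ ε) (hγ : IsTangentGraph Ω b τ ν γ) {a₂ a₃ C : ℝ} {n : ℕ}
    (hC : ∀ s : ℝ, |s| ≤ 1 →
      |φ (b + (s • τ + (a₂ * s ^ 2 + a₃ * s ^ 3) • ν))| ≤ C * |s| ^ (n + 1)) :
    ∀ᶠ s in 𝓝 (0 : ℝ), |γ s - (a₂ * s ^ 2 + a₃ * s ^ 3)| ≤ 2 * C * |s| ^ (n + 1) := by
  have hball := Metric.isOpen_ball.mem_nhds hb
  have hc1 : ∀ᶠ s : ℝ in 𝓝 0, b + (s • τ + γ s • ν) ∈ Metric.ball b₀ ε := by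
    refine ((continuous_frame b τ ν hγ.smooth.continuous).tendsto 0).eventually ?_
    simpa only [hγ.map_zero, zero_smul, add_zero] using (show ∀ᶠ y in 𝓝 b, y ∈ Metric.ball b₀ ε from hball)
  have hc2 : ∀ᶠ s : ℝ in 𝓝 0, b + (s • τ + (a₂ * s ^ 2 + a₃ * s ^ 3) • ν) ∈ Metric.ball b₀ ε := by
    refine ((continuous_frame b τ ν (g := fun s => a₂ * s ^ 2 + a₃ * s ^ 3)
      (by fun_prop)).tendsto 0).eventually ?_
    have e : a₂ * (0 : ℝ) ^ 2 + a₃ * 0 ^ 3 = 0 := by ring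
    simpa only [e, zero_smul, add_zero] using (show ∀ᶠ y in 𝓝 b, y ∈ Metric.ball b₀ ε from hball)
  filter_upwards [hc1, hc2, Metric.closedBall_mem_nhds (0 : ℝ) one_pos,
    eventually_zero_of_isTangentGraph hφ H hb hγ] with s h1 h2 hs hz
  have hs : |s| ≤ 1 := by simpa using hs
  have h3 := hC s hs
  rcases le_total (γ s) (a₂ * s ^ 2 + a₃ * s ^ 3) with hle | hle
  · have h4 := half_le_sub_of_isTangentGraph hφ H H' hν₀ hφν₀ hb hγ hle h1 h2
    rw [hz] at h4
    rw [abs_of_nonpos (sub_nonpos.2 hle)]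
    linarith [(abs_le.1 h3).2]
  · have h4 := half_le_sub_of_isTangentGraph hφ H H' hν₀ hφν₀ hb hγ hle h2 h1
    rw [hz] at h4
    rw [abs_of_nonneg (sub_nonneg.2 hle)]
    linarith [(abs_le.1 h3).1]

/-- A bootstrap in the order of contact: the tangent line yields a uniform bound for the quadratic
coefficient, the osculating parabola one for the cubic coefficient, and the osculating cubic the
final quartic error. Each stage makes the parameters of the next one bounded. -/
lemma exists_isSqueezedGraph_near (hε : 0 < ε) (hφ : ContDiff ℝ ∞ φ)
    (H : ∀ y ∈ Metric.ball b₀ ε, (y ∈ Ω ↔ 0 < φ y))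
    (H' : ∀ y ∈ Metric.ball b₀ ε, ‖fderiv ℝ φ y - fderiv ℝ φ b₀‖ ≤ 1 / 8)
    (hν₀ : ‖ν₀‖ = 1) (hφν₀ : fderiv ℝ φ b₀ ν₀ = 1) :
    ∃ ρ C : ℝ, 0 < ρ ∧ 0 ≤ C ∧ ∀ b ∈ Metric.ball b₀ (ε / 2), ∀ (τ ν : Plane) (γ : ℝ → ℝ),
      IsTangentGraph Ω b τ ν γ → IsSqueezedGraph Ω ρ C b τ ν (iteratedDeriv 2 γ 0) := by
  obtain ⟨C₁, hC₁, h₁⟩ := exists_bound_along_osculating hφ H 0 1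
  obtain ⟨C₂, hC₂, h₂⟩ := exists_bound_along_osculating hφ H (2 * C₁) 2
  obtain ⟨C₃, hC₃, h₃⟩ := exists_bound_along_osculating hφ H (2 * C₁ + 2 * C₂) 3
  set R := 2 * C₁ + 2 * C₂
  have hR : 0 ≤ R := by positivity
  -- Small enough that, over `|ξ| ≤ ρ`, both the rectangle and the cubic curve stay in the ball
  -- where `φ` describes the domain.
  set ρ := min 1 (ε / (4 * (1 + 2 * R)))
  have hρ : 0 < ρ := by positivity
  have hρ1 : ρ ≤ 1 := min_le_left _ _
  have hρ2 : ρ * (1 + 2 * R) ≤ ε / 4 := by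
    have : ρ ≤ ε / (4 * (1 + 2 * R)) := min_le_right _ _
    rw [le_div_iff₀ (by positivity)] at this
    linarith
  -- The three summands bound the curvature `2 * a₂`, the coefficient `a₃` and the quartic error.
  refine ⟨ρ, 4 * C₁ + 2 * C₂ + 2 * C₃, hρ, by positivity, fun b hb τ ν γ hγ => ?_⟩
  have hbε : b ∈ Metric.ball b₀ ε := Metric.ball_subset_ball (by linarith) hb
  have hO4 := isBigO_sub_cubic hγ.smooth hγ.map_zero hγ.deriv_zero
  set a₂ := iteratedDeriv 2 γ 0 / 2
  set a₃ := iteratedDeriv 3 γ 0 / 6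
  have hpow : ∀ m k : ℕ, m ≤ k → (fun s : ℝ => s ^ k) =O[𝓝 0] fun s => s ^ m := by
    intro m k hmk
    refine Asymptotics.IsBigO.of_bound 1 ?_
    filter_upwards [Metric.closedBall_mem_nhds (0 : ℝ) one_pos] with s hs
    have hs : |s| ≤ 1 := by simpa using hs
    rw [norm_pow, norm_pow, one_mul, Real.norm_eq_abs]
    exact pow_le_pow_of_le_one (abs_nonneg _) hs hmk
  have hO3 : (fun s => γ s - (a₂ * s ^ 2 + 0 * s ^ 3)) =O[𝓝 0] fun s => s ^ 3 := by
    have := (hO4.trans (hpow 3 4 (by norm_num))).add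
      ((Asymptotics.isBigO_refl (fun s : ℝ => s ^ 3) (𝓝 0)).const_mul_left a₃)
    refine this.congr_left fun s => ?_
    ring
  have hO2 : (fun s => γ s - (0 * s ^ 2 + 0 * s ^ 3)) =O[𝓝 0] fun s => s ^ 2 := by
    have := (hO3.trans (hpow 2 3 (by norm_num))).add
      ((Asymptotics.isBigO_refl (fun s : ℝ => s ^ 2) (𝓝 0)).const_mul_left a₂)
    refine this.congr_left fun s => ?_
    ring
  have ha₂ : |a₂| ≤ 2 * C₁ := by
    have := eventually_abs_sub_le_of_osculating hφ H H' hν₀ hφν₀ hbε hγ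
      (h₁ b hbε τ ν γ hγ 0 0 (by simp) (by simp) hO2)
    refine abs_le_of_eventually_le_of_isBigO this (hO3.congr_left fun s => ?_)
    ring
  have ha₃ : |a₃| ≤ 2 * C₂ := by
    have := eventually_abs_sub_le_of_osculating hφ H H' hν₀ hφν₀ hbε hγ
      (h₂ b hbε τ ν γ hγ a₂ 0 ha₂ (by simpa using hC₁) hO3)
    refine abs_le_of_eventually_le_of_isBigO this (hO4.congr_left fun s => ?_)
    ring
  have hq := h₃ b hbε τ ν γ hγ a₂ a₃ (by linarith) (by linarith) hO4
  refine ⟨?_, a₃, by linarith, fun ξ η hξ hη => ?_⟩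
  · have : |iteratedDeriv 2 γ 0| = 2 * |a₂| := by
      rw [← abs_two (α := ℝ), ← abs_mul]
      congr 1
      ring
    rw [this]
    linarith
  have hq' := hq ξ (hξ.trans hρ1)
  set p := a₂ * ξ ^ 2 + a₃ * ξ ^ 3
  have hp : |p| ≤ ρ * (2 * R) := by
    have h5 : |ξ| ^ 2 ≤ ρ := by
      calc |ξ| ^ 2 = |ξ| * |ξ| := sq _
        _ ≤ ρ * 1 := mul_le_mul hξ (hξ.trans hρ1) (abs_nonneg _) hρ.le
        _ = ρ := mul_one _
    have h6 : |ξ| ^ 3 ≤ ρ := by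
      calc |ξ| ^ 3 = |ξ| ^ 2 * |ξ| := by ring
        _ ≤ ρ * 1 := mul_le_mul h5 (hξ.trans hρ1) (abs_nonneg _) hρ.le
        _ = ρ := mul_one _
    calc |p| ≤ |a₂ * ξ ^ 2| + |a₃ * ξ ^ 3| := abs_add_le _ _
      _ = |a₂| * |ξ| ^ 2 + |a₃| * |ξ| ^ 3 := by simp only [abs_mul, abs_pow]
      _ ≤ R * ρ + R * ρ := by
        gcongr
        · linarith
        · linarith
      _ = _ := by ring
  have hin : ∀ η' : ℝ, |η'| ≤ ρ * (1 + 2 * R) - |ξ| + ρ →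
      b + (ξ • τ + η' • ν) ∈ Metric.ball b₀ ε := by
    intro η' h
    have h1 := frame_norm_le hγ.orthonormal ξ η'
    have h2 : dist (b + (ξ • τ + η' • ν)) b = ‖ξ • τ + η' • ν‖ := by simp [dist_eq_norm]
    have h3 := dist_triangle (b + (ξ • τ + η' • ν)) b b₀
    have h4 : ρ ≤ ρ * (1 + 2 * R) := le_mul_of_one_le_right hρ.le (by linarith)
    rw [Metric.mem_ball] at hb ⊢
    linarith
  have h1 := hin η (by nlinarith)
  have h2 := hin p (by nlinarith)
  have hle : 2 * C₃ * ξ ^ 4 ≤ (4 * C₁ + 2 * C₂ + 2 * C₃) * ξ ^ 4 := by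
    gcongr
    linarith
  have habs : |ξ| ^ 4 = ξ ^ 4 := by rw [← abs_pow, abs_of_nonneg (by positivity)]
  norm_num [habs] at hq'
  have hpos : 0 ≤ C₃ * ξ ^ 4 := by positivity
  constructor
  · intro hlt
    have hlt2 : p + 2 * C₃ * ξ ^ 4 < η := by linarith
    rw [H _ h1]
    have := half_le_sub_of_isTangentGraph hφ H H' hν₀ hφν₀ hbε hγ (by linarith) h2 h1
    linarith [(abs_le.1 hq').1]
  · intro hlt
    have hlt2 : η < p - 2 * C₃ * ξ ^ 4 := by linarith
    rw [H _ h1, not_lt]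
    have := half_le_sub_of_isTangentGraph hφ H H' hν₀ hφν₀ hbε hγ (by linarith) h1 h2
    linarith [(abs_le.1 hq').2]

end Local

/-- The domain is squeezed between cubic graphs uniformly along the boundary. -/
lemma exists_isSqueezedGraph {Ω : Set Plane} (hΩ : IsSmoothDomain Ω) :
    ∃ ρ C : ℝ, 0 < ρ ∧ 0 ≤ C ∧ ∀ b ∈ frontier Ω, ∀ (τ ν : Plane) (γ : ℝ → ℝ),
      IsTangentGraph Ω b τ ν γ → IsSqueezedGraph Ω ρ C b τ ν (iteratedDeriv 2 γ 0) := by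
  have hK : IsCompact (frontier Ω) :=
    Metric.isCompact_of_isClosed_isBounded isClosed_frontier hΩ.bounded_frontier
  -- Shrinking `ρ` and enlarging `C` merges two pieces of the boundary, so a local statement near
  -- each `b₀` is enough.
  refine hK.induction_on (p := fun S => ∃ ρ C : ℝ, 0 < ρ ∧ 0 ≤ C ∧ ∀ b ∈ S,
    ∀ (τ ν : Plane) (γ : ℝ → ℝ),
      IsTangentGraph Ω b τ ν γ → IsSqueezedGraph Ω ρ C b τ ν (iteratedDeriv 2 γ 0)) ?_ ?_ ?_ ?_
  · exact ⟨1, 0, one_pos, le_rfl, by simp⟩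
  · rintro s t hst ⟨ρ, C, hρ, hC, h⟩
    exact ⟨ρ, C, hρ, hC, fun b hb => h b (hst hb)⟩
  · rintro s t ⟨ρ, C, hρ, hC, h⟩ ⟨ρ', C', hρ', hC', h'⟩
    refine ⟨min ρ ρ', max C C', lt_min hρ hρ', hC.trans (le_max_left _ _), ?_⟩
    rintro b (hb | hb) τ ν γ hγ
    · exact (h b hb τ ν γ hγ).mono (min_le_left _ _) (le_max_left _ _)
    · exact (h' b hb τ ν γ hγ).mono (min_le_right _ _) (le_max_right _ _)
  · intro b₀ hb₀
    obtain ⟨τ₀, ν₀, γ₀, hγ₀⟩ := hΩ.exists_graph b₀ hb₀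
    obtain ⟨ρ₁, hρ₁, hmem⟩ := hγ₀.mem_iff
    set φ : Plane → ℝ := fun y => inner ℝ (y - b₀) ν₀ - γ₀ (inner ℝ (y - b₀) τ₀)
    have hφ : ContDiff ℝ ∞ φ := by
      have h1 : ∀ v : Plane, ContDiff ℝ ∞ fun y : Plane => inner ℝ (y - b₀) v := by
        intro v
        exact (contDiff_id.sub contDiff_const).inner ℝ contDiff_const
      exact (h1 ν₀).sub (hγ₀.smooth.comp (h1 τ₀))
    have hφν₀ : fderiv ℝ φ b₀ ν₀ = 1 := by
      have hline : HasDerivAt (fun s : ℝ => φ (b₀ + s • ν₀)) (fderiv ℝ φ b₀ ν₀) 0 := by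
        have hc : HasDerivAt (fun s : ℝ => b₀ + s • ν₀) ν₀ 0 := by
          have := ((hasDerivAt_id (0 : ℝ)).smul_const ν₀).const_add b₀
          refine this.congr_deriv (by simp)
        have hφd : HasFDerivAt φ (fderiv ℝ φ b₀) (b₀ + (0 : ℝ) • ν₀) := by
          simpa using (hφ.differentiable (by simp) b₀).hasFDerivAt
        exact hφd.comp_hasDerivAt (0 : ℝ) hc
      have e : (fun s : ℝ => φ (b₀ + s • ν₀)) = fun s => s := by
        ext s
        have e2 : s • ν₀ = (0 : ℝ) • τ₀ + s • ν₀ := by simp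
        simp only [φ, add_sub_cancel_left]
        rw [e2, frame_inner_left hγ₀.orthonormal, frame_inner_right hγ₀.orthonormal,
          hγ₀.map_zero, sub_zero]
      rw [e] at hline
      exact hline.unique (hasDerivAt_id 0)
    have hcont : Continuous (fderiv ℝ φ) := hφ.continuous_fderiv (by simp)
    obtain ⟨ε₁, hε₁, hclose⟩ := Metric.continuous_iff.1 hcont b₀ (1 / 8) (by norm_num)
    set ε := min ρ₁ ε₁
    have hε : 0 < ε := lt_min hρ₁ hε₁
    obtain ⟨ρ, C, hρ, hC, h⟩ := exists_isSqueezedGraph_near (Ω := Ω) (φ := φ) (b₀ := b₀) (ν₀ := ν₀)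
      (ε := ε) hε hφ
      (fun y hy => by
        rw [hmem y (Metric.ball_subset_ball (min_le_left _ _) hy)]
        exact sub_pos.symm)
      (fun y hy => by
        rw [← dist_eq_norm]
        exact (hclose y ((Metric.mem_ball.1 hy).trans_le (min_le_right _ _))).le)
      (frame_norm_right hγ₀.orthonormal) hφν₀
    exact ⟨Metric.ball b₀ (ε / 2), mem_nhdsWithin_of_mem_nhds
      (Metric.ball_mem_nhds _ (by positivity)), ρ, C, hρ, hC, h⟩

/-- A point of the domain lies on the inward normal at a closest boundary point. -/
lemma eq_add_smul_of_isClosestBoundaryPoint {Ω : Set Plane} (hΩ : IsOpen Ω) {x b τ ν : Plane}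
    {γ : ℝ → ℝ} (hx : x ∈ Ω) (hb : IsClosestBoundaryPoint Ω x b) (hγ : IsTangentGraph Ω b τ ν γ) :
    x = b + ‖b - x‖ • ν := by
  -- A segment leaving `Ω` would meet the boundary closer to `x` than `b`.
  have hball : ∀ y, dist x y < dist x b → y ∈ Ω := by
    intro y hy
    by_contra hyΩ
    obtain ⟨z, hz, hzf⟩ := (convex_segment x y).isPreconnected.inter_frontier_nonempty_of_isOpen hΩ
      ⟨x, left_mem_segment ℝ x y, hx⟩ ⟨y, right_mem_segment ℝ x y, hyΩ⟩
    have := dist_add_dist_of_mem_segment hz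
    linarith [hb.2 z hzf, dist_nonneg (x := z) (y := y)]
  obtain ⟨ρ, hρ, hmem⟩ := hγ.mem_iff
  obtain ⟨a, c, hac⟩ := frame_decomp hγ.orthonormal (x - b)
  have hdist : ∀ ξ η : ℝ, dist x (b + (ξ • τ + η • ν)) ^ 2 = (a - ξ) ^ 2 + (c - η) ^ 2 := by
    intro ξ η
    rw [dist_eq_norm, ← frame_norm_sq hγ.orthonormal]
    congr 2
    rw [← sub_sub, hac]
    module
  have hr : dist x b ^ 2 = a ^ 2 + c ^ 2 := by
    simpa using hdist 0 0
  -- The squared distance from `x` to the graph is minimal at `ξ = 0`; since `γ'(0) = 0`, its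
  -- derivative there is `-2 * a`.
  have ha : a = 0 := by
    set g : ℝ → ℝ := fun ξ => (a - ξ) ^ 2 + (c - γ ξ) ^ 2
    have hγd : HasDerivAt γ 0 0 := by
      have := (hγ.smooth.differentiable (by simp) 0).hasDerivAt
      rwa [hγ.deriv_zero] at this
    have hg : HasDerivAt g (-2 * a) 0 := by
      have := (((hasDerivAt_id (0 : ℝ)).const_sub a).pow 2).add ((hγd.const_sub c).pow 2)
      refine this.congr_deriv ?_
      simp
    have hmin : IsLocalMin g 0 := by
      have hev : ∀ᶠ ξ in 𝓝 (0 : ℝ), b + (ξ • τ + γ ξ • ν) ∈ Metric.ball b ρ := by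
        refine ((continuous_frame b τ ν hγ.smooth.continuous).tendsto 0).eventually
          (Metric.isOpen_ball.mem_nhds ?_)
        simpa [hγ.map_zero] using hρ
      filter_upwards [hev] with ξ hξ
      have hout : b + (ξ • τ + γ ξ • ν) ∉ Ω := by
        rw [hmem _ hξ, add_sub_cancel_left, frame_inner_left hγ.orthonormal,
          frame_inner_right hγ.orthonormal]
        exact lt_irrefl _
      have h1 : dist x b ≤ dist x (b + (ξ • τ + γ ξ • ν)) := by
        by_contra hlt
        exact hout (hball _ (not_le.1 hlt))
      have h2 := pow_le_pow_left₀ dist_nonneg h1 2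
      rw [hr, hdist] at h2
      simpa [g, hγ.map_zero] using h2
    have := hmin.hasDerivAt_eq_zero hg
    linarith
  subst ha
  -- If `c < 0`, points slightly below `b` would lie in the disc about `x`, hence in `Ω`, although
  -- they are under the graph.
  have hc : 0 ≤ c := by
    by_contra hc
    have hc : c < 0 := not_le.1 hc
    set s := min (ρ / 2) (-c)
    have hs : 0 < s := lt_min (by positivity) (by linarith)
    have hs1 : s ≤ ρ / 2 := min_le_left _ _
    have hs2 : s ≤ -c := min_le_right _ _
    have hin : b + ((0 : ℝ) • τ + (-s) • ν) ∈ Ω := by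
      apply hball
      refine lt_of_pow_lt_pow_left₀ 2 dist_nonneg ?_
      rw [hdist, hr]
      nlinarith
    have hb' : b + ((0 : ℝ) • τ + (-s) • ν) ∈ Metric.ball b ρ := by
      rw [Metric.mem_ball, dist_eq_norm, add_sub_cancel_left]
      refine (frame_norm_le hγ.orthonormal _ _).trans_lt ?_
      rw [abs_zero, zero_add, abs_neg, abs_of_pos hs]
      linarith
    rw [hmem _ hb', add_sub_cancel_left, frame_inner_left hγ.orthonormal,
      frame_inner_right hγ.orthonormal, hγ.map_zero] at hin
    linarith
  have hn : ‖b - x‖ = c := by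
    rw [norm_sub_rev, ← dist_eq_norm]
    refine (pow_left_inj₀ dist_nonneg hc two_ne_zero).1 ?_
    rw [hr]; ring
  rw [hn, ← sub_eq_iff_eq_add', hac]
  simp

/-! ### The planar heat kernel in scaled coordinates -/

/-- The heat kernel of the plane at time one. -/
noncomputable def heat (z : Plane) : ℝ := Real.exp (-‖z‖ ^ 2 / 4) / (4 * Real.pi)

lemma heat_nonneg (z : Plane) : 0 ≤ heat z := by unfold heat; positivity

@[fun_prop] lemma continuous_heat : Continuous heat := by unfold heat; fun_prop

lemma heat_frame {τ ν : Plane} (h : Orthonormal ℝ ![τ, ν]) (u w : ℝ) :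
    heat (u • τ + w • ν) = gau u * gau w := by
  unfold heat gau
  rw [frame_norm_sq h, div_mul_div_comm, ← Real.exp_add]
  congr 1
  · congr 1; ring
  · nlinarith [Real.mul_self_sqrt Real.pi_pos.le]

/-- Coordinates in a frame preserve the area. -/
lemma frame_measurePreserving {τ ν : Plane} (h : Orthonormal ℝ ![τ, ν]) :
    MeasurePreserving (fun p : ℝ × ℝ => p.1 • τ + p.2 • ν) volume volume ∧
      MeasurableEmbedding (fun p : ℝ × ℝ => p.1 • τ + p.2 • ν) := by
  set e : ℝ × ℝ ≃ᵐ Plane := (MeasurableEquiv.finTwoArrow (α := ℝ)).symm.trans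
    ((MeasurableEquiv.toLp 2 (Fin 2 → ℝ)).trans (frameBasis h).measurableEquiv.symm)
  have he : (fun p : ℝ × ℝ => p.1 • τ + p.2 • ν) = e := by
    ext1 p
    have h1 : e p = (frameBasis h).repr.symm (WithLp.toLp 2 ![p.1, p.2]) := rfl
    rw [h1, ← (frameBasis h).sum_repr_symm, Fin.sum_univ_two]
    simp [frameBasis]
  rw [he]
  refine ⟨?_, e.measurableEmbedding⟩
  exact ((volume_preserving_finTwoArrow ℝ).symm).trans
    (((EuclideanSpace.volume_preserving_symm_measurableEquiv_toLp (Fin 2)).symm).trans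
      (frameBasis h).measurePreserving_measurableEquiv.symm)

lemma integral_frame {τ ν : Plane} (h : Orthonormal ℝ ![τ, ν]) (g : Plane → ℝ) :
    ∫ p : ℝ × ℝ, g (p.1 • τ + p.2 • ν) = ∫ z, g z :=
  (frame_measurePreserving h).1.integral_comp (frame_measurePreserving h).2 g

lemma integrable_frame {τ ν : Plane} (h : Orthonormal ℝ ![τ, ν]) {g : Plane → ℝ} :
    Integrable (fun p : ℝ × ℝ => g (p.1 • τ + p.2 • ν)) ↔ Integrable g :=
  (frame_measurePreserving h).1.integrable_comp_emb (frame_measurePreserving h).2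

lemma exists_frame : ∃ τ ν : Plane, Orthonormal ℝ ![τ, ν] := by
  refine ⟨EuclideanSpace.basisFun (Fin 2) ℝ 0, EuclideanSpace.basisFun (Fin 2) ℝ 1, ?_⟩
  have e : ![EuclideanSpace.basisFun (Fin 2) ℝ 0, EuclideanSpace.basisFun (Fin 2) ℝ 1]
      = EuclideanSpace.basisFun (Fin 2) ℝ := by
    funext i
    fin_cases i <;> rfl
  rw [e]
  exact (EuclideanSpace.basisFun (Fin 2) ℝ).orthonormal

lemma integrable_pow_mul_one_add_sq_pow_mul_gau (j k : ℕ) :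
    Integrable fun u : ℝ => u ^ j * (1 + u ^ 2) ^ k * gau u := by
  induction k generalizing j with
  | zero => simpa using integrable_pow_mul_gau j
  | succ k ih =>
    refine ((ih j).add (ih (j + 2))).congr (Eventually.of_forall fun u => ?_)
    simp only [Pi.add_apply]
    ring

lemma integrable_one_add_sq_pow_mul_gau (k : ℕ) :
    Integrable fun u : ℝ => (1 + u ^ 2) ^ k * gau u := by
  simpa using integrable_pow_mul_one_add_sq_pow_mul_gau 0 k

/-- Polynomial weight on the coordinate plane. -/
noncomputable def weight (p : ℝ × ℝ) : ℝ := (1 + p.1 ^ 2) * (1 + p.2 ^ 2)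

lemma one_le_weight (p : ℝ × ℝ) : 1 ≤ weight p := by
  unfold weight; nlinarith [sq_nonneg p.1, sq_nonneg p.2, mul_nonneg (sq_nonneg p.1) (sq_nonneg p.2)]

lemma integrable_weight_pow (k : ℕ) :
    Integrable fun p : ℝ × ℝ => weight p ^ k * (gau p.1 * gau p.2) := by
  refine ((integrable_one_add_sq_pow_mul_gau k).mul_prod
    (integrable_one_add_sq_pow_mul_gau k)).congr (Eventually.of_forall fun p => ?_)
  simp only [weight, mul_pow]
  ring

lemma integrable_one_add_norm_sq_pow_mul_heat (k : ℕ) :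
    Integrable fun z : Plane => (1 + ‖z‖ ^ 2) ^ k * heat z := by
  obtain ⟨τ, ν, h⟩ := exists_frame
  rw [← integrable_frame h]
  refine (integrable_weight_pow k).mono' (by fun_prop) (Eventually.of_forall fun p => ?_)
  rw [heat_frame h, frame_norm_sq h, norm_mul, norm_mul, Real.norm_of_nonneg (gau_nonneg _),
    Real.norm_of_nonneg (gau_nonneg _), Real.norm_of_nonneg (by positivity)]
  refine mul_le_mul_of_nonneg_right ?_ (mul_nonneg (gau_nonneg _) (gau_nonneg _))
  refine pow_le_pow_left₀ (by positivity) ?_ k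
  unfold weight
  nlinarith [mul_nonneg (sq_nonneg p.1) (sq_nonneg p.2)]

lemma integrable_heat : Integrable heat := by
  simpa using integrable_one_add_norm_sq_pow_mul_heat 0

lemma integral_heat : ∫ z, heat z = 1 := by
  obtain ⟨τ, ν, h⟩ := exists_frame
  rw [← integral_frame h]
  simp only [heat_frame h]
  rw [Measure.volume_eq_prod, integral_prod_mul, integral_gau, one_mul]

/-- The spatial integral of the heat kernel against the source at time `h²`. -/
noncomputable def scaledIntegral (Ω : Set Plane) (F : Plane → ℝ) (h : ℝ) (x : Plane) : ℝ :=
  ∫ z, Ω.indicator F (x + h • z) * heat z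

/-- Under `y = x + √t z` the planar Jacobian `t` cancels the `t` in the denominator of the kernel.
-/
lemma setIntegral_eq_scaledIntegral {Ω : Set Plane} (hΩ : IsOpen Ω) {f F : Plane → ℝ}
    (hf : EqOn f F Ω) (x : Plane) {t : ℝ} (ht : 0 < t) :
    ∫ y in Ω, Real.exp (-‖x - y‖ ^ 2 / (4 * t)) / (4 * Real.pi * t) * f y
      = scaledIntegral Ω F (√t) x := by
  have hs : 0 < √t := Real.sqrt_pos.2 ht
  rw [← integral_indicator hΩ.measurableSet, ← integral_add_left_eq_self _ x]
  have h := Measure.integral_comp_smul_of_nonneg (μ := (volume : Measure Plane))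
    (fun z => Ω.indicator (fun y => Real.exp (-‖x - y‖ ^ 2 / (4 * t)) / (4 * Real.pi * t) * f y)
      (x + z)) (√t) (hR := hs.le)
  simp only [finrank_euclideanSpace, Fintype.card_fin, smul_eq_mul, Real.sq_sqrt ht.le] at h
  rw [inv_mul_eq_div, eq_div_iff ht.ne'] at h
  rw [← h, ← integral_mul_const]
  unfold scaledIntegral
  congr 1
  ext z
  by_cases hz : x + √t • z ∈ Ω
  · rw [indicator_of_mem hz, indicator_of_mem hz, hf hz]
    have e : ‖x - (x + √t • z)‖ ^ 2 = t * ‖z‖ ^ 2 := by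
      rw [sub_add_cancel_left, norm_neg, norm_smul, mul_pow, Real.norm_of_nonneg hs.le,
        Real.sq_sqrt ht.le]
    rw [e]
    have e2 : -(t * ‖z‖ ^ 2) / (4 * t) = -‖z‖ ^ 2 / 4 := by field_simp
    rw [e2]
    unfold heat
    field_simp
  · rw [indicator_of_notMem hz, indicator_of_notMem hz]
    simp

lemma scaledIntegral_eq_frame (Ω : Set Plane) (F : Plane → ℝ) (h : ℝ) (x : Plane) {τ ν : Plane}
    (hf : Orthonormal ℝ ![τ, ν]) :
    scaledIntegral Ω F h x = ∫ p : ℝ × ℝ, Ω.indicator F (x + h • (p.1 • τ + p.2 • ν))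
      * (gau p.1 * gau p.2) := by
  unfold scaledIntegral
  rw [← integral_frame hf]
  simp only [heat_frame hf]

lemma measurable_indicator_source {Ω : Set Plane} (hΩ : IsOpen Ω) {F : Plane → ℝ}
    (hF : Continuous F) : Measurable (Ω.indicator F) :=
  hF.measurable.indicator hΩ.measurableSet

lemma abs_indicator_source_le {Ω : Set Plane} {F : Plane → ℝ} {M : ℝ} (hM : 0 ≤ M)
    (h : ∀ y ∈ Ω, |F y| ≤ M) (y : Plane) : |Ω.indicator F y| ≤ M := by
  by_cases hy : y ∈ Ω
  · rw [indicator_of_mem hy]; exact h y hy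
  · rw [indicator_of_notMem hy, abs_zero]; exact hM

lemma integrable_indicator_mul_heat {Ω : Set Plane} (hΩ : IsOpen Ω) {F : Plane → ℝ}
    (hF : Continuous F) {M : ℝ} (hM : 0 ≤ M) (hb : ∀ y ∈ Ω, |F y| ≤ M) (h : ℝ) (x : Plane) :
    Integrable fun z => Ω.indicator F (x + h • z) * heat z := by
  refine (integrable_heat.const_mul M).mono' ?_ (Eventually.of_forall fun z => ?_)
  · have h1 : Measurable fun z : Plane => Ω.indicator F (x + h • z) :=
      (measurable_indicator_source hΩ hF).comp (by fun_prop)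
    exact (h1.mul continuous_heat.measurable).aestronglyMeasurable
  · rw [norm_mul, Real.norm_of_nonneg (heat_nonneg z)]
    exact mul_le_mul_of_nonneg_right (abs_indicator_source_le hM hb _) (heat_nonneg z)

lemma intervalIntegrable_scaledIntegral {Ω : Set Plane} (hΩ : IsOpen Ω) {F : Plane → ℝ}
    (hF : Continuous F) {M : ℝ} (hM : 0 ≤ M) (hb : ∀ y ∈ Ω, |F y| ≤ M) (x : Plane) (a b : ℝ) :
    IntervalIntegrable (fun t => scaledIntegral Ω F (√t) x) volume a b := by
  have hmeas : StronglyMeasurable fun t : ℝ => scaledIntegral Ω F (√t) x := by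
    unfold scaledIntegral
    refine StronglyMeasurable.integral_prod_right
      (f := fun (t : ℝ) (z : Plane) => Ω.indicator F (x + √t • z) * heat z) ?_
    have h1 : Measurable fun q : ℝ × Plane => Ω.indicator F (x + √q.1 • q.2) :=
      (measurable_indicator_source hΩ hF).comp (by fun_prop)
    exact (h1.mul (continuous_heat.measurable.comp measurable_snd)).stronglyMeasurable
  have hbound : ∀ t : ℝ, ‖scaledIntegral Ω F (√t) x‖ ≤ M := by
    intro t
    have := norm_integral_le_of_norm_le (integrable_heat.const_mul M)
      (f := fun z => Ω.indicator F (x + √t • z) * heat z) (Eventually.of_forall fun z => by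
        rw [norm_mul, Real.norm_of_nonneg (heat_nonneg z)]
        exact mul_le_mul_of_nonneg_right (abs_indicator_source_le hM hb _) (heat_nonneg z))
    rwa [integral_const_mul, integral_heat, mul_one] at this
  rw [intervalIntegrable_iff]
  exact Measure.integrableOn_of_bounded (M := M) (by simp) hmeas.aestronglyMeasurable
    (Eventually.of_forall hbound)

/-- Pointwise control of the spatial integral gives control of the potential. -/
lemma abs_localVolumePotential_sub_le {Ω : Set Plane} (hΩ : IsOpen Ω) {f F : Plane → ℝ}
    (hf : EqOn f F Ω) (hF : Continuous F) {M : ℝ} (hM : 0 ≤ M) (hb : ∀ y ∈ Ω, |F y| ≤ M)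
    (x : Plane) {δ : ℝ} (hδ : 0 < δ) {P : ℝ → ℝ} (hP : IntervalIntegrable P volume 0 δ) {B : ℝ}
    (hB : ∀ t, 0 < t → t ≤ δ → |scaledIntegral Ω F (√t) x - P t| ≤ B) :
    |localVolumePotential Ω f δ x - ∫ t in (0 : ℝ)..δ, P t| ≤ B * δ := by
  have h1 : localVolumePotential Ω f δ x = ∫ t in (0 : ℝ)..δ, scaledIntegral Ω F (√t) x := by
    unfold localVolumePotential
    refine intervalIntegral.integral_congr_ae (Eventually.of_forall fun t ht => ?_)
    rw [uIoc_of_le hδ.le] at ht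
    exact setIntegral_eq_scaledIntegral hΩ hf x ht.1
  rw [h1, ← intervalIntegral.integral_sub (intervalIntegrable_scaledIntegral hΩ hF hM hb x 0 δ) hP]
  have := intervalIntegral.norm_integral_le_of_norm_le_const (a := 0) (b := δ) (C := B)
    (f := fun t => scaledIntegral Ω F (√t) x - P t) (fun t ht => by
      rw [uIoc_of_le hδ.le] at ht
      exact hB t ht.1 ht.2)
  rwa [sub_zero, abs_of_pos hδ, Real.norm_eq_abs] at this

/-! ### Points away from the boundary -/

/-- Mass of the heat kernel, with a quartic weight, outside a disc. -/
lemma integral_tail_heat {a h : ℝ} (ha : 0 ≤ a) :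
    ∫ z : Plane, {z : Plane | a ≤ ‖z‖}.indicator (fun z => (1 + h ^ 4 * ‖z‖ ^ 4) * heat z) z
      = (1 + h ^ 4 * (a ^ 4 + 8 * a ^ 2 + 32)) * Real.exp (-a ^ 2 / 4) := by
  set g : ℝ → ℝ := fun y => (Ici a).indicator
    (fun y => (1 + h ^ 4 * y ^ 4) * (Real.exp (-y ^ 2 / 4) / (4 * Real.pi))) y
  have e1 : (fun z : Plane => {z : Plane | a ≤ ‖z‖}.indicator
      (fun z => (1 + h ^ 4 * ‖z‖ ^ 4) * heat z) z) = fun z => g ‖z‖ := by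
    ext z
    simp only [g, indicator, mem_ofPred_eq, mem_Ici, heat]
  have hpi : Real.pi ≠ 0 := Real.pi_ne_zero
  rw [e1, integral_fun_norm_addHaar]
  have hvol : (volume : Measure Plane).real (Metric.ball 0 1) = Real.pi := by
    simp [Measure.real, EuclideanSpace.volume_ball_fin_two, Real.pi_pos.le]
  rw [hvol, finrank_euclideanSpace, Fintype.card_fin]
  have e2 : (fun y : ℝ => y ^ (2 - 1) • g y) = (Ici a).indicator
      (fun y => y * ((1 + h ^ 4 * y ^ 4) * (Real.exp (-y ^ 2 / 4) / (4 * Real.pi)))) := by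
    ext y
    simp only [g, indicator, mem_Ici, smul_eq_mul]
    split_ifs <;> simp
  have e3 : ∫ y in Ioi (0 : ℝ), y ^ (2 - 1) • g y = ∫ y in Ioi a,
      y * ((1 + h ^ 4 * y ^ 4) * (Real.exp (-y ^ 2 / 4) / (4 * Real.pi))) := by
    rw [e2, ← integral_Ici_eq_integral_Ioi, setIntegral_indicator measurableSet_Ici,
      Ici_inter_Ici, sup_of_le_right ha, integral_Ici_eq_integral_Ioi]
  rw [e3]
  -- In polar coordinates the weight is `y exp(-y² / 4)` times a polynomial in `y²`, which has an
  -- elementary antiderivative: for `P = y⁴ + 8 y² + 32`, `y P / 2 - P' = y⁵ / 2`.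
  have hd : ∀ y ∈ Ici a, HasDerivAt
      (fun y => -((1 + h ^ 4 * (y ^ 4 + 8 * y ^ 2 + 32)) * gau y) * (2 * √Real.pi) / (2 * Real.pi))
      (y * ((1 + h ^ 4 * y ^ 4) * (Real.exp (-y ^ 2 / 4) / (4 * Real.pi)))) y := by
    intro y _
    have h1 := (((hasDerivAt_pow 4 y).add ((hasDerivAt_pow 2 y).const_mul 8)).add_const 32).const_mul
      (h ^ 4) |>.const_add 1
    have h2 := (((h1.mul (hasDerivAt_gau y)).neg).mul_const (2 * √Real.pi)).div_const (2 * Real.pi)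
    refine h2.congr_deriv ?_
    have e : Real.exp (-y ^ 2 / 4) = gau y * (2 * √Real.pi) := by unfold gau; field_simp
    rw [e]
    push_cast
    field_simp
    simp only [Pi.add_apply]
    ring
  have hlim : Tendsto
      (fun y => -((1 + h ^ 4 * (y ^ 4 + 8 * y ^ 2 + 32)) * gau y) * (2 * √Real.pi) / (2 * Real.pi))
      atTop (𝓝 0) := by
    have h1 := ((tendsto_pow_mul_gau 0).const_mul (1 + 32 * h ^ 4)).add
      (((tendsto_pow_mul_gau 4).const_mul (h ^ 4)).add
        ((tendsto_pow_mul_gau 2).const_mul (8 * h ^ 4)))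
    have h2 := ((h1.neg).mul_const (2 * √Real.pi)).div_const (2 * Real.pi)
    simp only [mul_zero, add_zero, neg_zero, zero_mul, zero_div] at h2
    refine h2.congr fun y => ?_
    ring
  have hnn : ∀ y ∈ Ioi a,
      0 ≤ y * ((1 + h ^ 4 * y ^ 4) * (Real.exp (-y ^ 2 / 4) / (4 * Real.pi))) := by
    intro y hy
    have : 0 ≤ y := ha.trans (le_of_lt hy)
    positivity
  rw [integral_Ioi_of_hasDerivAt_of_nonneg' hd hnn hlim]
  simp only [smul_eq_mul, nsmul_eq_mul]
  unfold gau
  push_cast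
  field_simp
  ring

lemma integral_eq_zero_of_odd {g : Plane → ℝ} (hg : ∀ z, g (-z) = -g z) : ∫ z, g z = 0 := by
  have h := integral_neg_eq_self g volume
  simp only [hg, integral_neg] at h
  linarith

lemma integrable_mul_heat_of_le {g : Plane → ℝ} (hg : Continuous g) {C : ℝ} {k : ℕ}
    (h : ∀ z, |g z| ≤ C * (1 + ‖z‖ ^ 2) ^ k) : Integrable fun z => g z * heat z := by
  refine ((integrable_one_add_norm_sq_pow_mul_heat k).const_mul C).mono'
    (by fun_prop) (Eventually.of_forall fun z => ?_)
  rw [norm_mul, Real.norm_of_nonneg (heat_nonneg z), ← mul_assoc]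
  exact mul_le_mul_of_nonneg_right (h z) (heat_nonneg z)

lemma integral_quadratic_mul_gau_mul_gau (α β γ : ℝ) :
    ∫ p : ℝ × ℝ, (p.1 ^ 2 * α + p.1 * p.2 * β + p.2 ^ 2 * γ) * (gau p.1 * gau p.2)
      = 2 * α + 2 * γ := by
  have e : (fun p : ℝ × ℝ => (p.1 ^ 2 * α + p.1 * p.2 * β + p.2 ^ 2 * γ) * (gau p.1 * gau p.2))
      = fun p => α * ((p.1 ^ 2 * gau p.1) * (p.2 ^ 0 * gau p.2))
        + β * ((p.1 ^ 1 * gau p.1) * (p.2 ^ 1 * gau p.2))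
        + γ * ((p.1 ^ 0 * gau p.1) * (p.2 ^ 2 * gau p.2)) := by
    ext p; ring
  have i : ∀ (c : ℝ) (j k : ℕ), Integrable fun p : ℝ × ℝ =>
      c * ((p.1 ^ j * gau p.1) * (p.2 ^ k * gau p.2)) := fun c j k =>
    ((integrable_pow_mul_gau j).mul_prod (integrable_pow_mul_gau k)).const_mul c
  have v : ∀ j k : ℕ, ∫ p : ℝ × ℝ, (p.1 ^ j * gau p.1) * (p.2 ^ k * gau p.2)
      = (∫ u, u ^ j * gau u) * ∫ u, u ^ k * gau u := fun j k => by
    rw [Measure.volume_eq_prod,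
      integral_prod_mul (fun u : ℝ => u ^ j * gau u) (fun u : ℝ => u ^ k * gau u)]
  rw [e, integral_add (by exact (i _ 2 0).add (i _ 1 1)) (i _ 0 2), integral_add (i _ 2 0) (i _ 1 1)]
  simp only [integral_const_mul, v]
  simp only [pow_zero, pow_one, one_mul, integral_gau, integral_id_mul_gau, integral_sq_mul_gau]
  ring

lemma integral_D2_mul_heat (F : Plane → ℝ) (x : Plane) {τ ν : Plane}
    (hf : Orthonormal ℝ ![τ, ν]) :
    ∫ z, D2 F x z z * heat z = 2 * (D2 F x τ τ + D2 F x ν ν) := by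
  rw [← integral_frame hf]
  simp only [heat_frame hf, D2_add_smul]
  rw [integral_quadratic_mul_gau_mul_gau]
  ring

/-- If a disc of radius `R ≤ 1` about `x` lies in the domain, the spatial integral has its
whole-plane expansion up to a term exponentially small in `R`. -/
lemma exists_far_bound {Ω : Set Plane} (hΩ : IsSmoothDomain Ω) {f F : Plane → ℝ}
    (hF : IsSmoothExtension Ω f F) :
    ∃ K : ℝ, 0 ≤ K ∧ ∀ x ∈ Ω, ∀ R : ℝ, 0 < R → R ≤ 1 → Metric.ball x R ⊆ Ω →
      ∀ τ ν : Plane, Orthonormal ℝ ![τ, ν] → ∀ h : ℝ, 0 < h → h ≤ 1 →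
        |scaledIntegral Ω F h x - (F x + h ^ 2 * (D2 F x τ τ + D2 F x ν ν))|
          ≤ K * (h ^ 4 + Real.exp (-R ^ 2 / (4 * h ^ 2))) := by
  obtain ⟨M, hM, hbd, -, hT⟩ := exists_taylor_bounds hΩ hF
  have hI := integrable_one_add_norm_sq_pow_mul_heat 2
  set I₂ := ∫ z : Plane, (1 + ‖z‖ ^ 2) ^ 2 * heat z
  have hI₂ : 0 ≤ I₂ := integral_nonneg fun z => mul_nonneg (by positivity) (heat_nonneg z)
  refine ⟨M * I₂ + 5 * M * 42, by positivity, fun x hx R hR hR1 hball τ ν hf h h0 h1 => ?_⟩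
  have hxc := subset_closure hx
  obtain ⟨b0, b1, b2, b3⟩ := hbd x hxc
  set c₃ : Plane → ℝ := fun z => iteratedFDeriv ℝ 3 F x (fun _ => z)
  have hc₃ : Continuous c₃ := by
    have : Continuous fun z : Plane => (fun _ : Fin 3 => z) := by fun_prop
    exact (iteratedFDeriv ℝ 3 F x).cont.comp this
  have hc₃s : ∀ (s : ℝ) z, c₃ (s • z) = s ^ 3 * c₃ z := by
    intro s z
    have := (iteratedFDeriv ℝ 3 F x).map_smul_univ (fun _ => s) (fun _ => z)
    simpa [c₃] using this
  have hD1c : Continuous fun z => D1 F x z := (fderiv ℝ F x).continuous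
  have hD2c : Continuous fun z => D2 F x z z := by
    have : Continuous fun z : Plane => ![z, z] := by fun_prop
    exact (iteratedFDeriv ℝ 2 F x).cont.comp this
  have hD1s : ∀ (s : ℝ) z, D1 F x (s • z) = s * D1 F x z := by intro s z; simp [D1]
  have hD2s : ∀ (s : ℝ) z, D2 F x (s • z) (s • z) = s ^ 2 * D2 F x z z := by
    intro s z
    have := D2_add_smul F x z 0 s 0
    simpa using this
  -- The cubic term is odd, so it does not change the integral, but it improves the pointwise error
  -- to order `h ^ 4`.
  set T : Plane → ℝ := fun z => taylorTwo F x (h • z) + 1 / 6 * c₃ (h • z)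
  have hTe : ∀ z, T z = F x + h * D1 F x z + h ^ 2 / 2 * D2 F x z z + h ^ 3 / 6 * c₃ z := by
    intro z
    simp only [T, taylorTwo, hD1s, hD2s, hc₃s]
    ring
  have i0 : Integrable fun z => F x * heat z := integrable_heat.const_mul _
  have i1 : Integrable fun z => D1 F x z * heat z := by
    refine integrable_mul_heat_of_le hD1c (C := M) (k := 1) fun z => (b1 z).trans ?_
    gcongr
    nlinarith [sq_nonneg (‖z‖ - 1), sq_nonneg ‖z‖]
  have i2 : Integrable fun z => D2 F x z z * heat z := by
    refine integrable_mul_heat_of_le hD2c (C := M) (k := 1) fun z => (b2 z z).trans ?_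
    gcongr
    nlinarith
  have i3 : Integrable fun z => c₃ z * heat z := by
    refine integrable_mul_heat_of_le hc₃ (C := M) (k := 2) fun z => (b3 z).trans ?_
    gcongr
    nlinarith [sq_nonneg (‖z‖ ^ 2 - ‖z‖), sq_nonneg ‖z‖, norm_nonneg z]
  have v1 : ∫ z, D1 F x z * heat z = 0 := integral_eq_zero_of_odd fun z => by
    simp [D1, heat]
  have v3 : ∫ z, c₃ z * heat z = 0 := integral_eq_zero_of_odd fun z => by
    have := hc₃s (-1) z
    rw [neg_one_smul] at this
    rw [this]
    simp only [heat, norm_neg]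
    ring
  have eT : (fun z => T z * heat z) = fun z => F x * heat z + h * (D1 F x z * heat z)
      + h ^ 2 / 2 * (D2 F x z z * heat z) + h ^ 3 / 6 * (c₃ z * heat z) := by
    ext z; rw [hTe]; ring
  have iT : Integrable fun z => T z * heat z := by
    rw [eT]
    exact ((i0.add (i1.const_mul h)).add (i2.const_mul _)).add (i3.const_mul _)
  have vT : ∫ z, T z * heat z = F x + h ^ 2 * (D2 F x τ τ + D2 F x ν ν) := by
    rw [eT, integral_add (by exact (i0.add (i1.const_mul h)).add (i2.const_mul _)) (i3.const_mul _),
      integral_add (by exact i0.add (i1.const_mul h)) (i2.const_mul _),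
      integral_add i0 (i1.const_mul h)]
    simp only [integral_const_mul, v1, v3, integral_heat, integral_D2_mul_heat F x hf]
    ring
  have iE := integrable_indicator_mul_heat hΩ.isOpen hF.smooth.continuous hM
    (fun y hy => (hbd y (subset_closure hy)).1) h x
  rw [← vT]
  unfold scaledIntegral
  rw [← integral_sub iE iT]
  -- Off `S` the point stays in the disc and Taylor applies. On `S` source and Taylor polynomial are
  -- bounded separately by a quartic weight, and Gaussian decay does the rest.
  set S : Set Plane := {z : Plane | R / h ≤ ‖z‖}
  have hS : MeasurableSet S := measurableSet_le measurable_const measurable_norm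
  have iS : Integrable fun z => S.indicator (fun z => (1 + h ^ 4 * ‖z‖ ^ 4) * heat z) z := by
    refine Integrable.indicator ?_ hS
    refine integrable_mul_heat_of_le (by fun_prop) (C := 1) (k := 2) fun z => ?_
    rw [abs_of_nonneg (by positivity)]
    have : h ^ 4 ≤ 1 := pow_le_one₀ h0.le h1
    nlinarith [sq_nonneg ‖z‖, mul_le_mul_of_nonneg_right this (by positivity : 0 ≤ ‖z‖ ^ 4)]
  have hpt : ∀ z, ‖Ω.indicator F (x + h • z) * heat z - T z * heat z‖
      ≤ M * h ^ 4 * ((1 + ‖z‖ ^ 2) ^ 2 * heat z)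
        + 5 * M * S.indicator (fun z => (1 + h ^ 4 * ‖z‖ ^ 4) * heat z) z := by
    intro z
    rw [← sub_mul, norm_mul, Real.norm_of_nonneg (heat_nonneg z), Real.norm_eq_abs]
    have hn : ‖h • z‖ = h * ‖z‖ := by rw [norm_smul, Real.norm_of_nonneg h0.le]
    by_cases hz : z ∈ S
    · rw [indicator_of_mem hz]
      have hEb := abs_indicator_source_le hM (fun y hy => (hbd y (subset_closure hy)).1)
        (x + h • z)
      set s := h * ‖z‖
      have hs : 0 ≤ s := by positivity
      have hTb : |T z| ≤ M * (1 + s + s ^ 2 + s ^ 3) := by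
        have k1 := b1 (h • z)
        have k2 := b2 (h • z) (h • z)
        have k3 := b3 (h • z)
        rw [hn] at k1 k2 k3
        simp only [T, taylorTwo]
        rw [abs_le] at *
        constructor <;> nlinarith [mul_nonneg hM hs, mul_nonneg hM (pow_nonneg hs 2),
          mul_nonneg hM (pow_nonneg hs 3)]
      have hs4 : 1 + s + s ^ 2 + s ^ 3 ≤ 4 * (1 + s ^ 4) := by
        nlinarith [sq_nonneg (s - 1), sq_nonneg (s ^ 2 - 1), sq_nonneg (s ^ 2 - s), sq_nonneg s]
      have h5 : |Ω.indicator F (x + h • z) - T z| ≤ 5 * M * (1 + h ^ 4 * ‖z‖ ^ 4) := by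
        have e : h ^ 4 * ‖z‖ ^ 4 = s ^ 4 := by rw [← mul_pow]
        rw [e]
        refine (abs_sub _ _).trans ?_
        nlinarith [mul_le_mul_of_nonneg_left hs4 hM, mul_nonneg hM (pow_nonneg hs 4)]
      have h6 : 0 ≤ M * h ^ 4 * ((1 + ‖z‖ ^ 2) ^ 2 * heat z) := by
        have := heat_nonneg z
        positivity
      have h7 := mul_le_mul_of_nonneg_right h5 (heat_nonneg z)
      linarith
    · rw [indicator_of_notMem hz, mul_zero, add_zero]
      have hz' : h * ‖z‖ < R := by
        have : ‖z‖ < R / h := not_le.1 hz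
        rw [lt_div_iff₀ h0] at this
        linarith
      have hin : x + h • z ∈ Ω := hball (by
        rw [Metric.mem_ball, dist_eq_norm, add_sub_cancel_left, hn]
        exact hz')
      rw [indicator_of_mem hin]
      have h5 := hT x hxc (h • z) (by rw [hn]; linarith)
      rw [hn] at h5
      have h6 : M * (h * ‖z‖) ^ 4 ≤ M * h ^ 4 * (1 + ‖z‖ ^ 2) ^ 2 := by
        rw [mul_pow, ← mul_assoc]
        gcongr
        nlinarith [sq_nonneg ‖z‖]
      rw [← mul_assoc]
      exact mul_le_mul_of_nonneg_right (h5.trans h6) (heat_nonneg z)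
  have hfin := norm_integral_le_of_norm_le
    ((hI.const_mul (M * h ^ 4)).add (iS.const_mul (5 * M))) (Eventually.of_forall hpt)
  refine hfin.trans ?_
  rw [integral_add' (hI.const_mul (M * h ^ 4)) (iS.const_mul (5 * M)), integral_const_mul,
    integral_const_mul, integral_tail_heat (by positivity)]
  have e1 : -(R / h) ^ 2 / 4 = -R ^ 2 / (4 * h ^ 2) := by field_simp
  rw [e1]
  set e := Real.exp (-R ^ 2 / (4 * h ^ 2))
  have he : 0 ≤ e := (Real.exp_pos _).le
  -- In the variable `a = R / h`, each factor `h ^ 4` absorbs the powers of `a`, so `R, h ≤ 1` gives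
  -- `1 + 1 + 8 + 32`. No polynomial prefactor is left in front of the exponential.
  have h42 : 1 + h ^ 4 * ((R / h) ^ 4 + 8 * (R / h) ^ 2 + 32) ≤ 42 := by
    have e2 : 1 + h ^ 4 * ((R / h) ^ 4 + 8 * (R / h) ^ 2 + 32)
        = 1 + R ^ 4 + 8 * (R ^ 2 * h ^ 2) + 32 * h ^ 4 := by field_simp; ring
    rw [e2]
    have k1 : R ^ 4 ≤ 1 := pow_le_one₀ hR.le hR1
    have k2 : h ^ 4 ≤ 1 := pow_le_one₀ h0.le h1
    have k3 : R ^ 2 * h ^ 2 ≤ 1 := mul_le_one₀ (pow_le_one₀ hR.le hR1) (by positivity)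
      (pow_le_one₀ h0.le h1)
    linarith
  calc M * h ^ 4 * I₂ + 5 * M * ((1 + h ^ 4 * ((R / h) ^ 4 + 8 * (R / h) ^ 2 + 32)) * e)
      ≤ M * h ^ 4 * I₂ + 5 * M * (42 * e) := by gcongr
    _ = (M * I₂) * h ^ 4 + (5 * M * 42) * e := by ring
    _ ≤ (M * I₂ + 5 * M * 42) * h ^ 4 + (M * I₂ + 5 * M * 42) * e := by
      gcongr <;> nlinarith [mul_nonneg hM hI₂]
    _ = _ := by ring

/-! ### Taylor expansion of the Gaussian half-line integrals -/

/-- Mean value inequality on the segment from `0` to `θ`; iterated, it gives Taylor bounds without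
factorials. -/
lemma abs_le_mul_pow_succ {g g' : ℝ → ℝ} (hg : ∀ t, HasDerivAt g (g' t) t) (h0 : g 0 = 0) {c : ℝ}
    {n : ℕ} (hc : 0 ≤ c) (hb : ∀ t, |g' t| ≤ c * |t| ^ n) (θ : ℝ) : |g θ| ≤ c * |θ| ^ (n + 1) := by
  have h := (convex_uIcc 0 θ).norm_image_sub_le_of_norm_hasDerivWithin_le
    (f := g) (f' := g') (C := c * |θ| ^ n) (fun t _ => (hg t).hasDerivWithinAt) (fun t ht => ?_)
    left_mem_uIcc right_mem_uIcc
  · rw [h0, sub_zero, sub_zero, Real.norm_eq_abs, Real.norm_eq_abs] at h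
    rw [pow_succ, ← mul_assoc]
    exact h
  · refine (hb t).trans ?_
    have : |t| ≤ |θ| := by simpa using abs_sub_left_of_mem_uIcc ht
    gcongr

lemma abs_sub_le_of_deriv {f f' : ℝ → ℝ} (hf : ∀ t, HasDerivAt f (f' t) t) {c : ℝ}
    (hb : ∀ t, |f' t| ≤ c) (σ θ : ℝ) : |f (σ + θ) - f σ| ≤ c * |θ| := by
  have hc : 0 ≤ c := (abs_nonneg _).trans (hb 0)
  have := abs_le_mul_pow_succ (g := fun t => f (σ + t) - f σ) (g' := fun t => f' (σ + t)) (c := c)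
    (n := 0) (fun t => ((hf (σ + t)).comp_const_add σ t).sub_const _) (by simp) hc
    (fun t => by simpa using hb _) θ
  simpa using this

lemma abs_sub_le_of_deriv_two {f f' f'' : ℝ → ℝ} (hf : ∀ t, HasDerivAt f (f' t) t)
    (hf' : ∀ t, HasDerivAt f' (f'' t) t) {c : ℝ} (hb : ∀ t, |f'' t| ≤ c) (σ θ : ℝ) :
    |f (σ + θ) - f σ - f' σ * θ| ≤ c * |θ| ^ 2 := by
  have hc : 0 ≤ c := (abs_nonneg _).trans (hb 0)
  refine abs_le_mul_pow_succ (g := fun t => f (σ + t) - f σ - f' σ * t)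
    (g' := fun t => f' (σ + t) - f' σ) (c := c) (n := 1) (fun t => ?_) (by simp) hc
    (fun t => by simpa using abs_sub_le_of_deriv hf' hb σ t) θ
  have := (((hf (σ + t)).comp_const_add σ t).sub_const (f σ)).sub
    ((hasDerivAt_id t).const_mul (f' σ))
  refine this.congr_deriv (by simp)

lemma abs_sub_le_of_deriv_three {f f' f'' f''' : ℝ → ℝ} (hf : ∀ t, HasDerivAt f (f' t) t)
    (hf' : ∀ t, HasDerivAt f' (f'' t) t) (hf'' : ∀ t, HasDerivAt f'' (f''' t) t) {c : ℝ}
    (hb : ∀ t, |f''' t| ≤ c) (σ θ : ℝ) :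
    |f (σ + θ) - f σ - f' σ * θ - f'' σ * θ ^ 2 / 2| ≤ c * |θ| ^ 3 := by
  have hc : 0 ≤ c := (abs_nonneg _).trans (hb 0)
  refine abs_le_mul_pow_succ (g := fun t => f (σ + t) - f σ - f' σ * t - f'' σ * t ^ 2 / 2)
    (g' := fun t => f' (σ + t) - f' σ - f'' σ * t) (c := c) (n := 2) (fun t => ?_) (by simp) hc
    (fun t => abs_sub_le_of_deriv_two hf' hf'' hb σ t) θ
  have := ((((hf (σ + t)).comp_const_add σ t).sub_const (f σ)).sub
    ((hasDerivAt_id t).const_mul (f' σ))).sub ((((hasDerivAt_pow 2 t).const_mul (f'' σ))).div_const 2)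
  refine this.congr_deriv ?_
  push_cast
  ring

/-- Derivative of the Gaussian density. -/
noncomputable def gauDeriv (u : ℝ) : ℝ := -(u / 2) * gau u

/-- The second Gaussian moment over a half-line. -/
noncomputable def tailTwo (s : ℝ) : ℝ := 2 * s * gau s + 2 * tail s

lemma hasDerivAt_gauDeriv (u : ℝ) :
    HasDerivAt gauDeriv ((u ^ 2 / 4 - 1 / 2) * gau u) u := by
  have := (((hasDerivAt_id u).div_const 2).neg).mul (hasDerivAt_gau u)
  refine this.congr_deriv ?_
  simp only [id, Pi.neg_apply]
  ring

lemma hasDerivAt_tailTwo (s : ℝ) : HasDerivAt tailTwo (-(s ^ 2 * gau s)) s := by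
  have := (((hasDerivAt_id s).const_mul 2).mul (hasDerivAt_gau s)).add
    ((hasDerivAt_tail s).const_mul 2)
  refine this.congr_deriv ?_
  simp only [id]
  ring

/-- Uniform Taylor bounds for the Gaussian density and the half-line moments. -/
lemma exists_gaussian_taylor_bounds : ∃ c : ℝ, 1 ≤ c ∧
    (∀ s, |tail s| ≤ c ∧ |gau s| ≤ c ∧ |gauDeriv s| ≤ c ∧ |tailTwo s| ≤ c) ∧
    (∀ σ θ, |tail (σ + θ) - tail σ| ≤ c * |θ|) ∧
    (∀ σ θ, |tail (σ + θ) - tail σ + gau σ * θ| ≤ c * |θ| ^ 2) ∧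
    (∀ σ θ, |tail (σ + θ) - tail σ + gau σ * θ + gauDeriv σ * θ ^ 2 / 2| ≤ c * |θ| ^ 3) ∧
    (∀ σ θ, |gau (σ + θ) - gau σ| ≤ c * |θ|) ∧
    (∀ σ θ, |gau (σ + θ) - gau σ - gauDeriv σ * θ| ≤ c * |θ| ^ 2) ∧
    (∀ σ θ, |tailTwo (σ + θ) - tailTwo σ| ≤ c * |θ|) := by
  obtain ⟨C₁, hC₁, h₁⟩ := exists_pow_mul_gau_le 1
  obtain ⟨C₂, hC₂, h₂⟩ := exists_pow_mul_gau_le 2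
  set c := 2 + 2 * C₁ + C₂
  have g0 : ∀ s, |gau s| ≤ c := fun s => by
    rw [abs_of_nonneg (gau_nonneg s)]
    linarith [gau_le_one s]
  have t0 : ∀ s, |tail s| ≤ c := fun s => by
    rw [abs_of_nonneg (tail_nonneg s)]
    linarith [tail_le_one s]
  have g1 : ∀ s, |gauDeriv s| ≤ c := fun s => by
    have := h₁ s
    rw [gauDeriv, abs_mul, abs_neg, abs_div, abs_two, abs_of_nonneg (gau_nonneg s)]
    rw [pow_one] at this
    linarith
  have g2 : ∀ s, |(s ^ 2 / 4 - 1 / 2) * gau s| ≤ c := fun s => by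
    have h3 := h₂ s
    rw [sq_abs] at h3
    have := gau_le_one s
    have := mul_nonneg (sq_nonneg s) (gau_nonneg s)
    have := gau_nonneg s
    rw [abs_le]
    constructor <;> nlinarith
  have m0 : ∀ s, |tailTwo s| ≤ c := fun s => by
    have h3 := h₁ s
    rw [tailTwo]
    refine (abs_add_le _ _).trans ?_
    rw [abs_mul, abs_mul, abs_mul, abs_two, abs_of_nonneg (gau_nonneg s),
      abs_of_nonneg (tail_nonneg s)]
    rw [pow_one] at h3
    linarith [tail_le_one s]
  have m1 : ∀ s, |-(s ^ 2 * gau s)| ≤ c := fun s => by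
    have h3 := h₂ s
    rw [abs_neg, abs_mul, abs_pow, abs_of_nonneg (gau_nonneg s)]
    linarith
  have hT : ∀ t, HasDerivAt tail (-gau t) t := hasDerivAt_tail
  have hG : ∀ t, HasDerivAt gau (gauDeriv t) t := hasDerivAt_gau
  have hG' : ∀ t, HasDerivAt (fun t => -gau t) (-gauDeriv t) t := fun t => (hG t).neg
  have hG'' : ∀ t, HasDerivAt (fun t => -gauDeriv t) (-((t ^ 2 / 4 - 1 / 2) * gau t)) t :=
    fun t => (hasDerivAt_gauDeriv t).neg
  refine ⟨c, by linarith, fun s => ⟨t0 s, g0 s, g1 s, m0 s⟩, ?_, ?_, ?_, ?_, ?_, ?_⟩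
  · exact abs_sub_le_of_deriv hT (fun t => by rw [abs_neg]; exact g0 t)
  · intro σ θ
    have := abs_sub_le_of_deriv_two hT hG' (c := c) (fun t => by rw [abs_neg]; exact g1 t) σ θ
    rwa [neg_mul, sub_neg_eq_add] at this
  · intro σ θ
    have := abs_sub_le_of_deriv_three hT hG' hG'' (c := c)
      (fun t => by rw [abs_neg]; exact g2 t) σ θ
    rwa [neg_mul, sub_neg_eq_add, neg_mul, neg_div, sub_neg_eq_add] at this
  · exact abs_sub_le_of_deriv hG g1
  · exact abs_sub_le_of_deriv_two hG hasDerivAt_gauDeriv g2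
  · exact abs_sub_le_of_deriv hasDerivAt_tailTwo m1

/-! ### The model problem: a quadratic source above a cubic graph -/

/-- A quadratic polynomial in scaled coordinates. -/
noncomputable def quadSource (h f₀ p q A B D : ℝ) (z : ℝ × ℝ) : ℝ :=
  f₀ + h * (p * z.1 + q * z.2) + h ^ 2 * (A * z.1 ^ 2 + B * (z.1 * z.2) + D * z.2 ^ 2)

/-- The cubic graph in scaled coordinates, at distance `ρ` below the origin. -/
noncomputable def cubicGraph (h ρ a b u : ℝ) : ℝ := -ρ + (a * h * u ^ 2 + b * h ^ 2 * u ^ 3)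

lemma continuous_quadSource (h f₀ p q A B D : ℝ) : Continuous (quadSource h f₀ p q A B D) := by
  unfold quadSource; fun_prop

lemma continuous_cubicGraph (h ρ a b : ℝ) : Continuous (cubicGraph h ρ a b) := by
  unfold cubicGraph; fun_prop

lemma abs_fst_le_weight (z : ℝ × ℝ) : |z.1| ≤ weight z := by
  unfold weight
  have := sq_abs z.1
  nlinarith [sq_nonneg (|z.1| - 1), sq_nonneg z.2, mul_nonneg (sq_nonneg z.1) (sq_nonneg z.2)]

lemma abs_snd_le_weight (z : ℝ × ℝ) : |z.2| ≤ weight z := by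
  unfold weight
  have := sq_abs z.2
  nlinarith [sq_nonneg (|z.2| - 1), sq_nonneg z.1, mul_nonneg (sq_nonneg z.1) (sq_nonneg z.2)]

lemma sq_fst_le_weight (z : ℝ × ℝ) : z.1 ^ 2 ≤ weight z := by
  unfold weight
  nlinarith [sq_nonneg z.2, mul_nonneg (sq_nonneg z.1) (sq_nonneg z.2)]

lemma sq_snd_le_weight (z : ℝ × ℝ) : z.2 ^ 2 ≤ weight z := by
  unfold weight
  nlinarith [sq_nonneg z.1, mul_nonneg (sq_nonneg z.1) (sq_nonneg z.2)]

lemma abs_mul_le_weight (z : ℝ × ℝ) : |z.1 * z.2| ≤ weight z := by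
  rw [abs_mul]
  unfold weight
  nlinarith [sq_abs z.1, sq_abs z.2, sq_nonneg (|z.1| - |z.2|),
    mul_nonneg (sq_nonneg z.1) (sq_nonneg z.2), sq_nonneg (|z.1| * |z.2|)]

lemma abs_quadSource_le {M h f₀ p q A B D : ℝ} (hM : 0 ≤ M) (h0 : 0 ≤ h) (h1 : h ≤ 1)
    (hf₀ : |f₀| ≤ M) (hp : |p| ≤ M) (hq : |q| ≤ M) (hA : |A| ≤ M) (hB : |B| ≤ M) (hD : |D| ≤ M)
    (z : ℝ × ℝ) : |quadSource h f₀ p q A B D z| ≤ 6 * M * weight z := by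
  have hW := one_le_weight z
  have hMW : M * 1 ≤ M * weight z := by gcongr
  have k1 : |p * z.1| ≤ M * weight z := by
    rw [abs_mul]; exact mul_le_mul hp (abs_fst_le_weight z) (abs_nonneg _) hM
  have k2 : |q * z.2| ≤ M * weight z := by
    rw [abs_mul]; exact mul_le_mul hq (abs_snd_le_weight z) (abs_nonneg _) hM
  have k3 : |A * z.1 ^ 2| ≤ M * weight z := by
    rw [abs_mul, abs_of_nonneg (sq_nonneg z.1)]
    exact mul_le_mul hA (sq_fst_le_weight z) (sq_nonneg _) hM
  have k4 : |B * (z.1 * z.2)| ≤ M * weight z := by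
    rw [abs_mul]; exact mul_le_mul hB (abs_mul_le_weight z) (abs_nonneg _) hM
  have k5 : |D * z.2 ^ 2| ≤ M * weight z := by
    rw [abs_mul, abs_of_nonneg (sq_nonneg z.2)]
    exact mul_le_mul hD (sq_snd_le_weight z) (sq_nonneg _) hM
  have k6 : |h * (p * z.1 + q * z.2)| ≤ 2 * (M * weight z) := by
    rw [abs_mul, abs_of_nonneg h0]
    have := (abs_add_le (p * z.1) (q * z.2))
    calc _ ≤ 1 * |p * z.1 + q * z.2| := by gcongr
      _ ≤ _ := by linarith
  have k7 : |h ^ 2 * (A * z.1 ^ 2 + B * (z.1 * z.2) + D * z.2 ^ 2)| ≤ 3 * (M * weight z) := by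
    rw [abs_mul, abs_of_nonneg (sq_nonneg h)]
    have := abs_add_three (A * z.1 ^ 2) (B * (z.1 * z.2)) (D * z.2 ^ 2)
    calc _ ≤ 1 * |A * z.1 ^ 2 + B * (z.1 * z.2) + D * z.2 ^ 2| := by
          gcongr
          exact pow_le_one₀ h0 h1
      _ ≤ _ := by linarith
  have := abs_add_three f₀ (h * (p * z.1 + q * z.2))
    (h ^ 2 * (A * z.1 ^ 2 + B * (z.1 * z.2) + D * z.2 ^ 2))
  unfold quadSource
  linarith

/-- The weights are those of the ten remainder terms in `abs_modelSlice_sub_le`; with the doubled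
terms counted twice they add up to `33`. -/
lemma abs_alternating_sum_le {x₁ x₂ x₃ x₄ x₅ x₆ x₇ x₈ x₉ x₁₀ Z : ℝ} (b1 : |x₁| ≤ 8 * Z)
    (b2 : |x₂| ≤ Z) (b3 : |x₃| ≤ Z) (b4 : |x₄| ≤ 4 * Z) (b5 : |x₅| ≤ Z) (b6 : |x₆| ≤ 2 * Z)
    (b7 : |x₇| ≤ 4 * Z) (b8 : |x₈| ≤ Z) (b9 : |x₉| ≤ 2 * Z) (b10 : |x₁₀| ≤ 2 * Z) :
    |x₁ - x₂ - x₃ + x₄ - x₅ + x₆ + 2 * x₇ + 2 * x₈ + 2 * x₉ + x₁₀| ≤ 40 * Z := by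
  rw [abs_le] at *
  constructor <;> linarith

set_option maxHeartbeats 1000000 in
/-- Algebraic core of the expansion in `h` for a fixed tangential coordinate. -/
lemma abs_modelSlice_sub_le {c M h u f₀ p q A B D a b T g g₁ m Ts gs ms : ℝ} (hc : 1 ≤ c)
    (hM : 1 ≤ M) (h0 : 0 ≤ h) (h1 : h ≤ 1) (hf₀ : |f₀| ≤ M) (hp : |p| ≤ M) (hq : |q| ≤ M)
    (hA : |A| ≤ M) (hB : |B| ≤ M) (hD : |D| ≤ M) (ha : |a| ≤ M) (hb : |b| ≤ M)
    (hg : |g| ≤ c) (hg₁ : |g₁| ≤ c) {θ : ℝ} (hθ : θ = a * h * u ^ 2 + b * h ^ 2 * u ^ 3)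
    (t1 : |Ts - T| ≤ c * |θ|) (t2 : |Ts - T + g * θ| ≤ c * |θ| ^ 2)
    (t3 : |Ts - T + g * θ + g₁ * θ ^ 2 / 2| ≤ c * |θ| ^ 3) (s1 : |gs - g| ≤ c * |θ|)
    (s2 : |gs - g - g₁ * θ| ≤ c * |θ| ^ 2) (r1 : |ms - m| ≤ c * |θ|) :
    |((f₀ + h * p * u + h ^ 2 * A * u ^ 2) * Ts + (h * q + h ^ 2 * B * u) * (2 * gs)
        + h ^ 2 * D * ms)
      - ((f₀ * T + 2 * h * q * g + h ^ 2 * D * m) + (h * p * T + 2 * h ^ 2 * B * g) * u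
        + (-f₀ * g * a * h + h ^ 2 * A * T + 2 * h ^ 2 * q * g₁ * a) * u ^ 2
        + (-f₀ * g * b * h ^ 2 - h ^ 2 * p * g * a) * u ^ 3
        + (-f₀ * g₁ * a ^ 2 * h ^ 2 / 2) * u ^ 4)|
      ≤ 40 * (c * M ^ 4 * (h ^ 3 * (1 + u ^ 2) ^ 6)) := by
  set Y := 1 + u ^ 2
  have hY : 1 ≤ Y := by nlinarith [sq_nonneg u]
  have hM0 : 0 ≤ M := by linarith
  have hc0 : 0 ≤ c := by linarith
  have hY0 : 0 ≤ Y := by linarith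
  have u1 : |u| ≤ Y := by nlinarith [sq_abs u, sq_nonneg (|u| - 1)]
  have u2 : |u| ^ 2 ≤ Y := by rw [sq_abs]; linarith
  have u3 : |u| ^ 3 ≤ Y ^ 2 := by
    calc |u| ^ 3 = |u| ^ 2 * |u| := by ring
      _ ≤ Y * Y := by gcongr
      _ = Y ^ 2 := by ring
  have u5 : |u| ^ 5 ≤ Y ^ 3 := by
    calc |u| ^ 5 = |u| ^ 2 * |u| ^ 3 := by ring
      _ ≤ Y * Y ^ 2 := by gcongr
      _ = Y ^ 3 := by ring
  have u6 : |u| ^ 6 ≤ Y ^ 3 := by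
    calc |u| ^ 6 = (|u| ^ 2) ^ 3 := by ring
      _ ≤ Y ^ 3 := by gcongr
  -- As `M` and `Y` are at least one and `h` at most one, every remainder is brought to the same
  -- monomial.
  have up : ∀ {j k l : ℕ}, 3 ≤ j → k ≤ 4 → l ≤ 6 →
      c * M ^ k * (h ^ j * Y ^ l) ≤ c * M ^ 4 * (h ^ 3 * Y ^ 6) := by
    intro j k l hj hk hl
    have e1 := pow_le_pow_right₀ hM hk
    have e2 := pow_le_pow_right₀ hY hl
    have e3 := pow_le_pow_of_le_one h0 h1 hj
    gcongr
  have hθb : |θ| ≤ 2 * (M * h * Y ^ 2) := by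
    rw [hθ]
    refine (abs_add_le _ _).trans ?_
    simp only [abs_mul, abs_pow, abs_of_nonneg h0]
    have e1 : |a| * h * |u| ^ 2 ≤ M * h * Y ^ 2 := by
      have : Y ≤ Y ^ 2 := by nlinarith
      gcongr
    have e2 : |b| * h ^ 2 * |u| ^ 3 ≤ M * h * Y ^ 2 := by
      have : h ^ 2 ≤ h := by nlinarith
      gcongr
    linarith
  have hθ0 := abs_nonneg θ
  -- The remainder splits into Taylor remainders in `θ`, which is of size `h`, and products in `θ`
  -- and `θ ^ 2` of total order at least `h ^ 3`.
  have e : ((f₀ + h * p * u + h ^ 2 * A * u ^ 2) * Ts + (h * q + h ^ 2 * B * u) * (2 * gs)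
        + h ^ 2 * D * ms)
      - ((f₀ * T + 2 * h * q * g + h ^ 2 * D * m) + (h * p * T + 2 * h ^ 2 * B * g) * u
        + (-f₀ * g * a * h + h ^ 2 * A * T + 2 * h ^ 2 * q * g₁ * a) * u ^ 2
        + (-f₀ * g * b * h ^ 2 - h ^ 2 * p * g * a) * u ^ 3
        + (-f₀ * g₁ * a ^ 2 * h ^ 2 / 2) * u ^ 4)
      = f₀ * (Ts - T + g * θ + g₁ * θ ^ 2 / 2)
        - f₀ * g₁ * (a * b * h ^ 3 * u ^ 5)
        - f₀ * g₁ * (b ^ 2 * h ^ 4 * u ^ 6) / 2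
        + h * p * u * (Ts - T + g * θ)
        - h * p * g * (b * h ^ 2 * u ^ 4)
        + h ^ 2 * A * u ^ 2 * (Ts - T)
        + 2 * (h * q * (gs - g - g₁ * θ))
        + 2 * (h * q * g₁ * (b * h ^ 2 * u ^ 3))
        + 2 * (h ^ 2 * B * u * (gs - g))
        + h ^ 2 * D * (ms - m) := by
    rw [hθ]; ring
  rw [e]
  set Z := c * M ^ 4 * (h ^ 3 * Y ^ 6)
  have b1 : |f₀ * (Ts - T + g * θ + g₁ * θ ^ 2 / 2)| ≤ 8 * Z := by
    rw [abs_mul]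
    calc _ ≤ M * (c * |θ| ^ 3) := by gcongr
      _ ≤ M * (c * (2 * (M * h * Y ^ 2)) ^ 3) := by gcongr
      _ = 8 * (c * M ^ 4 * (h ^ 3 * Y ^ 6)) := by ring
  have b2 : |f₀ * g₁ * (a * b * h ^ 3 * u ^ 5)| ≤ Z := by
    simp only [abs_mul, abs_pow, abs_of_nonneg h0]
    calc _ ≤ M * c * (M * M * h ^ 3 * Y ^ 3) := by gcongr
      _ = c * M ^ 3 * (h ^ 3 * Y ^ 3) := by ring
      _ ≤ Z := up le_rfl (by norm_num) (by norm_num)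
  have b3 : |f₀ * g₁ * (b ^ 2 * h ^ 4 * u ^ 6) / 2| ≤ Z := by
    rw [abs_div, abs_two]
    refine (half_le_self (abs_nonneg _)).trans ?_
    simp only [abs_mul, abs_pow, abs_of_nonneg h0]
    calc _ ≤ M * c * (M ^ 2 * h ^ 4 * Y ^ 3) := by gcongr
      _ = c * M ^ 3 * (h ^ 4 * Y ^ 3) := by ring
      _ ≤ Z := up (by norm_num) (by norm_num) (by norm_num)
  have b4 : |h * p * u * (Ts - T + g * θ)| ≤ 4 * Z := by
    rw [abs_mul, abs_mul, abs_mul, abs_of_nonneg h0]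
    calc _ ≤ h * M * Y * (c * |θ| ^ 2) := by gcongr
      _ ≤ h * M * Y * (c * (2 * (M * h * Y ^ 2)) ^ 2) := by gcongr
      _ = 4 * (c * M ^ 3 * (h ^ 3 * Y ^ 5)) := by ring
      _ ≤ 4 * Z := by gcongr ?_ * ?_; exact up le_rfl (by norm_num) (by norm_num)
  have b5 : |h * p * g * (b * h ^ 2 * u ^ 4)| ≤ Z := by
    simp only [abs_mul, abs_pow, abs_of_nonneg h0]
    have u4 : |u| ^ 4 ≤ Y ^ 2 := by
      calc |u| ^ 4 = (|u| ^ 2) ^ 2 := by ring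
        _ ≤ Y ^ 2 := by gcongr
    calc _ ≤ h * M * c * (M * h ^ 2 * Y ^ 2) := by gcongr
      _ = c * M ^ 2 * (h ^ 3 * Y ^ 2) := by ring
      _ ≤ Z := up le_rfl (by norm_num) (by norm_num)
  have b6 : |h ^ 2 * A * u ^ 2 * (Ts - T)| ≤ 2 * Z := by
    simp only [abs_mul, abs_pow, abs_of_nonneg h0]
    calc _ ≤ h ^ 2 * M * Y * (c * |θ|) := by gcongr
      _ ≤ h ^ 2 * M * Y * (c * (2 * (M * h * Y ^ 2))) := by gcongr
      _ = 2 * (c * M ^ 2 * (h ^ 3 * Y ^ 3)) := by ring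
      _ ≤ 2 * Z := by gcongr ?_ * ?_; exact up le_rfl (by norm_num) (by norm_num)
  have b7 : |h * q * (gs - g - g₁ * θ)| ≤ 4 * Z := by
    rw [abs_mul, abs_mul, abs_of_nonneg h0]
    calc _ ≤ h * M * (c * |θ| ^ 2) := by gcongr
      _ ≤ h * M * (c * (2 * (M * h * Y ^ 2)) ^ 2) := by gcongr
      _ = 4 * (c * M ^ 3 * (h ^ 3 * Y ^ 4)) := by ring
      _ ≤ 4 * Z := by gcongr ?_ * ?_; exact up le_rfl (by norm_num) (by norm_num)
  have b8 : |h * q * g₁ * (b * h ^ 2 * u ^ 3)| ≤ Z := by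
    simp only [abs_mul, abs_pow, abs_of_nonneg h0]
    calc _ ≤ h * M * c * (M * h ^ 2 * Y ^ 2) := by gcongr
      _ = c * M ^ 2 * (h ^ 3 * Y ^ 2) := by ring
      _ ≤ Z := up le_rfl (by norm_num) (by norm_num)
  have b9 : |h ^ 2 * B * u * (gs - g)| ≤ 2 * Z := by
    simp only [abs_mul, abs_pow, abs_of_nonneg h0]
    calc _ ≤ h ^ 2 * M * Y * (c * |θ|) := by gcongr
      _ ≤ h ^ 2 * M * Y * (c * (2 * (M * h * Y ^ 2))) := by gcongr
      _ = 2 * (c * M ^ 2 * (h ^ 3 * Y ^ 3)) := by ring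
      _ ≤ 2 * Z := by gcongr ?_ * ?_; exact up le_rfl (by norm_num) (by norm_num)
  have b10 : |h ^ 2 * D * (ms - m)| ≤ 2 * Z := by
    simp only [abs_mul, abs_pow, abs_of_nonneg h0]
    calc _ ≤ h ^ 2 * M * (c * |θ|) := by gcongr
      _ ≤ h ^ 2 * M * (c * (2 * (M * h * Y ^ 2))) := by gcongr
      _ = 2 * (c * M ^ 2 * (h ^ 3 * Y ^ 2)) := by ring
      _ ≤ 2 * Z := by gcongr ?_ * ?_; exact up le_rfl (by norm_num) (by norm_num)
  exact abs_alternating_sum_le b1 b2 b3 b4 b5 b6 b7 b8 b9 b10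

lemma integrable_indicator_quadSource {M h f₀ p q A B D : ℝ} (hM : 0 ≤ M) (h0 : 0 ≤ h)
    (h1 : h ≤ 1) (hf₀ : |f₀| ≤ M) (hp : |p| ≤ M) (hq : |q| ≤ M) (hA : |A| ≤ M) (hB : |B| ≤ M)
    (hD : |D| ≤ M) {S : Set (ℝ × ℝ)} (hS : MeasurableSet S) :
    Integrable fun z : ℝ × ℝ =>
      S.indicator (quadSource h f₀ p q A B D) z * (gau z.1 * gau z.2) := by
  have hT := abs_quadSource_le hM h0 h1 hf₀ hp hq hA hB hD
  have hc := continuous_quadSource h f₀ p q A B D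
  refine ((integrable_weight_pow 1).const_mul (6 * M)).mono' ?_ (Eventually.of_forall fun z => ?_)
  · have hg : Measurable fun z : ℝ × ℝ => gau z.1 * gau z.2 := by fun_prop
    exact ((hc.measurable.indicator hS).mul hg).aestronglyMeasurable
  · have hgg : 0 ≤ gau z.1 * gau z.2 := mul_nonneg (gau_nonneg _) (gau_nonneg _)
    rw [norm_mul, Real.norm_of_nonneg hgg, ← mul_assoc (6 * M), pow_one]
    refine mul_le_mul_of_nonneg_right ?_ hgg
    refine (norm_indicator_le_norm_self _ _).trans (hT z)

/-- The model integral equals the profile up to third order in `h`. -/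
lemma exists_model_bound {M : ℝ} (hM : 1 ≤ M) : ∃ K : ℝ, 0 ≤ K ∧
    ∀ h : ℝ, 0 < h → h ≤ 1 → ∀ ρ κ b f₀ p q A B D : ℝ, |κ| ≤ M → |b| ≤ M → |f₀| ≤ M →
      |p| ≤ M → |q| ≤ M → |A| ≤ M → |B| ≤ M → |D| ≤ M →
      |(∫ z : ℝ × ℝ, {z : ℝ × ℝ | cubicGraph h ρ (κ / 2) b z.1 < z.2}.indicator
          (quadSource h f₀ p q A B D) z * (gau z.1 * gau z.2))
        - profile h (h * ρ) κ f₀ q (2 * A) (2 * D)| ≤ K * h ^ 3 := by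
  obtain ⟨c, hc, hbd, t1, t2, t3, s1, s2, r1⟩ := exists_gaussian_taylor_bounds
  have hY := integrable_one_add_sq_pow_mul_gau 6
  set I := ∫ u, (1 + u ^ 2) ^ 6 * gau u
  have hI : 0 ≤ I := integral_nonneg fun u => mul_nonneg (by positivity) (gau_nonneg u)
  refine ⟨40 * (c * M ^ 4) * I, by positivity, ?_⟩
  intro h h0 h1 ρ κ b f₀ p q A B D hκ hb hf₀ hp hq hA hB hD
  have ha : |κ / 2| ≤ M := by
    rw [abs_div, abs_two]; linarith [abs_nonneg κ]
  set a := κ / 2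
  set s := cubicGraph h ρ a b
  set S : Set (ℝ × ℝ) := {z : ℝ × ℝ | s z.1 < z.2}
  have hS : MeasurableSet S := measurableSet_lt
    ((continuous_cubicGraph h ρ a b).measurable.comp measurable_fst) measurable_snd
  have hint := integrable_indicator_quadSource (by linarith) h0.le h1 hf₀ hp hq hA hB hD hS
  set V : ℝ → ℝ := fun u => (f₀ + h * p * u + h ^ 2 * A * u ^ 2) * tail (s u)
    + (h * q + h ^ 2 * B * u) * (2 * gau (s u)) + h ^ 2 * D * tailTwo (s u)
  -- The normal integral is a half-line moment of a quadratic polynomial, hence explicit.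
  have hslice : ∀ u, ∫ w, S.indicator (quadSource h f₀ p q A B D) (u, w) * (gau u * gau w)
      = V u * gau u := by
    intro u
    have e1 : (fun w => S.indicator (quadSource h f₀ p q A B D) (u, w) * (gau u * gau w))
        = (Ioi (s u)).indicator fun w => (((f₀ + h * p * u + h ^ 2 * A * u ^ 2)
          + (h * q + h ^ 2 * B * u) * w + (h ^ 2 * D) * w ^ 2) * gau w) * gau u := by
      ext w
      by_cases hw : s u < w
      · rw [indicator_of_mem (show (u, w) ∈ S from hw), indicator_of_mem (show w ∈ Ioi (s u) from hw)]
        unfold quadSource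
        ring
      · rw [indicator_of_notMem (show (u, w) ∉ S from hw),
          indicator_of_notMem (show w ∉ Ioi (s u) from hw), zero_mul]
    rw [e1, integral_indicator measurableSet_Ioi, integral_mul_const,
      integral_Ioi_quadratic_mul_gau]
    rfl
  have hVint : Integrable fun u => V u * gau u := by
    have := hint.integral_prod_left
    simpa only [hslice] using this
  have hFub : ∫ z : ℝ × ℝ, S.indicator (quadSource h f₀ p q A B D) z * (gau z.1 * gau z.2)
      = ∫ u, V u * gau u := by
    rw [Measure.volume_eq_prod, integral_prod _ hint]
    simp only [hslice]
  set T := tail (-ρ)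
  set g := gau (-ρ)
  set g₁ := gauDeriv (-ρ)
  set m := tailTwo (-ρ)
  set a₀ := f₀ * T + 2 * h * q * g + h ^ 2 * D * m
  set a₁ := h * p * T + 2 * h ^ 2 * B * g
  set a₂ := -f₀ * g * a * h + h ^ 2 * A * T + 2 * h ^ 2 * q * g₁ * a
  set a₃ := -f₀ * g * b * h ^ 2 - h ^ 2 * p * g * a
  set a₄ := -f₀ * g₁ * a ^ 2 * h ^ 2 / 2
  have hPint := integrable_quartic_mul_gau a₀ a₁ a₂ a₃ a₄
  -- Only `a₀ + 2 a₂ + 12 a₄` survives. The term `-3 / 4 * κ ^ 2` is the fourth moment `12` acting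
  -- on the squared curvature shift of the graph.
  have hprof : profile h (h * ρ) κ f₀ q (2 * A) (2 * D)
      = ∫ u, (a₀ + a₁ * u + a₂ * u ^ 2 + a₃ * u ^ 3 + a₄ * u ^ 4) * gau u := by
    rw [integral_quartic_mul_gau]
    have e1 : h * ρ / h = ρ := by field_simp
    have e2 : T = 1 - tail ρ := tail_neg ρ
    have e3 : g = gau ρ := gau_neg ρ
    have e4 : g₁ = ρ / 2 * gau ρ := by simp only [g₁, gauDeriv, gau_neg]; ring
    have e5 : m = -2 * ρ * gau ρ + 2 * (1 - tail ρ) := by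
      simp only [m, tailTwo, gau_neg, tail_neg]; ring
    unfold profile
    rw [e1]
    simp only [a₀, a₂, a₄, a, e2, e3, e4, e5]
    ring
  rw [hFub, hprof, ← integral_sub hVint hPint]
  have hpt : ∀ u, ‖V u * gau u - (a₀ + a₁ * u + a₂ * u ^ 2 + a₃ * u ^ 3 + a₄ * u ^ 4) * gau u‖
      ≤ 40 * (c * M ^ 4) * h ^ 3 * ((1 + u ^ 2) ^ 6 * gau u) := by
    intro u
    rw [← sub_mul, norm_mul, Real.norm_of_nonneg (gau_nonneg u), ← mul_assoc]
    refine mul_le_mul_of_nonneg_right ?_ (gau_nonneg u)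
    obtain ⟨-, hg, hg₁, -⟩ := hbd (-ρ)
    have := abs_modelSlice_sub_le (u := u) hc hM h0.le h1 hf₀ hp hq hA hB hD ha hb hg hg₁ rfl
      (t1 (-ρ) _) (t2 (-ρ) _) (t3 (-ρ) _) (s1 (-ρ) _) (s2 (-ρ) _) (r1 (-ρ) _)
    refine this.trans (le_of_eq ?_)
    ring
  have := norm_integral_le_of_norm_le (hY.const_mul _) (Eventually.of_forall hpt)
  rw [integral_const_mul] at this
  refine this.trans (le_of_eq ?_)
  ring

/-! ### Points near the boundary -/

/-- Gaussian mass of a thin strip around a graph. -/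
lemma exists_strip_bound : ∃ K : ℝ, 0 ≤ K ∧ ∀ s : ℝ → ℝ, Continuous s → ∀ d : ℝ, 0 ≤ d →
    Integrable (fun z : ℝ × ℝ => {z : ℝ × ℝ | |z.2 - s z.1| ≤ d * z.1 ^ 4}.indicator weight z
      * (gau z.1 * gau z.2)) ∧
    ∫ z : ℝ × ℝ, {z : ℝ × ℝ | |z.2 - s z.1| ≤ d * z.1 ^ 4}.indicator weight z
      * (gau z.1 * gau z.2) ≤ K * d := by
  obtain ⟨C, hC, h2⟩ := exists_pow_mul_gau_le 2
  have hJ := integrable_pow_mul_one_add_sq_pow_mul_gau 4 1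
  set J := ∫ u : ℝ, u ^ 4 * (1 + u ^ 2) ^ 1 * gau u
  have hJ0 : 0 ≤ J := integral_nonneg fun u => mul_nonneg (by positivity) (gau_nonneg u)
  refine ⟨2 * (1 + C) * J, by positivity, fun s hs d hd => ?_⟩
  set S : Set (ℝ × ℝ) := {z : ℝ × ℝ | |z.2 - s z.1| ≤ d * z.1 ^ 4}
  have hS : MeasurableSet S :=
    (isClosed_le (by fun_prop) (by fun_prop) : IsClosed S).measurableSet
  have hint : Integrable fun z : ℝ × ℝ => S.indicator weight z * (gau z.1 * gau z.2) := by
    refine ((integrable_weight_pow 1).indicator hS).congr (Eventually.of_forall fun z => ?_)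
    by_cases hz : z ∈ S
    · simp [hz]
    · simp [hz]
  refine ⟨hint, ?_⟩
  rw [Measure.volume_eq_prod, integral_prod _ hint]
  have hslice : ∀ u, ∫ w, S.indicator weight (u, w) * (gau u * gau w)
      ≤ 2 * (1 + C) * d * (u ^ 4 * (1 + u ^ 2) ^ 1 * gau u) := by
    intro u
    set I := Icc (s u - d * u ^ 4) (s u + d * u ^ 4)
    -- In the normal variable weight times density is bounded, so only the length `2 d u⁴` of the
    -- slice counts. The position `s u` plays no role, which makes the bound uniform in the distance
    -- to the boundary.
    have hle : ∀ w, S.indicator weight (u, w) * (gau u * gau w)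
        ≤ I.indicator (fun _ => (1 + C) * ((1 + u ^ 2) * gau u)) w := by
      intro w
      by_cases hw : (u, w) ∈ S
      · have hwI : w ∈ I := by
          have hw' : |w - s u| ≤ d * u ^ 4 := hw
          rw [abs_le] at hw'
          exact ⟨by linarith [hw'.1], by linarith [hw'.2]⟩
        rw [indicator_of_mem hw, indicator_of_mem hwI]
        have h3 := h2 w
        rw [sq_abs] at h3
        have h4 : (1 + w ^ 2) * gau w ≤ 1 + C := by
          have := gau_le_one w
          linarith
        calc weight (u, w) * (gau u * gau w)
            = ((1 + w ^ 2) * gau w) * ((1 + u ^ 2) * gau u) := by unfold weight; ring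
          _ ≤ _ := mul_le_mul_of_nonneg_right h4
            (mul_nonneg (by positivity) (gau_nonneg u))
      · rw [indicator_of_notMem hw, zero_mul]
        exact indicator_nonneg (fun _ _ => mul_nonneg (by positivity)
          (mul_nonneg (by positivity) (gau_nonneg u))) w
    have hnn : ∀ w, 0 ≤ S.indicator weight (u, w) * (gau u * gau w) := fun w =>
      mul_nonneg (indicator_nonneg (fun z _ => (zero_le_one.trans (one_le_weight z))) _)
        (mul_nonneg (gau_nonneg _) (gau_nonneg _))
    have hIint : Integrable (I.indicator fun _ : ℝ => (1 + C) * ((1 + u ^ 2) * gau u)) :=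
      (integrable_indicator_iff measurableSet_Icc).2 continuousOn_const.integrableOn_Icc
    have hmono := integral_mono_of_nonneg (Eventually.of_forall hnn) hIint
      (Eventually.of_forall hle)
    refine hmono.trans (le_of_eq ?_)
    have hd4 : 0 ≤ d * u ^ 4 := by positivity
    rw [integral_indicator measurableSet_Icc, setIntegral_const, smul_eq_mul, Real.volume_real_Icc,
      max_eq_left (by linarith)]
    ring
  refine (integral_mono hint.integral_prod_left (hJ.const_mul _) hslice).trans (le_of_eq ?_)
  rw [integral_const_mul]
  ring

set_option maxHeartbeats 1000000 in
/-- Uniform expansion of the spatial integral at points on the inward normals, close to the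
boundary. -/
lemma exists_near_bound {Ω : Set Plane} (hΩ : IsSmoothDomain Ω) {f F : Plane → ℝ}
    (hF : IsSmoothExtension Ω f F) :
    ∃ ρ K : ℝ, 0 < ρ ∧ 0 ≤ K ∧ ∀ b ∈ frontier Ω, ∀ (τ ν : Plane) (γ : ℝ → ℝ),
      IsTangentGraph Ω b τ ν γ → ∀ r : ℝ, 0 ≤ r → r ≤ ρ → b + r • ν ∈ closure Ω →
      ∀ h : ℝ, 0 < h → h ≤ 1 →
        |scaledIntegral Ω F h (b + r • ν) - profile h r (iteratedDeriv 2 γ 0) (F (b + r • ν))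
          (D1 F (b + r • ν) ν) (D2 F (b + r • ν) τ τ) (D2 F (b + r • ν) ν ν)| ≤ K * h ^ 3 := by
  obtain ⟨M₀, hM₀, hbd₀, hT₀, -⟩ := exists_taylor_bounds hΩ hF
  obtain ⟨ρ₀, C₀, hρ₀, hC₀, hgraph⟩ := exists_isSqueezedGraph hΩ
  set M := 1 + M₀ + C₀
  have hM1 : 1 ≤ M := by linarith
  have hM : 0 ≤ M := by linarith
  have hMM₀ : M₀ ≤ M := by linarith
  obtain ⟨K₁, hK₁, hmodel⟩ := exists_model_bound hM1
  obtain ⟨K₂, hK₂, hstrip⟩ := exists_strip_bound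
  have hW := integrable_weight_pow 3
  set I := ∫ z : ℝ × ℝ, weight z ^ 3 * (gau z.1 * gau z.2)
  have hI : 0 ≤ I := integral_nonneg fun z => mul_nonneg
    (pow_nonneg (zero_le_one.trans (one_le_weight z)) _)
    (mul_nonneg (gau_nonneg _) (gau_nonneg _))
  -- The halves leave room for `r + h w ≤ 2 ρ ≤ ρ₀` in the graph description and for displacements
  -- of norm at most one in the Taylor bound.
  set ρ := min (ρ₀ / 2) (1 / 2)
  have hρ : 0 < ρ := lt_min (by positivity) (by norm_num)
  have hρ1 : 2 * ρ ≤ ρ₀ := by have : ρ ≤ ρ₀ / 2 := min_le_left _ _; linarith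
  have hρ2 : 2 * ρ ≤ 1 := by have : ρ ≤ 1 / 2 := min_le_right _ _; linarith
  -- The first term serves the Taylor error in the rectangle, the second the crude bound outside it.
  set K₃ := 4 * M + 7 * M / ρ ^ 3
  have hK₃ : 0 ≤ K₃ := by positivity
  refine ⟨ρ, K₃ * I + 6 * M * (K₂ * C₀) + K₁, hρ, by positivity, ?_⟩
  intro b hb τ ν γ hγ r hr hrρ hx h h0 h1
  set x := b + r • ν
  have hf := hγ.orthonormal
  obtain ⟨hκ, a, ha, hsq⟩ := hgraph b hb τ ν γ hγ
  set κ := iteratedDeriv 2 γ 0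
  obtain ⟨b0, b1, b2, -⟩ := hbd₀ x hx
  have hτ1 := frame_norm_left hf
  have hν1 := frame_norm_right hf
  have c2 : ∀ u v : Plane, ‖u‖ = 1 → ‖v‖ = 1 → |D2 F x u v| ≤ M₀ := by
    intro u v hu hv
    have := b2 u v
    rwa [hu, hv, mul_one, mul_one] at this
  set p := D1 F x τ
  set q := D1 F x ν
  set A := D2 F x τ τ / 2
  set B := (D2 F x τ ν + D2 F x ν τ) / 2
  set D := D2 F x ν ν / 2
  have hp : |p| ≤ M := by have := b1 τ; rw [hτ1, mul_one] at this; linarith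
  have hq : |q| ≤ M := by have := b1 ν; rw [hν1, mul_one] at this; linarith
  have hA : |A| ≤ M := by
    have := c2 τ τ hτ1 hτ1
    rw [abs_div, abs_two]; linarith
  have hB : |B| ≤ M := by
    have := c2 τ ν hτ1 hν1
    have := c2 ν τ hν1 hτ1
    have := abs_add_le (D2 F x τ ν) (D2 F x ν τ)
    rw [abs_div, abs_two]; linarith
  have hD : |D| ≤ M := by
    have := c2 ν ν hν1 hν1
    rw [abs_div, abs_two]; linarith
  have hF0 : |F x| ≤ M := b0.trans hMM₀
  set Q := quadSource h (F x) p q A B D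
  have hQ : ∀ z : ℝ × ℝ, taylorTwo F x (h • (z.1 • τ + z.2 • ν)) = Q z := by
    intro z
    rw [smul_add, smul_smul, smul_smul, taylorTwo, D1_add_smul, D2_add_smul]
    simp only [Q, quadSource, A, B, D, p, q]
    ring
  have hQb : ∀ z, |Q z| ≤ 6 * M * weight z :=
    abs_quadSource_le hM h0.le h1 hF0 hp hq hA hB hD
  set s := cubicGraph h (r / h) (κ / 2) a
  have hs : Continuous s := continuous_cubicGraph _ _ _ _
  set S : Set (ℝ × ℝ) := {z : ℝ × ℝ | s z.1 < z.2}
  have hS : MeasurableSet S := measurableSet_lt (hs.measurable.comp measurable_fst) measurable_snd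
  set N : Set (ℝ × ℝ) := {z : ℝ × ℝ | |z.2 - s z.1| ≤ C₀ * h ^ 3 * z.1 ^ 4}
  set E : ℝ × ℝ → ℝ := fun z => Ω.indicator F (x + h • (z.1 • τ + z.2 • ν))
  have hEb : ∀ z, |E z| ≤ M := fun z => abs_indicator_source_le hM
    (fun y hy => ((hbd₀ y (subset_closure hy)).1).trans hMM₀) _
  -- In the rectangle and off the strip `N`, membership in `Ω` and in the model region `S` agree,
  -- leaving the Taylor error. On `N` the weight absorbs a possible mismatch.
  have key : ∀ z, |E z - S.indicator Q z| ≤ K₃ * h ^ 3 * weight z ^ 3 + 6 * M * N.indicator weight z := by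
    intro z
    have hw1 := one_le_weight z
    have hw0 : 0 ≤ weight z := by linarith
    have hN0 : 0 ≤ N.indicator weight z :=
      indicator_nonneg (fun z _ => (zero_le_one.trans (one_le_weight z))) z
    have hSQ : |S.indicator Q z| ≤ |Q z| := by
      simpa only [Real.norm_eq_abs] using norm_indicator_le_norm_self (s := S) Q z
    by_cases hin : h * |z.1| ≤ ρ ∧ h * |z.2| ≤ ρ
    · obtain ⟨hu, hw⟩ := hin
      have hy : x + h • (z.1 • τ + z.2 • ν) = b + ((h * z.1) • τ + (r + h * z.2) • ν) := by
        simp only [x]; module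
      have hu' : |h * z.1| ≤ ρ₀ := by rw [abs_mul, abs_of_pos h0]; linarith
      have hw' : |r + h * z.2| ≤ ρ₀ := by
        refine (abs_add_le _ _).trans ?_
        rw [abs_mul, abs_of_pos h0, abs_of_nonneg hr]; linarith
      obtain ⟨k1, k2⟩ := hsq _ _ hu' hw'
      rw [← hy] at k1 k2
      have hz : ‖h • (z.1 • τ + z.2 • ν)‖ ≤ h * (|z.1| + |z.2|) := by
        rw [norm_smul, Real.norm_of_nonneg h0.le]
        gcongr
        exact frame_norm_le hf _ _
      have hTz := hT₀ x hx (h • (z.1 • τ + z.2 • ν)) (by linarith)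
      rw [hQ] at hTz
      have hcube : (|z.1| + |z.2|) ^ 3 ≤ 4 * weight z ^ 3 := by
        have e1 : (|z.1| + |z.2|) ^ 2 ≤ 2 * weight z := by
          unfold weight
          nlinarith [sq_abs z.1, sq_abs z.2, sq_nonneg (|z.1| - |z.2|),
            mul_nonneg (sq_nonneg z.1) (sq_nonneg z.2)]
        have e2 : |z.1| + |z.2| ≤ 2 * weight z := by
          linarith [abs_fst_le_weight z, abs_snd_le_weight z]
        calc (|z.1| + |z.2|) ^ 3 = (|z.1| + |z.2|) ^ 2 * (|z.1| + |z.2|) := by ring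
          _ ≤ (2 * weight z) * (2 * weight z) := by gcongr
          _ = 4 * weight z ^ 2 := by ring
          _ ≤ 4 * weight z ^ 3 := by gcongr; norm_num
      have hFQ : |F (x + h • (z.1 • τ + z.2 • ν)) - Q z| ≤ K₃ * h ^ 3 * weight z ^ 3 := by
        refine hTz.trans ?_
        calc M₀ * ‖h • (z.1 • τ + z.2 • ν)‖ ^ 3 ≤ M * (h * (|z.1| + |z.2|)) ^ 3 := by gcongr
          _ = M * h ^ 3 * (|z.1| + |z.2|) ^ 3 := by ring
          _ ≤ M * h ^ 3 * (4 * weight z ^ 3) := by gcongr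
          _ = (4 * M) * h ^ 3 * weight z ^ 3 := by ring
          _ ≤ K₃ * h ^ 3 * weight z ^ 3 := by
            gcongr
            have : 0 ≤ 7 * M / ρ ^ 3 := by positivity
            linarith
      have hK0 : 0 ≤ K₃ * h ^ 3 * weight z ^ 3 := by positivity
      by_cases hzN : z ∈ N
      · rw [indicator_of_mem hzN]
        have hQz := hQb z
        by_cases hyΩ : x + h • (z.1 • τ + z.2 • ν) ∈ Ω
        · have hE : E z = F (x + h • (z.1 • τ + z.2 • ν)) := indicator_of_mem hyΩ F
          by_cases hzS : z ∈ S
          · rw [hE, indicator_of_mem hzS]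
            have : 0 ≤ 6 * M * weight z := by positivity
            linarith
          · rw [hE, indicator_of_notMem hzS, sub_zero]
            have := abs_sub_abs_le_abs_sub (F (x + h • (z.1 • τ + z.2 • ν))) (Q z)
            linarith
        · have hE : E z = 0 := indicator_of_notMem hyΩ F
          rw [hE, zero_sub, abs_neg]
          linarith
      · rw [indicator_of_notMem hzN, mul_zero, add_zero]
        have hzN' : C₀ * h ^ 3 * z.1 ^ 4 < |z.2 - s z.1| := not_le.1 hzN
        have hhs : h * s z.1 = -r + (κ / 2 * (h * z.1) ^ 2 + a * (h * z.1) ^ 3) := by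
          simp only [s, cubicGraph]; field_simp
        have hquart : C₀ * (h * z.1) ^ 4 = h * (C₀ * h ^ 3 * z.1 ^ 4) := by ring
        rw [hquart] at k1 k2
        rcases lt_abs.1 hzN' with hlt | hlt
        · have hzS : z ∈ S := by
            have : 0 ≤ C₀ * h ^ 3 * z.1 ^ 4 := by positivity
            exact (by linarith : s z.1 < z.2)
          have hyΩ : x + h • (z.1 • τ + z.2 • ν) ∈ Ω := by
            apply k1
            have := mul_lt_mul_of_pos_left hlt h0
            rw [mul_sub, hhs] at this
            linarith
          have hE : E z = F (x + h • (z.1 • τ + z.2 • ν)) := indicator_of_mem hyΩ F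
          rw [hE, indicator_of_mem hzS]
          exact hFQ
        · have hzS : z ∉ S := by
            have : 0 ≤ C₀ * h ^ 3 * z.1 ^ 4 := by positivity
            exact not_lt.2 (by linarith : z.2 ≤ s z.1)
          have hyΩ : x + h • (z.1 • τ + z.2 • ν) ∉ Ω := by
            apply k2
            have := mul_lt_mul_of_pos_left hlt h0
            rw [neg_sub, mul_sub, hhs] at this
            linarith
          have hE : E z = 0 := indicator_of_notMem hyΩ F
          rw [hE, indicator_of_notMem hzS, sub_zero, abs_zero]
          exact hK0
    -- Outside the rectangle, `h ^ 3 * weight z ^ 2 / ρ ^ 3 ≥ 1` buys the factor `h ^ 3` at the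
    -- price of polynomial growth.
    · have hbig : ρ ≤ h * |z.1| ∨ ρ ≤ h * |z.2| := by
        rcases not_and_or.1 hin with h' | h'
        · exact Or.inl (not_le.1 h').le
        · exact Or.inr (not_le.1 h').le
      have hcube : ρ ^ 3 ≤ h ^ 3 * weight z ^ 2 := by
        have e : ∀ v : ℝ, ρ ≤ h * |v| → v ^ 2 ≤ weight z → |v| ≤ weight z →
            ρ ^ 3 ≤ h ^ 3 * weight z ^ 2 := by
          intro v hv e1 e2
          calc ρ ^ 3 ≤ (h * |v|) ^ 3 := by gcongr
            _ = h ^ 3 * (v ^ 2 * |v|) := by rw [← sq_abs v]; ring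
            _ ≤ h ^ 3 * (weight z * weight z) := by gcongr
            _ = _ := by ring
        rcases hbig with h' | h'
        · exact e _ h' (sq_fst_le_weight z) (abs_fst_le_weight z)
        · exact e _ h' (sq_snd_le_weight z) (abs_snd_le_weight z)
      have hone : 1 ≤ h ^ 3 * weight z ^ 2 / ρ ^ 3 := by
        rw [le_div_iff₀ (by positivity), one_mul]; exact hcube
      have h7 : |E z - S.indicator Q z| ≤ 7 * M * weight z := by
        refine (abs_sub _ _).trans ?_
        have := hEb z
        have := hQb z
        have : M * 1 ≤ M * weight z := by gcongr
        linarith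
      calc |E z - S.indicator Q z| ≤ 7 * M * weight z * 1 := by rw [mul_one]; exact h7
        _ ≤ 7 * M * weight z * (h ^ 3 * weight z ^ 2 / ρ ^ 3) := by gcongr
        _ = (7 * M / ρ ^ 3) * h ^ 3 * weight z ^ 3 := by ring
        _ ≤ K₃ * h ^ 3 * weight z ^ 3 := by
          gcongr
          linarith
        _ ≤ _ := by
          have := mul_nonneg (by positivity : 0 ≤ 6 * M) hN0
          linarith
  obtain ⟨hNint, hNle⟩ := hstrip s hs (C₀ * h ^ 3) (by positivity)
  have hEint : Integrable fun z : ℝ × ℝ => E z * (gau z.1 * gau z.2) := by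
    have := integrable_indicator_mul_heat hΩ.isOpen hF.smooth.continuous hM
      (fun y hy => ((hbd₀ y (subset_closure hy)).1).trans hMM₀) h x
    rw [← integrable_frame hf] at this
    simpa only [heat_frame hf] using this
  have hQint := integrable_indicator_quadSource hM h0.le h1 hF0 hp hq hA hB hD hS
  have hdiff : |(∫ z : ℝ × ℝ, E z * (gau z.1 * gau z.2))
      - ∫ z : ℝ × ℝ, S.indicator Q z * (gau z.1 * gau z.2)|
      ≤ (K₃ * I + 6 * M * (K₂ * C₀)) * h ^ 3 := by
    rw [← integral_sub hEint hQint]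
    have hpt : ∀ z : ℝ × ℝ, ‖E z * (gau z.1 * gau z.2) - S.indicator Q z * (gau z.1 * gau z.2)‖
        ≤ K₃ * h ^ 3 * (weight z ^ 3 * (gau z.1 * gau z.2))
          + 6 * M * (N.indicator weight z * (gau z.1 * gau z.2)) := by
      intro z
      have hgg : 0 ≤ gau z.1 * gau z.2 := mul_nonneg (gau_nonneg _) (gau_nonneg _)
      rw [← sub_mul, norm_mul, Real.norm_of_nonneg hgg]
      refine (mul_le_mul_of_nonneg_right (key z) hgg).trans (le_of_eq ?_)
      ring
    have := norm_integral_le_of_norm_le ((hW.const_mul (K₃ * h ^ 3)).add (hNint.const_mul (6 * M)))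
      (Eventually.of_forall hpt)
    refine this.trans ?_
    rw [integral_add' (hW.const_mul (K₃ * h ^ 3)) (hNint.const_mul (6 * M)), integral_const_mul,
      integral_const_mul]
    calc _ ≤ K₃ * h ^ 3 * I + 6 * M * (K₂ * (C₀ * h ^ 3)) := by gcongr
      _ = _ := by ring
  have hmod := hmodel h h0 h1 (r / h) κ a (F x) p q A B D (by linarith) (by linarith) hF0 hp hq hA
    hB hD
  have e1 : h * (r / h) = r := by field_simp
  have e2 : 2 * A = D2 F x τ τ := by simp only [A]; ring
  have e3 : 2 * D = D2 F x ν ν := by simp only [D]; ring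
  rw [e1, e2, e3] at hmod
  rw [scaledIntegral_eq_frame Ω F h x hf]
  refine (abs_sub_le _ (∫ z : ℝ × ℝ, S.indicator Q z * (gau z.1 * gau z.2)) _).trans ?_
  rw [add_mul]
  exact add_le_add hdiff hmod

/-! ### Comparison of the two expansions away from the boundary -/

/-- The boundary layer functions are of third order in `h` at a fixed distance. -/
lemma exists_layer_bound {ρ : ℝ} (hρ : 0 < ρ) : ∃ c : ℝ, 0 ≤ c ∧ ∀ h r : ℝ, 0 < h → ρ ≤ r →
    tail (r / h) ≤ c * h ^ 3 ∧ gau (r / h) ≤ c * h ^ 3 ∧ r / h * gau (r / h) ≤ c * h ^ 3 := by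
  obtain ⟨C₁, hC₁, h₁⟩ := exists_pow_mul_tail_le 3
  obtain ⟨C₂, hC₂, h₂⟩ := exists_pow_mul_gau_le 3
  obtain ⟨C₃, hC₃, h₃⟩ := exists_pow_mul_gau_le 4
  refine ⟨(C₁ + C₂ + C₃) / ρ ^ 3, by positivity, fun h r h0 hr => ?_⟩
  have hpos : 0 < r / h := div_pos (hρ.trans_le hr) h0
  -- Each layer function, multiplied by `(r / h) ^ 3`, is bounded, and `r ≥ ρ`.
  have aux : ∀ {y C : ℝ}, 0 < C → C ≤ C₁ + C₂ + C₃ → (r / h) ^ 3 * y ≤ C →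
      y ≤ (C₁ + C₂ + C₃) / ρ ^ 3 * h ^ 3 := by
    intro y C hC hle hy
    have h4 : y ≤ C / (r / h) ^ 3 := by
      rw [le_div_iff₀ (by positivity)]; linarith
    refine h4.trans ?_
    calc C / (r / h) ^ 3 ≤ (C₁ + C₂ + C₃) / (ρ / h) ^ 3 := by gcongr
      _ = _ := by field_simp
  have k2 := h₂ (r / h)
  have k3 := h₃ (r / h)
  rw [abs_of_pos hpos] at k2 k3
  refine ⟨aux hC₁ (by linarith) (h₁ _ hpos.le), aux hC₂ (by linarith) k2,
    aux hC₃ (by linarith) ?_⟩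
  calc (r / h) ^ 3 * (r / h * gau (r / h)) = (r / h) ^ 4 * gau (r / h) := by ring
    _ ≤ C₃ := k3

lemma exists_profile_far_bound {ρ M : ℝ} (hρ : 0 < ρ) (hM : 0 ≤ M) : ∃ K : ℝ, 0 ≤ K ∧
    ∀ h r κ f₀ fη fξξ fηη : ℝ, 0 < h → h ≤ 1 → ρ ≤ r → |κ| ≤ M → |f₀| ≤ M → |fη| ≤ M →
      |fξξ| ≤ M → |fηη| ≤ M →
      |profile h r κ f₀ fη fξξ fηη - (f₀ + h ^ 2 * (fξξ + fηη))| ≤ K * h ^ 3 := by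
  obtain ⟨c, hc, hlayer⟩ := exists_layer_bound hρ
  refine ⟨(3 * M + (2 * M + M * M) + (M * M + M + M ^ 2 * M)) * c, by positivity, ?_⟩
  intro h r κ f₀ fη fξξ fηη h0 h1 hr hκ hf₀ hfη hfξξ hfηη
  obtain ⟨l1, l2, l3⟩ := hlayer h r h0 hr
  have hT := tail_nonneg (r / h)
  have hg := gau_nonneg (r / h)
  have hr0 : 0 ≤ r / h := div_nonneg (hρ.le.trans hr) h0.le
  have hh2 : h ^ 2 ≤ 1 := pow_le_one₀ h0.le h1
  -- The difference consists of layer terms alone; writing `h * r` as `h ^ 2 * (r / h)` keeps the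
  -- bound uniform for large `r`.
  have e : profile h r κ f₀ fη fξξ fηη - (f₀ + h ^ 2 * (fξξ + fηη))
      = -((f₀ + h ^ 2 * (fξξ + fηη)) * tail (r / h)) + (2 * fη - κ * f₀) * (h * gau (r / h))
        + (κ * fη - fηη - 3 / 4 * κ ^ 2 * f₀) * (h ^ 2 * (r / h * gau (r / h))) := by
    unfold profile
    have : h * r * gau (r / h) = h ^ 2 * (r / h * gau (r / h)) := by field_simp
    rw [this]
    ring
  have a1 : |f₀ + h ^ 2 * (fξξ + fηη)| ≤ 3 * M := by
    have k1 : |h ^ 2 * (fξξ + fηη)| ≤ 1 * (M + M) := by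
      rw [abs_mul, abs_of_nonneg (sq_nonneg h)]
      exact mul_le_mul hh2 ((abs_add_le _ _).trans (add_le_add hfξξ hfηη)) (abs_nonneg _)
        zero_le_one
    have := abs_add_le f₀ (h ^ 2 * (fξξ + fηη))
    linarith
  have a2 : |2 * fη - κ * f₀| ≤ 2 * M + M * M := by
    refine (abs_sub _ _).trans ?_
    rw [abs_mul, abs_mul, abs_two]
    gcongr
  have a3 : |κ * fη - fηη - 3 / 4 * κ ^ 2 * f₀| ≤ M * M + M + M ^ 2 * M := by
    refine (abs_sub _ _).trans (add_le_add ((abs_sub _ _).trans (add_le_add ?_ hfηη)) ?_)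
    · rw [abs_mul]; gcongr
    · rw [abs_mul, abs_mul, abs_pow, abs_of_nonneg (by norm_num : (0 : ℝ) ≤ 3 / 4)]
      have : |κ| ^ 2 ≤ M ^ 2 := by gcongr
      gcongr
      nlinarith [sq_nonneg |κ|]
  have g2 : |h * gau (r / h)| ≤ c * h ^ 3 := by
    rw [abs_of_nonneg (by positivity)]
    exact (mul_le_of_le_one_left hg h1).trans l2
  have g3 : |h ^ 2 * (r / h * gau (r / h))| ≤ c * h ^ 3 := by
    rw [abs_of_nonneg (by positivity)]
    exact (mul_le_of_le_one_left (by positivity) hh2).trans l3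
  rw [e]
  refine (abs_add_three _ _ _).trans ?_
  rw [abs_neg, abs_mul (f₀ + _), abs_mul (2 * fη - _), abs_mul (κ * fη - fηη - _),
    abs_of_nonneg hT]
  have m1 := mul_le_mul a1 l1 hT (by positivity)
  have m2 := mul_le_mul a2 g2 (abs_nonneg _) (by positivity)
  have m3 := mul_le_mul a3 g3 (abs_nonneg _) (by positivity)
  calc _ ≤ 3 * M * (c * h ^ 3) + (2 * M + M * M) * (c * h ^ 3)
        + (M * M + M + M ^ 2 * M) * (c * h ^ 3) := add_le_add (add_le_add m1 m2) m3
    _ = _ := by ring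

lemma exp_neg_sq_div_eq_gau {R h : ℝ} :
    Real.exp (-R ^ 2 / (4 * h ^ 2)) = 2 * √Real.pi * gau (R / h) := by
  have e : -(R / h) ^ 2 / 4 = -R ^ 2 / (4 * h ^ 2) := by
    rw [div_pow, ← neg_div, div_div, mul_comm (h ^ 2) 4]
  rw [gau, e]
  field_simp

lemma ball_subset_of_isClosest {Ω : Set Plane} (hΩ : IsOpen Ω) {x : Plane} (hx : x ∈ Ω) {R : ℝ}
    (h : ∀ z ∈ frontier Ω, R ≤ dist x z) : Metric.ball x R ⊆ Ω := by
  intro y hy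
  by_contra hyΩ
  obtain ⟨z, hz, hzf⟩ := (convex_segment x y).isPreconnected.inter_frontier_nonempty_of_isOpen hΩ
    ⟨x, left_mem_segment ℝ x y, hx⟩ ⟨y, right_mem_segment ℝ x y, hyΩ⟩
  have h1 := dist_add_dist_of_mem_segment hz
  have h2 := h z hzf
  rw [Metric.mem_ball, dist_comm] at hy
  linarith [dist_nonneg (x := z) (y := y)]

/-- Uniform expansion of the spatial integral at all points of the domain. -/
lemma exists_uniform_bound {Ω : Set Plane} (hΩ : IsSmoothDomain Ω) {f F : Plane → ℝ}
    (hF : IsSmoothExtension Ω f F) :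
    ∃ K : ℝ, 0 ≤ K ∧ ∀ x ∈ Ω, ∀ b, IsClosestBoundaryPoint Ω x b → ∀ (τ ν : Plane) (γ : ℝ → ℝ),
      IsTangentGraph Ω b τ ν γ → ∀ h : ℝ, 0 < h → h ≤ 1 →
        |scaledIntegral Ω F h x - profile h ‖b - x‖ (iteratedDeriv 2 γ 0) (F x)
          (D1 F x ν) (D2 F x τ τ) (D2 F x ν ν)| ≤ K * h ^ 3 := by
  obtain ⟨ρ, K₁, hρ, hK₁, hnear⟩ := exists_near_bound hΩ hF
  obtain ⟨K₂, hK₂, hfar⟩ := exists_far_bound hΩ hF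
  obtain ⟨M₀, hM₀, hbd₀, -⟩ := exists_taylor_bounds hΩ hF
  obtain ⟨ρ₀, C₀, -, hC₀, hgraph⟩ := exists_isSqueezedGraph hΩ
  set R := min ρ 1
  have hR : 0 < R := lt_min hρ one_pos
  obtain ⟨K₃, hK₃, hprof⟩ := exists_profile_far_bound (M := M₀ + C₀) hρ (by positivity)
  obtain ⟨c, hc, hlayer⟩ := exists_layer_bound hR
  refine ⟨K₁ + K₂ * (1 + 2 * √Real.pi * c) + K₃, by positivity, ?_⟩
  intro x hx b hb τ ν γ hγ h h0 h1
  have hh : 0 ≤ h ^ 3 := by positivity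
  -- Close to the boundary the graph expansion applies; otherwise a disc of radius `R` lies in the
  -- domain, and both `scaledIntegral` and `profile` are compared with the whole-plane expansion.
  rcases le_total ‖b - x‖ ρ with hle | hge
  · have hxe := eq_add_smul_of_isClosestBoundaryPoint hΩ.isOpen hx hb hγ
    have := hnear b hb.1 τ ν γ hγ ‖b - x‖ (norm_nonneg _) hle (hxe ▸ subset_closure hx) h h0 h1
    rw [← hxe] at this
    refine this.trans ?_
    gcongr
    have : 0 ≤ K₂ * (1 + 2 * √Real.pi * c) := by positivity
    linarith
  · have hball : Metric.ball x R ⊆ Ω := by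
      refine ball_subset_of_isClosest hΩ.isOpen hx fun z hz => ?_
      have h2 := hb.2 z hz
      rw [dist_eq_norm x b, norm_sub_rev] at h2
      exact (min_le_left _ _).trans (hge.trans h2)
    have k1 := hfar x hx R hR (min_le_right _ _) hball τ ν hγ.orthonormal h h0 h1
    obtain ⟨b0, b1, b2, -⟩ := hbd₀ x (subset_closure hx)
    have hτ1 := frame_norm_left hγ.orthonormal
    have hν1 := frame_norm_right hγ.orthonormal
    have c1 := b1 ν
    have c2 := b2 τ τ
    have c3 := b2 ν ν
    rw [hν1, mul_one] at c1
    rw [hτ1, mul_one, mul_one] at c2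
    rw [hν1, mul_one, mul_one] at c3
    have c4 := (hgraph b hb.1 τ ν γ hγ).1
    have k2 := hprof h ‖b - x‖ (iteratedDeriv 2 γ 0) (F x) (D1 F x ν) (D2 F x τ τ) (D2 F x ν ν)
      h0 h1 hge (by linarith) (by linarith) (by linarith) (by linarith) (by linarith)
    have k3 : h ^ 4 + Real.exp (-R ^ 2 / (4 * h ^ 2)) ≤ (1 + 2 * √Real.pi * c) * h ^ 3 := by
      rw [exp_neg_sq_div_eq_gau]
      have l2 := (hlayer h R h0 le_rfl).2.1
      have l3 : h ^ 4 ≤ h ^ 3 := pow_le_pow_of_le_one h0.le h1 (by norm_num)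
      have l4 : 2 * √Real.pi * gau (R / h) ≤ 2 * √Real.pi * (c * h ^ 3) := by gcongr
      linarith
    have k4 : K₂ * (h ^ 4 + Real.exp (-R ^ 2 / (4 * h ^ 2)))
        ≤ K₂ * ((1 + 2 * √Real.pi * c) * h ^ 3) := by gcongr
    have k5 := abs_sub_le (scaledIntegral Ω F h x)
      (F x + h ^ 2 * (D2 F x τ τ + D2 F x ν ν))
      (profile h ‖b - x‖ (iteratedDeriv 2 γ 0) (F x) (D1 F x ν) (D2 F x τ τ) (D2 F x ν ν))
    rw [abs_sub_comm] at k2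
    have := mul_nonneg hK₁ hh
    linarith

/-! ### From the spatial integral to the potential. -/

lemma rpow_five_halves {δ : ℝ} (hδ : 0 ≤ δ) : δ ^ (5 / 2 : ℝ) = √δ ^ 3 * δ := by
  rw [show (5 / 2 : ℝ) = (1 / 2 : ℝ) * ((5 : ℕ) : ℝ) by norm_num, Real.rpow_mul hδ,
    ← Real.sqrt_eq_rpow, Real.rpow_natCast]
  nth_rw 3 [← Real.sq_sqrt hδ]
  ring

/-- The potential at a point with a disc contained in the domain. -/
lemma exists_potential_far_bound {Ω : Set Plane} (hΩ : IsSmoothDomain Ω) {f F : Plane → ℝ}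
    (hF : IsSmoothExtension Ω f F) :
    ∃ K : ℝ, 0 ≤ K ∧ ∀ x ∈ Ω, ∀ R : ℝ, 0 < R → R ≤ 1 → Metric.ball x R ⊆ Ω →
      ∀ τ ν : Plane, Orthonormal ℝ ![τ, ν] → ∀ δ : ℝ, 0 < δ → δ ≤ 1 →
        |localVolumePotential Ω f δ x - (δ * f x + δ ^ 2 / 2 * (D2 f x τ τ + D2 f x ν ν))|
          ≤ K * (δ ^ 3 + δ * Real.exp (-R ^ 2 / (4 * δ))) := by
  obtain ⟨K, hK, hfar⟩ := exists_far_bound hΩ hF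
  obtain ⟨M, hM, hbd, -⟩ := exists_taylor_bounds hΩ hF
  refine ⟨K, hK, fun x hx R hR hR1 hball τ ν hf δ hδ hδ1 => ?_⟩
  rw [hF.eqOn hx, D2_eq_of_eqOn hΩ.isOpen hF.eqOn hx, D2_eq_of_eqOn hΩ.isOpen hF.eqOn hx]
  set L := D2 F x τ τ + D2 F x ν ν
  have hP : Continuous fun t : ℝ => F x + t * L := by fun_prop
  have hPi : ∫ t in (0 : ℝ)..δ, (F x + t * L) = δ * F x + δ ^ 2 / 2 * L := by
    rw [intervalIntegral.integral_add (by simp) (by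
      exact (Continuous.intervalIntegrable (by fun_prop) _ _)), intervalIntegral.integral_mul_const,
      integral_id]
    simp
  rw [← hPi]
  have := abs_localVolumePotential_sub_le hΩ.isOpen hF.eqOn hF.smooth.continuous hM
    (fun y hy => (hbd y (subset_closure hy)).1) x hδ (hP.intervalIntegrable 0 δ)
    (B := K * (δ ^ 2 + Real.exp (-R ^ 2 / (4 * δ)))) (fun t ht htδ => by
      have h := hfar x hx R hR hR1 hball τ ν hf (√t) (Real.sqrt_pos.2 ht)
        (Real.sqrt_le_one.2 (htδ.trans hδ1))
      rw [show √t ^ 4 = (√t ^ 2) ^ 2 by ring, Real.sq_sqrt ht.le] at h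
      refine h.trans ?_
      gcongr K * (?_ + Real.exp ?_)
      · gcongr
      -- The exponential increases with `t`, so its value at `t = δ` dominates on the interval.
      · rw [neg_div, neg_div, neg_le_neg_iff]
        gcongr)
  refine this.trans (le_of_eq ?_)
  ring

lemma exp_neg_le_two_div_sq {y : ℝ} (hy : 0 < y) : Real.exp (-y) ≤ 2 / y ^ 2 := by
  have h := Real.pow_div_factorial_le_exp y hy.le 2
  rw [Real.exp_neg, inv_le_comm₀ (Real.exp_pos _) (by positivity), inv_div]
  simpa [Nat.factorial] using h

/-- `exp (-y) ≤ 2 / y ^ 2` with `y = R ^ 2 / (4 δ)`; at a fixed radius the exponential term is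
absorbed in `δ ^ 3`. -/
lemma mul_exp_le_cube {δ R : ℝ} (hδ : 0 < δ) (hR : 0 < R) :
    δ * Real.exp (-R ^ 2 / (4 * δ)) ≤ 32 / R ^ 4 * δ ^ 3 := by
  have h := exp_neg_le_two_div_sq (y := R ^ 2 / (4 * δ)) (by positivity)
  rw [← neg_div] at h
  calc _ ≤ δ * (2 / (R ^ 2 / (4 * δ)) ^ 2) := by gcongr
    _ = _ := by field_simp; ring

end HeatVol

/-! ### The four expansions. -/

theorem lemma4p5 (Ω : Set HeatVol.Plane) (hΩ : HeatVol.IsSmoothDomain Ω)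
    (f F : HeatVol.Plane → ℝ) (hF : HeatVol.IsSmoothExtension Ω f F) :
    -- the expansion at points of `Ω`, uniformly in the point
    (∃ C δ₀ : ℝ, 0 < δ₀ ∧ ∀ δ : ℝ, 0 < δ → δ ≤ δ₀ →
      ∀ x ∈ Ω, ∀ b : HeatVol.Plane, HeatVol.IsClosestBoundaryPoint Ω x b →
      ∀ (τ ν : HeatVol.Plane) (γ : ℝ → ℝ), HeatVol.IsTangentGraph Ω b τ ν γ →
        |HeatVol.localVolumePotential Ω f δ x
          - HeatVol.expansion δ (‖b - x‖ / Real.sqrt δ) (iteratedDeriv 2 γ 0)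
              (f x) (HeatVol.D1 f x ν) (HeatVol.D2 f x τ τ) (HeatVol.D2 f x ν ν)|
          ≤ C * δ ^ (5 / 2 : ℝ)) ∧
    -- points away from the boundary, up to an exponentially small term
    (∃ C δ₀ : ℝ, 0 < δ₀ ∧ ∀ δ : ℝ, 0 < δ → δ ≤ δ₀ →
      ∀ x ∈ Ω, 12 * Real.sqrt δ < Metric.infDist x (frontier Ω) →
      ∀ τ ν : HeatVol.Plane, Orthonormal ℝ ![τ, ν] →
        |HeatVol.localVolumePotential Ω f δ x
          - (δ * f x + δ ^ 2 / 2 * (HeatVol.D2 f x τ τ + HeatVol.D2 f x ν ν))|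
          ≤ C * (δ ^ 3 + δ * Real.exp (-(Metric.infDist x (frontier Ω)) ^ 2 / (4 * δ)))) ∧
    -- a fixed point of `Ω`
    (∀ x ∈ Ω, ∀ τ ν : HeatVol.Plane, Orthonormal ℝ ![τ, ν] →
      Asymptotics.IsBigO (nhdsWithin (0 : ℝ) (Set.Ioi 0))
        (fun δ : ℝ => HeatVol.localVolumePotential Ω f δ x
          - (δ * f x + δ ^ 2 / 2 * (HeatVol.D2 f x τ τ + HeatVol.D2 f x ν ν)))
        (fun δ : ℝ => δ ^ 3)) ∧
    -- points on the boundary, uniformly in the point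
    (∃ C δ₀ : ℝ, 0 < δ₀ ∧ ∀ δ : ℝ, 0 < δ → δ ≤ δ₀ →
      ∀ b ∈ frontier Ω,
      ∀ (τ ν : HeatVol.Plane) (γ : ℝ → ℝ), HeatVol.IsTangentGraph Ω b τ ν γ →
        |HeatVol.localVolumePotential Ω f δ b
          - (δ / 2 * F b
            + δ ^ (3 / 2 : ℝ) / (3 * Real.sqrt Real.pi)
              * (2 * HeatVol.D1 F b ν - iteratedDeriv 2 γ 0 * F b)
            + δ ^ 2 / 4 * (HeatVol.D2 F b τ τ + HeatVol.D2 F b ν ν))|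
          ≤ C * δ ^ (5 / 2 : ℝ)) := by
  have hfr : ∀ b ∈ frontier Ω, b ∈ closure Ω := fun b hb => frontier_subset_closure hb
  obtain ⟨M, hM, hbd, -⟩ := HeatVol.exists_taylor_bounds hΩ hF
  have hb : ∀ y ∈ Ω, |F y| ≤ M := fun y hy => (hbd y (subset_closure hy)).1
  have hFc := hF.smooth.continuous
  obtain ⟨K₂, hK₂, hfar⟩ := HeatVol.exists_potential_far_bound hΩ hF
  refine ⟨?_, ?_, ?_, ?_⟩
  · obtain ⟨K, hK, hunif⟩ := HeatVol.exists_uniform_bound hΩ hF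
    refine ⟨K, 1, one_pos, fun δ hδ hδ1 x hx b hbx τ ν γ hγ => ?_⟩
    rw [hF.eqOn hx, HeatVol.D1_eq_of_eqOn hΩ.isOpen hF.eqOn hx,
      HeatVol.D2_eq_of_eqOn hΩ.isOpen hF.eqOn hx, HeatVol.D2_eq_of_eqOn hΩ.isOpen hF.eqOn hx,
      ← HeatVol.integral_profile (norm_nonneg _) _ _ _ _ _ hδ, HeatVol.rpow_five_halves hδ.le,
      ← mul_assoc]
    refine HeatVol.abs_localVolumePotential_sub_le hΩ.isOpen hF.eqOn hFc hM hb x hδ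
      (HeatVol.intervalIntegrable_profile (norm_nonneg _) _ _ _ _ _ hδ.le) fun t ht htδ => ?_
    refine (hunif x hx b hbx τ ν γ hγ (√t) (Real.sqrt_pos.2 ht)
      (Real.sqrt_le_one.2 (htδ.trans hδ1))).trans ?_
    have := Real.sqrt_le_sqrt htδ
    gcongr
  · refine ⟨33 * K₂, 1, one_pos, fun δ hδ hδ1 x hx hd τ ν hf => ?_⟩
    set d := Metric.infDist x (frontier Ω)
    -- `Metric.infDist` to the empty set is zero, so a positive distance also excludes a domain
    -- without boundary.
    have hd0 : 0 < d := (mul_nonneg (by norm_num) (Real.sqrt_nonneg δ)).trans_lt hd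
    have hball : Metric.ball x (min d 1) ⊆ Ω :=
      HeatVol.ball_subset_of_isClosest hΩ.isOpen hx fun z hz =>
        (min_le_left _ _).trans (Metric.infDist_le_dist_of_mem hz)
    refine (hfar x hx (min d 1) (lt_min hd0 one_pos) (min_le_right _ _) hball τ ν hf δ hδ
      hδ1).trans ?_
    have hE : 0 ≤ δ * Real.exp (-d ^ 2 / (4 * δ)) := by positivity
    -- The disc is capped at radius one; when `d > 1` the exponential at radius one is at most `32 δ
    -- ^ 3`, whence `33 = 1 + 32`.
    have hle : δ * Real.exp (-(min d 1) ^ 2 / (4 * δ))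
        ≤ δ * Real.exp (-d ^ 2 / (4 * δ)) + 32 * δ ^ 3 := by
      rcases le_total d 1 with h | h
      · rw [min_eq_left h]
        linarith [pow_pos hδ 3]
      · rw [min_eq_right h]
        have := HeatVol.mul_exp_le_cube hδ one_pos
        norm_num at this ⊢
        linarith
    have h3 : δ ^ 3 + δ * Real.exp (-(min d 1) ^ 2 / (4 * δ))
        ≤ 33 * (δ ^ 3 + δ * Real.exp (-d ^ 2 / (4 * δ))) := by linarith
    calc _ ≤ K₂ * (33 * (δ ^ 3 + δ * Real.exp (-d ^ 2 / (4 * δ)))) := by gcongr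
      _ = _ := by ring
  · intro x hx τ ν hf
    obtain ⟨R, hR, hball⟩ := Metric.isOpen_iff.1 hΩ.isOpen x hx
    have hR' : 0 < min R 1 := lt_min hR one_pos
    refine Asymptotics.IsBigO.of_bound (K₂ * (1 + 32 / (min R 1) ^ 4)) ?_
    filter_upwards [Ioc_mem_nhdsGT one_pos] with δ hδ
    rw [Real.norm_eq_abs, Real.norm_of_nonneg (pow_pos hδ.1 3).le]
    refine (hfar x hx (min R 1) hR' (min_le_right _ _)
      ((Metric.ball_subset_ball (min_le_left _ _)).trans hball) τ ν hf δ hδ.1 hδ.2).trans ?_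
    have := HeatVol.mul_exp_le_cube hδ.1 hR'
    calc _ ≤ K₂ * (δ ^ 3 + 32 / (min R 1) ^ 4 * δ ^ 3) := by gcongr
      _ = _ := by ring
  · obtain ⟨ρ, K, hρ, hK, hnear⟩ := HeatVol.exists_near_bound hΩ hF
    refine ⟨K, 1, one_pos, fun δ hδ hδ1 b hbf τ ν γ hγ => ?_⟩
    -- The boundary formula is the general expansion at `c = 0`, where `erf` vanishes.
    have hexp : δ / 2 * F b + δ ^ (3 / 2 : ℝ) / (3 * Real.sqrt Real.pi)
          * (2 * HeatVol.D1 F b ν - iteratedDeriv 2 γ 0 * F b)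
        + δ ^ 2 / 4 * (HeatVol.D2 F b τ τ + HeatVol.D2 F b ν ν)
        = HeatVol.expansion δ (0 / √δ) (iteratedDeriv 2 γ 0) (F b) (HeatVol.D1 F b ν)
          (HeatVol.D2 F b τ τ) (HeatVol.D2 F b ν ν) := by
      have hp : √Real.pi ≠ 0 := by positivity
      have h0 : HeatVol.erf 0 = 0 := by simp [HeatVol.erf]
      simp only [HeatVol.expansion, HeatVol.erfc, zero_div, h0]
      norm_num
      field_simp
      ring
    rw [hexp, ← HeatVol.integral_profile le_rfl _ _ _ _ _ hδ, HeatVol.rpow_five_halves hδ.le,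
      ← mul_assoc]
    refine HeatVol.abs_localVolumePotential_sub_le hΩ.isOpen hF.eqOn hFc hM hb b hδ
      (HeatVol.intervalIntegrable_profile le_rfl _ _ _ _ _ hδ.le) fun t ht htδ => ?_
    have h := hnear b hbf τ ν γ hγ 0 le_rfl hρ.le (by simpa using hfr b hbf) (√t)
      (Real.sqrt_pos.2 ht) (Real.sqrt_le_one.2 (htδ.trans hδ1))
    rw [zero_smul, add_zero] at h
    refine h.trans ?_
    have := Real.sqrt_le_sqrt htδ
    gcongr
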